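/- Let $G$ be a second countable locally compact Hausdorff groupoid with unit space $G^{(0)}$, range and source maps $r,s$, and a (left) Haar system $\{\lambda^u\}_{u\in G^{(0)}}$; let $\lambda_u$ be the image of $\lambda^u$ under $x\mapsto x^{-1}$. Let $p:\mathcal B\to G$ be a Fell bundle: a separable upper semicontinuous Banach bundle with enough sections (separable meaning that $\Gamma_0(G;\mathcal B)$ is separable in the supremum norm), with a continuous bilinear associative multiplication $(a,b)\mapsto ab$ defined when $(p(a),p(b))$ is composable and a continuous conjugate-linear involution $b\mapsto b^*$, such that $p(ab)=p(a)p(b)$, $p(b^*)=p(b)^{-1}$, $(ab)^*=b^*a^*$, each fibre $B(u)$ with $u\in G^{(0)}$ is a $C^*$-algebra, and each fibre $B(x)$ is a $B(r(x))$–$B(s(x))$-imprimitivity bimodule with inner products $ab^*$ and $a^*b$. Let $\Gamma_c(G;\mathcal B)$ be the space of continuous compactly supported sections, with $$f*g(x)=\int_G f(y)g(y^{-1}x)\,d\lambda^{r(x)}(y),\qquad f^*(x)=f(x^{-1})^*,$$ $$\|f\|_I=\max\Bigl(\sup_{u}\int_G\|f(x)\|\,d\lambda^u(x),\ \sup_u\int_G\|f(x)\|\,d\lambda_u(x)\Bigr).$$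 Let $\mu$ be a Radon measure on $G^{(0)}$ that is quasi-invariant, that is, $\nu=\int_{G^{(0)}}\lambda^u\,d\mu(u)$ and its image $\nu^{-1}$ under inversion are equivalent, and let $\Delta=d\nu/d\nu^{-1}$. Let $G^{(0)}*\mathcal H$ be a Borel Hilbert bundle with fibres $\mathcal H(u)$. Let $\pi$ be a Borel $*$-functor from $\mathcal B$ to $\operatorname{End}(G^{(0)}*\mathcal H)$: operators $\pi(b)\in B(\mathcal H(s(b)),\mathcal H(r(b)))$ for $b\in\mathcal B$ (writing $r(b)=r(p(b))$ and $s(b)=s(p(b))$), linear on each fibre, with $\pi(ab)=\pi(a)\pi(b)$ whenever $ab$ is defined and $\pi(b^*)=\pi(b)^*$, such that for every $f\in\Gamma_c(G;\mathcal B)$ and all Borel sections $\xi,\eta$ of $G^{(0)}*\mathcal H$ the function $x\mapsto\langle\pi(f(x))\xi(s(x)),\eta(r(x))\rangle$ is Borel. Then there is a unique linear map $L:\Gamma_c(G;\mathcal B)\to B\bigl(L^2(G^{(0)}*\mathcal H,\mu)\bigr)$, the integrated form of $\pi$, such that for all $f\in\Gamma_c(G;\mathcal B)$ and all square-integrable Borel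 sections $\xi,\eta$, $$\langle L(f)\xi,\eta\rangle=\int_G\langle\pi(f(x))\xi(s(x)),\eta(r(x))\rangle\,\Delta(x)^{-1/2}\,d\nu(x),$$ the integrand being $\nu$-integrable, and $L$ is an $I$-norm bounded $*$-homomorphism: $\|L(f)\|\le\|f\|_I$, $f*g\in\Gamma_c(G;\mathcal B)$ with $L(f*g)=L(f)L(g)$, and $L(f^*)=L(f)^*$ for all $f,g\in\Gamma_c(G;\mathcal B)$. -/

import Mathlib

open MeasureTheory Set Filter Topology
open scoped ENNReal InnerProductSpace

universe u₀ u v w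

/-! ## Topological groupoids and Haar systems -/

/-- A topological groupoid with unit space `G₀` and space of arrows `G`. The product `x * y` is
composition and is meaningful only for composable pairs, that is, when `s x = r y`; its values on
other pairs are irrelevant and no axiom mentions them. `one` embeds `G₀` in `G` as the set of
units. -/
class TopologicalGroupoid (G₀ : outParam (Type u₀)) (G : Type u)
    [TopologicalSpace G₀] [TopologicalSpace G] extends Mul G, Inv G where
  /-- range map -/
  r : G → G₀
  /-- source map -/
  s : G → G₀
  /-- inclusion of the unit space -/
  one : G₀ → G
  r_one : ∀ a, r (one a) = a
  s_one : ∀ a, s (one a) = a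
  r_mul : ∀ x y, s x = r y → r (x * y) = r x
  s_mul : ∀ x y, s x = r y → s (x * y) = s y
  mul_assoc : ∀ x y z, s x = r y → s y = r z → (x * y) * z = x * (y * z)
  one_mul : ∀ x, one (r x) * x = x
  mul_one : ∀ x, x * one (s x) = x
  r_inv : ∀ x, r x⁻¹ = s x
  s_inv : ∀ x, s x⁻¹ = r x
  mul_inv : ∀ x, x * x⁻¹ = one (r x)
  inv_mul : ∀ x, x⁻¹ * x = one (s x)
  continuous_r : Continuous r
  continuous_s : Continuous s
  continuous_one : Continuous one
  continuousOn_mul : ContinuousOn (fun q : G × G => q.1 * q.2) {q | s q.1 = r q.2}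
  continuous_inv : Continuous (fun x : G => x⁻¹)

namespace TopologicalGroupoid

variable {G₀ : Type u₀} {G : Type u} [TopologicalSpace G₀] [TopologicalSpace G]
  [TopologicalGroupoid G₀ G]

theorem inv_inv (x : G) : x⁻¹⁻¹ = x := by
  have h1 : x⁻¹⁻¹ = x⁻¹⁻¹ * one (s x⁻¹⁻¹) := (mul_one _).symm
  have e1 : s x⁻¹⁻¹ = s x := by rw [s_inv, r_inv]
  rw [h1, e1, ← inv_mul x, ← mul_assoc _ _ _ (by rw [s_inv]) (by rw [s_inv]), inv_mul, s_inv,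
    one_mul]

theorem composable_conv {x y : G} (h : r y = r x) : s y = r (y⁻¹ * x) := by
  rw [r_mul _ _ (by rw [s_inv, h]), r_inv]

end TopologicalGroupoid

/-- A (left) Haar system on a topological groupoid: Radon measures `lam a` on `G`, with support
equal to `{x | r x = a}`, depending continuously on `a` and left invariant. (For the second
countable locally compact Hausdorff groupoids considered below, a locally finite Borel measure is
a Radon measure.) -/
structure HaarSystem (G₀ : Type u₀) (G : Type u) [TopologicalSpace G₀] [TopologicalSpace G]
    [TopologicalGroupoid G₀ G] [MeasurableSpace G] where
  lam : G₀ → Measure G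
  locallyFinite : ∀ a, IsLocallyFiniteMeasure (lam a)
  null_off_fibre : ∀ a, lam a {x | TopologicalGroupoid.r x ≠ a} = 0
  pos_of_isOpen : ∀ a, ∀ U : Set G, IsOpen U → (∃ x ∈ U, TopologicalGroupoid.r x = a) →
    0 < lam a U
  continuous_integral : ∀ f : G → ℝ, Continuous f → HasCompactSupport f →
    Continuous (fun a => ∫ x, f x ∂(lam a))
  left_invariant : ∀ f : G → ℝ, Continuous f → HasCompactSupport f → ∀ x : G,
    ∫ y, f (x * y) ∂(lam (TopologicalGroupoid.s x)) = ∫ y, f y ∂(lam (TopologicalGroupoid.r x))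

namespace HaarSystem

variable {G₀ : Type u₀} {G : Type u} [TopologicalSpace G₀] [TopologicalSpace G]
  [TopologicalGroupoid G₀ G] [MeasurableSpace G]

/-- `a ↦ λ^a(E)` is Borel for Borel `E`; hence `Measure.bind` below has its intended meaning. -/
theorem measurable_lam [MeasurableSpace G₀] [BorelSpace G₀] [BorelSpace G] [T2Space G]
    [LocallyCompactSpace G] [SecondCountableTopology G] (lam : HaarSystem G₀ G) :
    Measurable lam.lam := by
  have hlf := lam.locallyFinite
  have hK : ∀ K : Set G, IsCompact K → Measurable fun a => lam.lam a K := by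
    intro K hK
    have h : (fun a => lam.lam a K) = fun a => ⨅ (f : G → ℝ) (_ : Continuous f)
        (_ : HasCompactSupport f) (_ : EqOn f 1 K) (_ : 0 ≤ f),
        ENNReal.ofReal (∫ x, f x ∂(lam.lam a)) := by
      funext a
      exact hK.measure_eq_biInf_integral_hasCompactSupport (lam.lam a)
    rw [h]
    refine UpperSemicontinuous.measurable ?_
    refine upperSemicontinuous_iInf fun f => upperSemicontinuous_iInf fun hf =>
      upperSemicontinuous_iInf fun hc => upperSemicontinuous_iInf fun _ =>
      upperSemicontinuous_iInf fun _ => ?_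
    exact (ENNReal.continuous_ofReal.comp (lam.continuous_integral f hf hc)).upperSemicontinuous
  let c := CompactExhaustion.choice G
  have hn : ∀ n, Measurable fun a => (lam.lam a).restrict (c n) := by
    intro n
    have hfin : ∀ a, IsFiniteMeasure ((lam.lam a).restrict (c n)) := fun a =>
      ⟨by simpa using (c.isCompact n).measure_lt_top⟩
    refine Measurable.measure_of_isPiSystem (S := {C : Set G | IsClosed C})
      (BorelSpace.measurable_eq.trans borel_eq_generateFrom_isClosed) isPiSystem_isClosed ?_ ?_
    · intro C hC
      simp only [Measure.restrict_apply (IsClosed.measurableSet hC)]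
      exact hK _ ((c.isCompact n).inter_left hC)
    · simpa using hK _ (c.isCompact n)
  refine Measure.measurable_of_measurable_coe _ fun E hE => ?_
  have h : (fun a => lam.lam a E) = fun a => ⨆ n, (lam.lam a).restrict (c n) E := by
    funext a
    have hmono : Monotone fun n => E ∩ c n := fun i j hij =>
      inter_subset_inter_right _ (c.subset hij)
    simp only [Measure.restrict_apply hE]
    rw [← hmono.measure_iUnion, ← inter_iUnion, c.iUnion_eq, inter_univ]
  rw [h]
  exact Measurable.iSup fun n => (Measure.measurable_coe hE).comp (hn n)

/-- The measure `λ_a`, the image of `λ^a` under inversion. -/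
noncomputable def lamInv (lam : HaarSystem G₀ G) (a : G₀) : Measure G :=
  (lam.lam a).map (fun x : G => x⁻¹)

/-- The measure `ν = μ ∘ λ`, `ν(E) = ∫ λ^a(E) dμ(a)`. -/
noncomputable def nu [MeasurableSpace G₀] (lam : HaarSystem G₀ G) (μ : Measure G₀) : Measure G :=
  μ.bind lam.lam

/-- The measure `ν⁻¹`, the image of `ν` under inversion. -/
noncomputable def nuInv [MeasurableSpace G₀] (lam : HaarSystem G₀ G) (μ : Measure G₀) :
    Measure G :=
  (lam.nu μ).map (fun x : G => x⁻¹)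

/-- `μ` is quasi-invariant if `ν` and `ν⁻¹` are equivalent. -/
def QuasiInvariant [MeasurableSpace G₀] (lam : HaarSystem G₀ G) (μ : Measure G₀) : Prop :=
  lam.nu μ ≪ lam.nuInv μ ∧ lam.nuInv μ ≪ lam.nu μ

/-- The Radon-Nikodym derivative `Δ = dν/dν⁻¹`. -/
noncomputable def Delta [MeasurableSpace G₀] (lam : HaarSystem G₀ G) (μ : Measure G₀) (x : G) :
    ℝ :=
  ((lam.nu μ).rnDeriv (lam.nuInv μ) x).toReal

end HaarSystem

/-! ## Upper semicontinuous Banach bundles and Fell bundles -/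

/-- The total space of a family `E`, consisting of pairs `⟨x, a⟩` with `a ∈ E x`. -/
abbrev Tot {X : Type u} (E : X → Type v) : Type (max u v) := Bundle.TotalSpace PUnit.{1} E

namespace Tot

variable {X : Type u} {E : X → Type v}

/-- The element of the fibre `E x` given by a point of the total space lying over `x`
(and `0` if the point does not lie over `x`). -/
noncomputable def toFib [∀ x, Zero (E x)] (x : X) (b : Tot E) : E x :=
  open Classical in if h : b.proj = x then h ▸ b.snd else 0

theorem mk_toFib [∀ x, Zero (E x)] {x : X} {b : Tot E} (h : b.proj = x) :
    (⟨x, toFib x b⟩ : Tot E) = b := by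
  subst h
  simp [toFib]

theorem toFib_mk [∀ x, Zero (E x)] {x : X} (a : E x) : toFib x (⟨x, a⟩ : Tot E) = a := by
  simp [toFib]

end Tot

/-- An upper semicontinuous Banach bundle over `X` with fibres the Banach spaces `E x` and a given
topology on the total space, having enough sections. (The projection is surjective because every
fibre contains `0`.) -/
class USCBanachBundle {X : Type u} [TopologicalSpace X] (E : X → Type v)
    [∀ x, NormedAddCommGroup (E x)] [∀ x, NormedSpace ℂ (E x)] [∀ x, CompleteSpace (E x)]
    [TopologicalSpace (Tot E)] : Prop where
  continuous_proj : Continuous (fun a : Tot E => a.proj)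
  isOpenMap_proj : IsOpenMap (fun a : Tot E => a.proj)
  usc_norm : UpperSemicontinuous (fun a : Tot E => ‖a.snd‖)
  continuousOn_add : ContinuousOn
    (fun q : Tot E × Tot E => (⟨q.1.proj, q.1.snd + Tot.toFib q.1.proj q.2⟩ : Tot E))
    {q | q.1.proj = q.2.proj}
  continuous_smul : ∀ c : ℂ, Continuous (fun a : Tot E => (⟨a.proj, c • a.snd⟩ : Tot E))
  tendsto_zero : ∀ (x : X) (l : Filter (Tot E)), Tendsto (fun a : Tot E => a.proj) l (𝓝 x) →
    Tendsto (fun a : Tot E => ‖a.snd‖) l (𝓝 0) → l ≤ 𝓝 (⟨x, 0⟩ : Tot E)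
  enough_sections : ∀ (x : X) (a : E x), ∃ f : ∀ y, E y,
    Continuous (fun y => (⟨y, f y⟩ : Tot E)) ∧ f x = a

section Sections

variable {X : Type u} [TopologicalSpace X] (E : X → Type v)
  [∀ x, NormedAddCommGroup (E x)] [∀ x, NormedSpace ℂ (E x)] [∀ x, CompleteSpace (E x)]
  [TopologicalSpace (Tot E)]

/-- The sections vanishing at infinity. -/
def Gamma0 : Set (∀ x, E x) :=
  {f | Continuous (fun x => (⟨x, f x⟩ : Tot E)) ∧ ∀ ε : ℝ, 0 < ε → IsCompact {x | ε ≤ ‖f x‖}}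

/-- The bundle is separable: `Γ₀(X; E)` is separable in the supremum norm. -/
def SeparableBundle : Prop :=
  ∃ D : Set (∀ x, E x), D.Countable ∧ D ⊆ Gamma0 E ∧
    ∀ f ∈ Gamma0 E, ∀ ε : ℝ, 0 < ε → ∃ d ∈ D, ∀ x, ‖f x - d x‖ ≤ ε

variable [USCBanachBundle E]

/-- The complex vector space `Γ_c(X; E)` of continuous compactly supported sections. -/
def GammaC : Submodule ℂ (∀ x, E x) where
  carrier := {f | Continuous (fun x => (⟨x, f x⟩ : Tot E)) ∧ IsCompact (closure {x | f x ≠ 0})}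
  add_mem' := by
    rintro f g ⟨hf, hf'⟩ ⟨hg, hg'⟩
    refine ⟨?_, ?_⟩
    · have h := (USCBanachBundle.continuousOn_add (E := E)).comp_continuous
        (hf.prodMk hg) (fun x => rfl)
      simpa [Tot.toFib_mk, Function.comp_def] using h
    · refine (hf'.union hg').of_isClosed_subset isClosed_closure ?_
      rw [← closure_union]
      refine closure_mono fun x hx => ?_
      by_contra hc
      simp only [mem_union, mem_ofPred_eq, not_or, not_not] at hc
      exact hx (by simp [hc.1, hc.2])
  zero_mem' := by
    refine ⟨?_, by simp⟩
    rw [continuous_iff_continuousAt]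
    intro x
    refine USCBanachBundle.tendsto_zero x _ ?_ ?_
    · rw [tendsto_map'_iff]; exact tendsto_id
    · rw [tendsto_map'_iff]; simp [Function.comp_def]
  smul_mem' := by
    rintro c f ⟨hf, hf'⟩
    refine ⟨(USCBanachBundle.continuous_smul (E := E) c).comp hf, ?_⟩
    refine hf'.of_isClosed_subset isClosed_closure (closure_mono fun x hx hc => hx ?_)
    simp [hc]

end Sections

open TopologicalGroupoid in
/-- A Fell bundle over the groupoid `G` with fibres `E x`. -/
class FellBundle {G₀ : Type u₀} {G : Type u} [TopologicalSpace G₀] [TopologicalSpace G]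
    [TopologicalGroupoid G₀ G] (E : G → Type v)
    [∀ x, NormedAddCommGroup (E x)] [∀ x, NormedSpace ℂ (E x)] [∀ x, CompleteSpace (E x)]
    [TopologicalSpace (Tot E)] extends USCBanachBundle E where
  separable : SeparableBundle E
  /-- multiplication, bilinear, mapping `E x × E y` to `E (x * y)` for composable `x`, `y` -/
  m : ∀ {x y : G}, s x = r y → E x →ₗ[ℂ] E y →ₗ[ℂ] E (x * y)
  /-- involution, conjugate linear, mapping `E x` to `E x⁻¹` -/
  st : ∀ {x : G}, E x →ₛₗ[starRingEnd ℂ] E x⁻¹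
  continuous_m : Continuous (fun q : {q : Tot E × Tot E // s q.1.proj = r q.2.proj} =>
    (⟨q.1.1.proj * q.1.2.proj, m q.2 q.1.1.snd q.1.2.snd⟩ : Tot E))
  continuous_st : Continuous (fun a : Tot E => (⟨a.proj⁻¹, st a.snd⟩ : Tot E))
  m_assoc : ∀ {x y z : G} (hxy : s x = r y) (hyz : s y = r z) (a : E x) (b : E y) (c : E z),
    (⟨x * y * z, m ((s_mul x y hxy).trans hyz) (m hxy a b) c⟩ : Tot E) =
      ⟨x * (y * z), m (hxy.trans (r_mul y z hyz).symm) a (m hyz b c)⟩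
  st_st : ∀ {x : G} (a : E x), (⟨x⁻¹⁻¹, st (st a)⟩ : Tot E) = ⟨x, a⟩
  st_m : ∀ {x y : G} (h : s x = r y) (a : E x) (b : E y),
    (⟨(x * y)⁻¹, st (m h a b)⟩ : Tot E) =
      ⟨y⁻¹ * x⁻¹, m (((s_inv y).trans h.symm).trans (r_inv x).symm) (st b) (st a)⟩
  /-- For a unit `e`, the Banach space `E e` is a `C*`-algebra: the norm is submultiplicative ... -/
  norm_m_unit : ∀ (e : G₀) (a b : E (one e)),
    ‖m ((s_one e).trans (r_one e).symm) a b‖ ≤ ‖a‖ * ‖b‖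
  /-- ... and satisfies the `C*`-identity. -/
  cstar_unit : ∀ (e : G₀) (a : E (one e)),
    ‖m (s_inv (one e)) (st a) a‖ = ‖a‖ ^ 2
  /-- `E x` is a right Hilbert `E (s x)`-module with `⟨a, b⟩ = a* b`: positivity of `⟨a, a⟩`
  in the `C*`-algebra `E (s x)` (a positive element is one of the form `c* c`), ... -/
  right_pos : ∀ {x : G} (a : E x), ∃ c : E (one (s x)),
    (⟨x⁻¹ * x, m (s_inv x) (st a) a⟩ : Tot E) =
      ⟨(one (s x))⁻¹ * one (s x), m (s_inv (one (s x))) (st c) c⟩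
  /-- ... the norm of `E x` is the Hilbert module norm, ... -/
  right_norm : ∀ {x : G} (a : E x), ‖m (s_inv x) (st a) a‖ = ‖a‖ ^ 2
  /-- ... and the module is full. -/
  right_full : ∀ x : G, closure (Submodule.span ℂ
    {c : E (x⁻¹ * x) | ∃ a b : E x, c = m (s_inv x) (st a) b} : Set (E (x⁻¹ * x))) = univ
  /-- `E x` is a left Hilbert `E (r x)`-module with `⟨a, b⟩ = a b*`: positivity, ... -/
  left_pos : ∀ {x : G} (a : E x), ∃ c : E (one (r x)),
    (⟨x * x⁻¹, m (r_inv x).symm a (st a)⟩ : Tot E) =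
      ⟨(one (r x))⁻¹ * one (r x), m (s_inv (one (r x))) (st c) c⟩
  /-- ... norm, ... -/
  left_norm : ∀ {x : G} (a : E x), ‖m (r_inv x).symm a (st a)‖ = ‖a‖ ^ 2
  /-- ... and fullness. (The remaining axioms of an imprimitivity bimodule, that
  `⟨a, b⟩ c = a ⟨b, c⟩` and that each algebra acts by adjointable operators, are instances of
  associativity and of the rule `(ab)* = b* a*`.) -/
  left_full : ∀ x : G, closure (Submodule.span ℂ
    {c : E (x * x⁻¹) | ∃ a b : E x, c = m (r_inv x).symm a (st b)} : Set (E (x * x⁻¹))) = univ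

section SectionAlgebra

variable {G₀ : Type u₀} {G : Type u} [TopologicalSpace G₀] [TopologicalSpace G]
  [TopologicalGroupoid G₀ G] {E : G → Type v}
  [∀ x, NormedAddCommGroup (E x)] [∀ x, NormedSpace ℂ (E x)] [∀ x, CompleteSpace (E x)]
  [TopologicalSpace (Tot E)] [FellBundle E]

/-- The involution on `Γ_c(G; E)`: `f*(x) = f(x⁻¹)*`. -/
noncomputable def GammaC.star (f : GammaC E) : GammaC E :=
  ⟨fun x => Tot.toFib x (⟨x⁻¹⁻¹, FellBundle.st (f.1 x⁻¹)⟩ : Tot E), by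
    have key : ∀ x : G, (⟨x, Tot.toFib x (⟨x⁻¹⁻¹, FellBundle.st (f.1 x⁻¹)⟩ : Tot E)⟩ : Tot E) =
        ⟨x⁻¹⁻¹, FellBundle.st (f.1 x⁻¹)⟩ := fun x =>
      Tot.mk_toFib (TopologicalGroupoid.inv_inv x)
    refine ⟨?_, ?_⟩
    · simp only [key]
      exact (FellBundle.continuous_st (E := E)).comp
        (f.2.1.comp (TopologicalGroupoid.continuous_inv (G := G)))
    · have hc : IsCompact ((fun x : G => x⁻¹) '' closure {x | f.1 x ≠ 0}) :=
        f.2.2.image TopologicalGroupoid.continuous_inv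
      have hcl : IsClosed ((fun x : G => x⁻¹) '' closure {x | f.1 x ≠ 0}) := by
        have : (fun x : G => x⁻¹) '' closure {x | f.1 x ≠ 0} =
            (fun x : G => x⁻¹) ⁻¹' closure {x | f.1 x ≠ 0} :=
          image_eq_preimage_of_inverse (fun x => TopologicalGroupoid.inv_inv x)
            (fun x => TopologicalGroupoid.inv_inv x) |> fun h => congrFun h _
        rw [this]
        exact isClosed_closure.preimage TopologicalGroupoid.continuous_inv
      refine hc.of_isClosed_subset isClosed_closure (closure_minimal (fun x hx => ?_) hcl)
      refine ⟨x⁻¹, subset_closure fun h => hx ?_, TopologicalGroupoid.inv_inv x⟩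
      have h0 := key x
      rw [h, map_zero] at h0
      have : ∀ (y : G), y = x → (⟨x, Tot.toFib x (⟨x⁻¹⁻¹, FellBundle.st (f.1 x⁻¹)⟩ : Tot E)⟩ :
          Tot E) = ⟨y, 0⟩ → Tot.toFib x (⟨x⁻¹⁻¹, FellBundle.st (f.1 x⁻¹)⟩ : Tot E) = 0 := by
        rintro y rfl h2
        simpa using h2
      refine this _ (TopologicalGroupoid.inv_inv x) ?_
      rw [key x, h, map_zero]⟩

/-- The integrand `f(y) g(y⁻¹ x) ∈ E x` of the convolution, for `y` with `r y = r x`; it is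
extended by `0` to other `y`, which form a null set for `λ^{r x}`. -/
noncomputable def convIntegrand (f g : ∀ x, E x) (x y : G) : E x :=
  open Classical in
  if h : TopologicalGroupoid.r y = TopologicalGroupoid.r x then
    Tot.toFib x (⟨y * (y⁻¹ * x),
      FellBundle.m (TopologicalGroupoid.composable_conv h) (f y) (g (y⁻¹ * x))⟩ : Tot E)
  else 0

/-- The convolution `f * g (x) = ∫ f(y) g(y⁻¹ x) dλ^{r x}(y)`, a Bochner integral in `E x`. -/
noncomputable def conv [MeasurableSpace G] (lam : HaarSystem G₀ G) (f g : ∀ x, E x) (x : G) :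
    E x :=
  ∫ y, convIntegrand f g x y ∂(lam.lam (TopologicalGroupoid.r x))

/-- The `I`-norm
`max (sup_a ∫ ‖f(x)‖ dλ^a(x)) (sup_a ∫ ‖f(x)‖ dλ_a(x))`. -/
noncomputable def normI [MeasurableSpace G] (lam : HaarSystem G₀ G) (f : ∀ x, E x) : ℝ :=
  (max (⨆ a : G₀, ∫⁻ x, ‖f x‖ₑ ∂(lam.lam a)) (⨆ a : G₀, ∫⁻ x, ‖f x‖ₑ ∂(lam.lamInv a))).toReal

end SectionAlgebra

/-! ## Borel Hilbert bundles and their `L²`-spaces -/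

/-- A Borel Hilbert bundle over `X` with fibres the Hilbert spaces `H a`, given by a fundamental
sequence of sections: their inner products are Borel, and they are total in every fibre (so
that every fibre is separable). The associated Borel structure on the total space is the one
generated by the projection to `X` and the functions `(a, h) ↦ ⟪fund i a, h⟫`. -/
structure BorelHilbertBundle {X : Type u₀} [MeasurableSpace X] (H : X → Type w)
    [∀ a, NormedAddCommGroup (H a)] [∀ a, InnerProductSpace ℂ (H a)]
    [∀ a, CompleteSpace (H a)] where
  fund : ℕ → ∀ a, H a
  measurable_inner_fund : ∀ i j, Measurable fun a => inner ℂ (fund i a) (fund j a)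
  total : ∀ a, closure (Submodule.span ℂ (range fun i => fund i a) : Set (H a)) = univ

namespace BorelHilbertBundle

variable {X : Type u₀} [MeasurableSpace X] {H : X → Type w}
  [∀ a, NormedAddCommGroup (H a)] [∀ a, InnerProductSpace ℂ (H a)] [∀ a, CompleteSpace (H a)]
  (𝓗 : BorelHilbertBundle H)

/-- Borel sections. -/
def IsBorelSection (ξ : ∀ a, H a) : Prop :=
  ∀ i, Measurable fun a => inner ℂ (𝓗.fund i a) (ξ a)

variable {𝓗}

theorem IsBorelSection.add {ξ η : ∀ a, H a} (hξ : 𝓗.IsBorelSection ξ)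
    (hη : 𝓗.IsBorelSection η) : 𝓗.IsBorelSection (ξ + η) := fun i => by
  simp only [Pi.add_apply, inner_add_right]
  exact (hξ i).add (hη i)

theorem IsBorelSection.smul {ξ : ∀ a, H a} (c : ℂ) (hξ : 𝓗.IsBorelSection ξ) :
    𝓗.IsBorelSection (c • ξ) := fun i => by
  simpa [inner_smul_right] using (hξ i).const_mul c

theorem measurable_norm_sum (N : ℕ) (q : Fin N → ℂ) :
    Measurable fun a => ‖∑ i, q i • 𝓗.fund i a‖ := by
  have h : (fun a => ‖∑ i, q i • 𝓗.fund i a‖) = fun a => √(RCLike.re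
      (∑ i, ∑ j, starRingEnd ℂ (q i) * (q j * inner ℂ (𝓗.fund i a) (𝓗.fund j a)))) := by
    funext a
    rw [norm_eq_sqrt_re_inner (𝕜 := ℂ)]
    simp only [sum_inner, inner_sum, inner_smul_left, inner_smul_right, Finset.mul_sum]
    rw [Finset.sum_comm]
    congr 2
    exact Finset.sum_congr rfl fun i _ => Finset.sum_congr rfl fun j _ => by ring
  rw [h]
  refine (Complex.measurable_re.comp ?_).sqrt
  exact Finset.measurable_sum _ fun i _ => Finset.measurable_sum _ fun j _ =>
    ((𝓗.measurable_inner_fund i j).const_mul _).const_mul _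

theorem dense_combinations (a : X) :
    Dense (⋃ (N : ℕ), range fun (k : Fin N → ℕ) =>
      ∑ i, (TopologicalSpace.denseSeq ℂ (k i)) • 𝓗.fund i a) := by
  rw [dense_iff_closure_eq, ← univ_subset_iff, ← 𝓗.total a]
  refine closure_minimal ?_ isClosed_closure
  intro x hx
  obtain ⟨c, rfl⟩ := (Finsupp.mem_span_range_iff_exists_finsupp).1 hx
  obtain ⟨N, hN⟩ : ∃ N : ℕ, c.support ⊆ Finset.range N :=
    c.support.exists_nat_subset_range
  have hsum : (c.sum fun i z => z • 𝓗.fund i a) = ∑ i : Fin N, c i • 𝓗.fund i a := by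
    rw [Finsupp.sum_of_support_subset _ hN _ (by simp), Finset.sum_range]
  rw [hsum]
  have hcont : Continuous fun z : Fin N → ℂ => ∑ i : Fin N, z i • 𝓗.fund i a := by fun_prop
  have hd : DenseRange fun (k : Fin N → ℕ) (i : Fin N) => TopologicalSpace.denseSeq ℂ (k i) :=
    DenseRange.piMap fun _ => TopologicalSpace.denseRange_denseSeq ℂ
  have h1 := hcont.range_subset_closure_image_dense hd
  refine closure_mono ?_ (h1 ⟨fun i => c i, rfl⟩)
  rintro _ ⟨_, ⟨k, rfl⟩, rfl⟩
  exact mem_iUnion.2 ⟨N, k, rfl⟩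

theorem IsBorelSection.measurable_norm {ξ : ∀ a, H a} (hξ : 𝓗.IsBorelSection ξ) :
    Measurable fun a => ‖ξ a‖ := by
  refine measurable_of_Iic fun c => ?_
  rcases lt_or_ge c 0 with hc | hc
  · have : (fun a => ‖ξ a‖) ⁻¹' Iic c = ∅ := by
      ext a
      simpa using hc.trans_le (norm_nonneg _)
    rw [this]; exact MeasurableSet.empty
  · have : (fun a => ‖ξ a‖) ⁻¹' Iic c = ⋂ (N : ℕ), ⋂ (k : Fin N → ℕ),
        {a | ‖∑ i, starRingEnd ℂ (TopologicalSpace.denseSeq ℂ (k i)) *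
          inner ℂ (𝓗.fund i a) (ξ a)‖ ≤
          c * ‖∑ i, (TopologicalSpace.denseSeq ℂ (k i)) • 𝓗.fund i a‖} := by
      ext a
      have hin : ∀ (N : ℕ) (k : Fin N → ℕ),
          ∑ i, starRingEnd ℂ (TopologicalSpace.denseSeq ℂ (k i)) *
          inner ℂ (𝓗.fund i a) (ξ a) =
          inner ℂ (∑ i, (TopologicalSpace.denseSeq ℂ (k i)) • 𝓗.fund i a) (ξ a) := by
        intro N k
        simp only [sum_inner, inner_smul_left]
      simp only [mem_preimage, mem_Iic, mem_iInter, mem_ofPred_eq, hin]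
      constructor
      · intro h N k
        refine (norm_inner_le_norm _ _).trans ?_
        rw [mul_comm]
        gcongr
      · intro h
        have hcl : IsClosed {d : H a | ‖inner ℂ d (ξ a)‖ ≤ c * ‖d‖} :=
          isClosed_le (by fun_prop) (by fun_prop)
        have hall : ∀ d : H a, ‖inner ℂ d (ξ a)‖ ≤ c * ‖d‖ := by
          intro d
          have hsub := closure_minimal (s := ⋃ (N : ℕ), range fun (k : Fin N → ℕ) =>
            ∑ i, (TopologicalSpace.denseSeq ℂ (k i)) • 𝓗.fund i a) (by
              rintro _ hx
              obtain ⟨N, k, rfl⟩ := mem_iUnion.1 hx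
              exact h N k) hcl
          exact hsub (dense_combinations a d)
        have h2 := hall (ξ a)
        rw [inner_self_eq_norm_sq_to_K] at h2
        simp only [norm_pow, RCLike.norm_ofReal, abs_norm] at h2
        by_contra hlt
        push Not at hlt
        nlinarith [norm_nonneg (ξ a)]
    rw [this]
    refine MeasurableSet.iInter fun N => MeasurableSet.iInter fun k => measurableSet_le ?_ ?_
    · refine Measurable.norm ?_
      exact Finset.measurable_sum _ fun i _ => (hξ i).const_mul _
    · exact (measurable_norm_sum N _).const_mul c

theorem IsBorelSection.measurable_inner {ξ η : ∀ a, H a} (hξ : 𝓗.IsBorelSection ξ)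
    (hη : 𝓗.IsBorelSection η) : Measurable fun a => inner ℂ (ξ a) (η a) := by
  have h1 : ∀ c : ℂ, Measurable fun a => ‖ξ a + c • η a‖ := fun c =>
    (hξ.add (hη.smul c)).measurable_norm
  have h : (fun a => inner ℂ (ξ a) (η a)) = fun a =>
      (((‖ξ a + (1 : ℂ) • η a‖ : ℝ) : ℂ) ^ 2 - ((‖ξ a + (-1 : ℂ) • η a‖ : ℝ) : ℂ) ^ 2 +
        (((‖ξ a + (-Complex.I) • η a‖ : ℝ) : ℂ) ^ 2 -
          ((‖ξ a + Complex.I • η a‖ : ℝ) : ℂ) ^ 2) * Complex.I) / 4 := by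
    funext a
    rw [inner_eq_sum_norm_sq_div_four (𝕜 := ℂ)]
    simp [sub_eq_add_neg]
  rw [h]
  have h2 : ∀ c : ℂ, Measurable fun a => ((‖ξ a + c • η a‖ : ℝ) : ℂ) := fun c =>
    Complex.measurable_ofReal.comp (h1 c)
  exact ((((h2 1).pow_const 2).sub ((h2 (-1)).pow_const 2)).add
    ((((h2 (-Complex.I)).pow_const 2).sub ((h2 Complex.I).pow_const 2)).mul_const _)).div_const 4

variable (𝓗)

/-- The square-integrable Borel sections. -/
def sqIntegrable (μ : Measure X) : Submodule ℂ (∀ a, H a) where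
  carrier := {ξ | 𝓗.IsBorelSection ξ ∧ Integrable (fun a => ‖ξ a‖ ^ 2) μ}
  add_mem' := by
    rintro ξ η ⟨hξ, hξ'⟩ ⟨hη, hη'⟩
    refine ⟨hξ.add hη, ((hξ'.add hη').const_mul 2).mono'
      ((hξ.add hη).measurable_norm.pow_const 2).aestronglyMeasurable
      (Eventually.of_forall fun a => ?_)⟩
    have := norm_add_le (ξ a) (η a)
    simp only [Pi.add_apply, norm_pow, norm_norm]
    nlinarith [sq_nonneg (‖ξ a‖ - ‖η a‖), norm_nonneg (ξ a + η a)]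
  zero_mem' := ⟨fun i => by simp, by simp⟩
  smul_mem' := by
    rintro c ξ ⟨hξ, hξ'⟩
    refine ⟨hξ.smul c, ?_⟩
    simpa [norm_smul, mul_pow] using hξ'.const_mul (‖c‖ ^ 2)

/-- The space of square-integrable Borel sections, as a type of its own (which carries the
`L²`-seminorm below). -/
def PreL2 (μ : Measure X) : Type (max u₀ w) := 𝓗.sqIntegrable μ

variable {𝓗} {μ : Measure X}

instance : AddCommGroup (𝓗.PreL2 μ) := inferInstanceAs (AddCommGroup (𝓗.sqIntegrable μ))

instance : Module ℂ (𝓗.PreL2 μ) := inferInstanceAs (Module ℂ (𝓗.sqIntegrable μ))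

/-- The section underlying an element of `PreL2`. -/
def PreL2.sec (ξ : 𝓗.PreL2 μ) : ∀ a, H a := Subtype.val (p := (· ∈ 𝓗.sqIntegrable μ)) ξ

theorem PreL2.borel (ξ : 𝓗.PreL2 μ) : 𝓗.IsBorelSection ξ.sec :=
  (Subtype.property (p := (· ∈ 𝓗.sqIntegrable μ)) ξ).1

theorem PreL2.integrable_sq (ξ : 𝓗.PreL2 μ) : Integrable (fun a => ‖ξ.sec a‖ ^ 2) μ :=
  (Subtype.property (p := (· ∈ 𝓗.sqIntegrable μ)) ξ).2

theorem PreL2.integrable_inner (ξ η : 𝓗.PreL2 μ) :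
    Integrable (fun a => inner ℂ (ξ.sec a) (η.sec a)) μ := by
  refine (ξ.integrable_sq.add η.integrable_sq).mono'
    (ξ.borel.measurable_inner η.borel).aestronglyMeasurable (Eventually.of_forall fun a => ?_)
  refine (norm_inner_le_norm _ _).trans ?_
  simp only [Pi.add_apply]
  nlinarith [sq_nonneg (‖ξ.sec a‖ - ‖η.sec a‖), norm_nonneg (ξ.sec a), norm_nonneg (η.sec a)]

/-- The `L²` semi-inner product `∫ ⟪ξ(a), η(a)⟫ dμ(a)`. -/
noncomputable instance PreL2.core : PreInnerProductSpace.Core ℂ (𝓗.PreL2 μ) where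
  inner ξ η := ∫ a, inner ℂ (ξ.sec a) (η.sec a) ∂μ
  conj_inner_symm ξ η := by
    rw [← integral_conj]
    simp only [inner_conj_symm]
  re_inner_nonneg ξ := by
    rw [← integral_re (ξ.integrable_inner ξ)]
    exact integral_nonneg fun a => inner_self_nonneg
  add_left ξ η ζ := by
    rw [← integral_add (ξ.integrable_inner ζ) (η.integrable_inner ζ)]
    exact integral_congr_ae (Eventually.of_forall fun a => inner_add_left (ξ.sec a) (η.sec a) _)
  smul_left ξ η c := by
    rw [← integral_const_mul]
    exact integral_congr_ae (Eventually.of_forall fun a => inner_smul_left (ξ.sec a) _ c)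

noncomputable instance : SeminormedAddCommGroup (𝓗.PreL2 μ) :=
  InnerProductSpace.Core.toSeminormedAddCommGroup (𝕜 := ℂ)

noncomputable instance : InnerProductSpace ℂ (𝓗.PreL2 μ) :=
  InnerProductSpace.ofCore PreL2.core

theorem PreL2.inner_def (ξ η : 𝓗.PreL2 μ) :
    inner ℂ ξ η = ∫ a, inner ℂ (ξ.sec a) (η.sec a) ∂μ := rfl

theorem PreL2.norm_sq (ξ : 𝓗.PreL2 μ) : ‖ξ‖ ^ 2 = ∫ a, ‖ξ.sec a‖ ^ 2 ∂μ := by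
  have h := norm_sq_eq_re_inner (𝕜 := ℂ) ξ
  rw [h, PreL2.inner_def, ← integral_re (ξ.integrable_inner ξ)]
  exact integral_congr_ae (Eventually.of_forall fun a => (norm_sq_eq_re_inner (𝕜 := ℂ) _).symm)

theorem PreL2.lintegral_sq (ξ : 𝓗.PreL2 μ) :
    ∫⁻ a, ENNReal.ofReal (‖ξ.sec a‖ ^ 2) ∂μ = ENNReal.ofReal (‖ξ‖ ^ 2) := by
  rw [ξ.norm_sq, ofReal_integral_eq_lintegral_ofReal ξ.integrable_sq
    (Eventually.of_forall fun a => by positivity)]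

theorem PreL2.sec_sub (ξ η : 𝓗.PreL2 μ) (a : X) : (ξ - η).sec a = ξ.sec a - η.sec a := rfl

theorem PreL2.exists_limit (u : ℕ → 𝓗.PreL2 μ)
    (hu : ∀ N n m : ℕ, N ≤ n → N ≤ m → dist (u n) (u m) < (1 / 2) ^ N) :
    ∃ ξ, Tendsto u atTop (𝓝 ξ) := by
  have hd : ∀ N n m : ℕ, N ≤ n → N ≤ m →
      ∫⁻ a, ENNReal.ofReal (‖(u n).sec a - (u m).sec a‖ ^ 2) ∂μ ≤
        ENNReal.ofReal ((1 / 2) ^ N * (1 / 2) ^ N) := by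
    intro N n m hn hm
    have h1 := (u n - u m).lintegral_sq
    simp only [PreL2.sec_sub] at h1
    rw [h1]
    have h2 := hu N n m hn hm
    rw [dist_eq_norm] at h2
    refine ENNReal.ofReal_le_ofReal ?_
    rw [sq]
    exact mul_self_le_mul_self (norm_nonneg _) h2.le
  let g : ℕ → X → ℝ≥0∞ := fun n a =>
    ENNReal.ofReal (2 ^ n * ‖(u n).sec a - (u (n + 1)).sec a‖ ^ 2)
  have hgm : ∀ n, Measurable (g n) := fun n => by
    have := (u n - u (n + 1)).borel.measurable_norm
    simp only [PreL2.sec_sub] at this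
    exact ENNReal.measurable_ofReal.comp ((this.pow_const 2).const_mul _)
  have hgi : ∫⁻ a, ∑' n, g n a ∂μ ≠ ∞ := by
    rw [lintegral_tsum fun n => (hgm n).aemeasurable]
    have hle : ∀ n, ∫⁻ a, g n a ∂μ ≤ ENNReal.ofReal ((1 / 2) ^ n) := by
      intro n
      have h1 : ∀ a, g n a = ENNReal.ofReal (2 ^ n) *
          ENNReal.ofReal (‖(u n).sec a - (u (n + 1)).sec a‖ ^ 2) := fun a =>
        ENNReal.ofReal_mul (by positivity)
      simp only [h1]
      rw [lintegral_const_mul' _ _ ENNReal.ofReal_ne_top]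
      calc _ ≤ ENNReal.ofReal (2 ^ n) * ENNReal.ofReal ((1 / 2) ^ n * (1 / 2) ^ n) := by
            gcongr
            exact hd n n (n + 1) le_rfl (Nat.le_succ n)
        _ = ENNReal.ofReal ((1 / 2) ^ n) := by
            rw [← ENNReal.ofReal_mul (by positivity), ← mul_assoc, ← mul_pow]
            norm_num
    refine ((ENNReal.tsum_le_tsum hle).trans_lt ?_).ne
    rw [← ENNReal.ofReal_tsum_of_nonneg (fun n => by positivity) summable_geometric_two]
    exact ENNReal.ofReal_lt_top
  let S : Set X := {a | ∑' n, g n a < ∞}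
  have hSm : MeasurableSet S :=
    measurableSet_lt (Measurable.tsum hgm) measurable_const
  have hSae : ∀ᵐ a ∂μ, a ∈ S :=
    ae_lt_top (Measurable.tsum hgm) hgi
  have hconv : ∀ a ∈ S, ∃ y, Tendsto (fun n => (u n).sec a) atTop (𝓝 y) := by
    intro a ha
    refine cauchySeq_tendsto_of_complete (cauchySeq_of_summable_dist ?_)
    have hs : Summable fun n => 2 ^ n * ‖(u n).sec a - (u (n + 1)).sec a‖ ^ 2 := by
      have h1 := ENNReal.summable_toReal (ne_of_lt ha)
      refine h1.congr fun n => ?_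
      exact ENNReal.toReal_ofReal (by positivity)
    refine Summable.of_nonneg_of_le (fun n => dist_nonneg) (fun n => ?_)
      (summable_geometric_two.add hs)
    rw [dist_eq_norm]
    set t := ‖(u n).sec a - (u (n + 1)).sec a‖
    have h2 : ((1 : ℝ) / 2) ^ n * 2 ^ n = 1 := by rw [← mul_pow]; norm_num
    have h3 : (0 : ℝ) < 2 ^ n := by positivity
    have h4 : (0 : ℝ) < (1 / 2) ^ n := by positivity
    have h5 : 0 ≤ t := norm_nonneg _
    have h6 : 0 ≤ (1 / 2 : ℝ) ^ n * (1 - 2 ^ n * t) ^ 2 := by positivity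
    have h7 : (1 / 2 : ℝ) ^ n * (1 - 2 ^ n * t) ^ 2 =
        (1 / 2) ^ n - 2 * ((1 / 2) ^ n * 2 ^ n) * t +
          ((1 / 2) ^ n * 2 ^ n) * (2 ^ n * t ^ 2) := by ring
    rw [h7, h2] at h6
    nlinarith
  classical
  let ζ : ∀ a, H a := fun a => if h : a ∈ S then (hconv a h).choose else 0
  have hζ : ∀ a ∈ S, Tendsto (fun n => (u n).sec a) atTop (𝓝 (ζ a)) := by
    intro a ha
    simp only [ζ, dif_pos ha]
    exact (hconv a ha).choose_spec
  have hζb : 𝓗.IsBorelSection ζ := by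
    intro i
    refine measurable_of_tendsto_metrizable (f := fun n => S.indicator
      fun a => inner ℂ (𝓗.fund i a) ((u n).sec a)) (fun n => ((u n).borel i).indicator hSm) ?_
    rw [tendsto_pi_nhds]
    intro a
    by_cases ha : a ∈ S
    · simp only [indicator_of_mem ha]
      exact tendsto_const_nhds.inner (hζ a ha)
    · simp only [indicator_of_notMem ha, ζ, dif_neg ha, inner_zero_right]
      exact tendsto_const_nhds
  have hdb : ∀ n, Measurable fun a => ‖(u n).sec a - ζ a‖ := by
    intro n
    have := ((u n).borel.add (hζb.smul (-1))).measurable_norm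
    simpa [sub_eq_add_neg] using this
  have hfatou : ∀ n, ∫⁻ a, ENNReal.ofReal (‖(u n).sec a - ζ a‖ ^ 2) ∂μ ≤
      ENNReal.ofReal ((1 / 2) ^ n * (1 / 2) ^ n) := by
    intro n
    have h1 : ∀ᵐ a ∂μ, ENNReal.ofReal (‖(u n).sec a - ζ a‖ ^ 2) =
        liminf (fun m => ENNReal.ofReal (‖(u n).sec a - (u m).sec a‖ ^ 2)) atTop := by
      filter_upwards [hSae] with a ha
      refine (Tendsto.liminf_eq ?_).symm
      exact (ENNReal.continuous_ofReal.tendsto _).comp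
        (((tendsto_const_nhds.sub (hζ a ha)).norm).pow 2)
    rw [lintegral_congr_ae h1]
    refine (lintegral_liminf_le fun m => ?_).trans ?_
    · have := (u n - u m).borel.measurable_norm
      simp only [PreL2.sec_sub] at this
      exact ENNReal.measurable_ofReal.comp (this.pow_const 2)
    · refine (liminf_le_liminf (v := fun _ => ENNReal.ofReal ((1 / 2) ^ n * (1 / 2) ^ n))
        ?_).trans (by simp)
      filter_upwards [eventually_ge_atTop n] with m hm
      exact hd n n m le_rfl hm
  have hint : ∀ n, Integrable (fun a => ‖(u n).sec a - ζ a‖ ^ 2) μ := by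
    intro n
    refine (lintegral_ofReal_ne_top_iff_integrable
      ((hdb n).pow_const 2).aestronglyMeasurable
      (Eventually.of_forall fun a => by positivity)).1 ?_
    exact ((hfatou n).trans_lt ENNReal.ofReal_lt_top).ne
  have hdmem : (fun a => (u 0).sec a - ζ a) ∈ 𝓗.sqIntegrable μ := by
    refine ⟨?_, hint 0⟩
    have := (u 0).borel.add (hζb.smul (-1))
    convert this using 1
    funext a
    simp [sub_eq_add_neg]
  have hζmem : ζ ∈ 𝓗.sqIntegrable μ := by
    have h1 := (𝓗.sqIntegrable μ).sub_mem
      (Subtype.property (p := (· ∈ 𝓗.sqIntegrable μ)) (u 0)) hdmem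
    convert h1 using 1
    funext a
    exact (sub_sub_cancel ((u 0).sec a) (ζ a)).symm
  let ξ : 𝓗.PreL2 μ := (⟨ζ, hζmem⟩ : 𝓗.sqIntegrable μ)
  refine ⟨ξ, ?_⟩
  rw [tendsto_iff_dist_tendsto_zero]
  refine squeeze_zero (fun n => dist_nonneg) (fun n => ?_)
    (tendsto_pow_atTop_nhds_zero_of_lt_one (r := (1 / 2 : ℝ)) (by norm_num) (by norm_num))
  rw [dist_eq_norm]
  have h1 := (u n - ξ).lintegral_sq
  have h2 : ∀ a, (u n - ξ).sec a = (u n).sec a - ζ a := fun a => rfl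
  simp only [h2] at h1
  have h3 := hfatou n
  rw [h1, ENNReal.ofReal_le_ofReal_iff (by positivity), sq] at h3
  exact (mul_self_le_mul_self_iff (norm_nonneg _) (by positivity)).2 h3

instance : CompleteSpace (𝓗.PreL2 μ) :=
  Metric.complete_of_convergent_controlled_sequences (fun n => (1 / 2) ^ n)
    (fun n => by positivity) PreL2.exists_limit

variable (𝓗) (μ)

/-- The Hilbert space `L²(X * H, μ)` of square-integrable Borel sections, two sections being
identified when their difference has norm zero, that is, when they agree almost everywhere. -/
abbrev L2 : Type (max u₀ w) := SeparationQuotient (𝓗.PreL2 μ)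

end BorelHilbertBundle

/-! ## Strict representations -/

/-- `End(X * H)`: triples `(tgt, op, src)` with `op` a bounded operator from `H src` to `H tgt`. -/
structure BundleEnd {X : Type u₀} (H : X → Type w)
    [∀ a, NormedAddCommGroup (H a)] [∀ a, InnerProductSpace ℂ (H a)] where
  tgt : X
  src : X
  op : H src →L[ℂ] H tgt

namespace BundleEnd

variable {X : Type u₀} {H : X → Type w}
  [∀ a, NormedAddCommGroup (H a)] [∀ a, InnerProductSpace ℂ (H a)]

/-- Composition of `S` and `T` when `src S = tgt T`. -/
def comp (S T : BundleEnd H) (h : S.src = T.tgt) : BundleEnd H :=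
  ⟨S.tgt, T.src, (h ▸ S.op : H T.tgt →L[ℂ] H S.tgt) ∘L T.op⟩

/-- The adjoint operator. -/
noncomputable def adjoint [∀ a, CompleteSpace (H a)] (T : BundleEnd H) : BundleEnd H :=
  ⟨T.src, T.tgt, ContinuousLinearMap.adjoint T.op⟩

/-- The smallest Borel structure on `End(X * H)` for which `(u, T, v) ↦ ⟪η(u), T ξ(v)⟫` is Borel
for all Borel sections `ξ` and `η`. -/
@[reducible]
noncomputable def measurableSpace [∀ a, CompleteSpace (H a)] [MeasurableSpace X]
    (𝓗 : BorelHilbertBundle H) : MeasurableSpace (BundleEnd H) :=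
  ⨆ (ξ : {ξ : ∀ a, H a // 𝓗.IsBorelSection ξ}) (η : {η : ∀ a, H a // 𝓗.IsBorelSection η}),
    MeasurableSpace.comap (fun T : BundleEnd H => inner ℂ (η.1 T.tgt) (T.op (ξ.1 T.src)))
      inferInstance

end BundleEnd

section StarFunctor

variable {G₀ : Type u₀} {G : Type u} [TopologicalSpace G₀] [TopologicalSpace G]
  [TopologicalGroupoid G₀ G] (E : G → Type v)
  [∀ x, NormedAddCommGroup (E x)] [∀ x, NormedSpace ℂ (E x)] [∀ x, CompleteSpace (E x)]
  [TopologicalSpace (Tot E)] [FellBundle E]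
  (H : G₀ → Type w) [∀ a, NormedAddCommGroup (H a)] [∀ a, InnerProductSpace ℂ (H a)]
  [∀ a, CompleteSpace (H a)]

open TopologicalGroupoid in
/-- A `*`-functor `b ↦ (r(b), π(b), s(b))` from the Fell bundle `E` to `End(G₀ * H)`. -/
structure StarFunctor where
  π : ∀ {x : G}, E x →ₗ[ℂ] (H (s x) →L[ℂ] H (r x))
  map_m : ∀ {x y : G} (h : s x = r y) (a : E x) (b : E y),
    (⟨r (x * y), s (x * y), π (FellBundle.m h a b)⟩ : BundleEnd H) =
      BundleEnd.comp ⟨r x, s x, π a⟩ ⟨r y, s y, π b⟩ h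
  map_st : ∀ {x : G} (a : E x),
    (⟨r x⁻¹, s x⁻¹, π (FellBundle.st a)⟩ : BundleEnd H) = BundleEnd.adjoint ⟨r x, s x, π a⟩

variable {E H}

/-- The map `b ↦ (r(b), π(b), s(b))` on the total space. -/
def StarFunctor.hat (F : StarFunctor E H) (b : Tot E) : BundleEnd H :=
  ⟨TopologicalGroupoid.r b.proj, TopologicalGroupoid.s b.proj, F.π b.snd⟩

/-- The `*`-functor is Borel: `x ↦ (r(x), π(f(x)), s(x))` is Borel for every `f ∈ Γ_c(G; E)`. -/
def StarFunctor.IsBorel [MeasurableSpace G₀] [MeasurableSpace G] (F : StarFunctor E H)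
    (𝓗 : BorelHilbertBundle H) : Prop :=
  ∀ f ∈ GammaC E,
    Measurable[_, BundleEnd.measurableSpace 𝓗] fun x : G => F.hat (⟨x, f x⟩ : Tot E)

end StarFunctor

/-! The formula for `⟪η, L(f) ξ⟫` is a sesquilinear form in `ξ` and `η`. Once it is known to be
bounded by the `I`-norm of `f`, it defines `L(f)` and determines it, which settles existence,
uniqueness and linearity.

Boundedness rests on two facts. First, a `*`-functor is contractive: over a unit it is a
`*`-homomorphism of `C*`-algebras, and on any fibre `‖π(a)‖² = ‖π(a* a)‖ ≤ ‖a* a‖ = ‖a‖²`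
(`norm_π_le`). Second, Schur's test (`lintegral_schur`): Cauchy–Schwarz splits `‖f‖ ‖η ∘ r‖ ‖ξ ∘ s‖
Δ^{-1/2} dν` into `‖f‖ ‖η ∘ r‖² dν` and `‖f‖ ‖ξ ∘ s‖² Δ^{-1} dν`. Since `Δ^{-1} ν = ν⁻¹`, the two
pieces are controlled by the two suprema in the `I`-norm.

Compatibility with adjoints is the invariance of `Δ^{-1/2} ν` under inversion
(`integral_comp_inv_mul_Delta`).

Multiplicativity takes place on pairs of arrows with common range, with the measure `∫ λ^a × λ^a
dμ(a)`. The involutions `(x, y) ↦ (y, x)` and `(x, y) ↦ (x⁻¹, x⁻¹ y)` permute the three units at the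
ends of the pair and satisfy the braid relation. The first preserves the measure and the second
multiplies it by `Δ(x)^{-1}`, so comparing the two sides of the braid relation gives `Δ(x) Δ(x⁻¹ y)
= Δ(y)` almost everywhere (`modular_cocycle`). With this identity the second involution turns `⟪η,
L(f * g) ξ⟫` into the integral of `⟪π(f*(z)) η, π(g(w)) ξ⟫ Δ(z)^{-1/2} Δ(w)^{-1/2}` over pairs `(z,
w)`. Fubini's theorem identifies that integral with `⟪L(f*) η, L(g) ξ⟫ = ⟪η, L(f) L(g) ξ⟫`. The
identification uses that a representative of `L(f*) η` is, at almost every unit, the weak integral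
over the fibre (`ae_inner_eq_integral_pointSection`).

That `f * g` is a continuous section (`continuous_conv`) is a separate point. The norm is only upper
semicontinuous, so continuity is obtained from local approximation by sections known to be
continuous. -/

set_option linter.unusedSectionVars false

/-! ## `*`-functors are norm decreasing -/

/-- A `*`-homomorphism from a Banach space with the operations of a `C*`-algebra, given in unbundled
form, to a `C*`-algebra is norm decreasing. -/
theorem norm_map_le_of_cstar {A B : Type*} [NormedAddCommGroup A] [NormedSpace ℂ A]
    [CompleteSpace A] [CStarAlgebra B] (mul : A → A → A) (str : A → A)
    (mul_add : ∀ a b c, mul a (b + c) = mul a b + mul a c)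
    (add_mul : ∀ a b c, mul (a + b) c = mul a c + mul b c)
    (smul_mul : ∀ (z : ℂ) a b, mul (z • a) b = z • mul a b)
    (mul_smul : ∀ (z : ℂ) a b, mul a (z • b) = z • mul a b)
    (mul_assoc : ∀ a b c, mul (mul a b) c = mul a (mul b c))
    (str_str : ∀ a, str (str a) = a) (str_mul : ∀ a b, str (mul a b) = mul (str b) (str a))
    (str_add : ∀ a b, str (a + b) = str a + str b)
    (str_smul : ∀ (z : ℂ) a, str (z • a) = starRingEnd ℂ z • str a)
    (norm_mul : ∀ a b, ‖mul a b‖ ≤ ‖a‖ * ‖b‖) (cstar : ∀ a, ‖mul (str a) a‖ = ‖a‖ ^ 2)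
    (φ : A →ₗ[ℂ] B) (map_mul : ∀ a b, φ (mul a b) = φ a * φ b)
    (map_str : ∀ a, φ (str a) = star (φ a)) (a : A) : ‖φ a‖ ≤ ‖a‖ := by
  let i1 : NonUnitalNormedRing A :=
    { (inferInstance : NormedAddCommGroup A) with
      mul := mul
      left_distrib := mul_add
      right_distrib := add_mul
      zero_mul := fun a => by
        have h := smul_mul 0 0 a
        simp only [zero_smul] at h
        exact h
      mul_zero := fun a => by
        have h := mul_smul 0 a 0
        simp only [zero_smul] at h
        exact h
      mul_assoc := mul_assoc
      norm_mul_le := norm_mul }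
  let i2 : StarRing A :=
    { star := str
      star_involutive := str_str
      star_mul := str_mul
      star_add := str_add }
  let i3 : CStarRing A := ⟨fun {x} => by
    have := cstar x
    rw [sq] at this
    exact this.symm.le⟩
  have i4 : IsScalarTower ℂ A A := ⟨fun z a b => smul_mul z a b⟩
  have i5 : SMulCommClass ℂ A A := ⟨fun z a b => (mul_smul z a b).symm⟩
  have i6 : StarModule ℂ A := ⟨fun z a => str_smul z a⟩
  let i7 : NonUnitalCStarAlgebra A :=
    { i1, i2, i3, i4, i5, i6, (inferInstance : CompleteSpace A),
      (inferInstance : NormedSpace ℂ A) with }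
  let ψ : A →⋆ₙₐ[ℂ] B :=
    { toFun := φ
      map_smul' := fun z a => φ.map_smul z a
      map_zero' := φ.map_zero
      map_add' := φ.map_add
      map_mul' := map_mul
      map_star' := map_str }
  exact NonUnitalStarAlgHom.norm_apply_le ψ a

/-! ### Transport between fibres, and operators, over equal base points -/

namespace Tot

variable {X : Type u} {E : X → Type v}

theorem mk_injective {x : X} {a b : E x} (h : (⟨x, a⟩ : Tot E) = ⟨x, b⟩) : a = b := by
  simpa using h

theorem toFib_add [∀ x, AddMonoid (E x)] {x y : X} (h : y = x) (a b : E y) :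
    toFib x (⟨y, a + b⟩ : Tot E) = toFib x ⟨y, a⟩ + toFib x ⟨y, b⟩ := by
  subst h
  simp only [toFib_mk]

theorem toFib_smul [∀ x, AddMonoid (E x)] [∀ x, DistribMulAction ℂ (E x)] {x y : X} (h : y = x)
    (c : ℂ) (a : E y) : toFib x (⟨y, c • a⟩ : Tot E) = c • toFib x ⟨y, a⟩ := by
  subst h
  simp only [toFib_mk]

theorem norm_toFib [∀ x, NormedAddCommGroup (E x)] {x : X} {b : Tot E} (h : b.proj = x) :
    ‖toFib x b‖ = ‖b.snd‖ := by
  subst h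
  simp [toFib]

end Tot

namespace BundleEnd

variable {X : Type u₀} {H : X → Type w}
  [∀ a, NormedAddCommGroup (H a)] [∀ a, InnerProductSpace ℂ (H a)]

/-- The operator of an element of `End(X * H)`, as an operator on the fibre `H a` (and `0` if it is
not an operator on this fibre). -/
noncomputable def onFibre (a : X) (T : BundleEnd H) : H a →L[ℂ] H a :=
  open Classical in if h : T.tgt = a ∧ T.src = a then
    (h.1 ▸ (h.2 ▸ T.op : H a →L[ℂ] H T.tgt) : H a →L[ℂ] H a) else 0

theorem onFibre_mk (a : X) (T : H a →L[ℂ] H a) : onFibre a ⟨a, a, T⟩ = T := by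
  simp [onFibre]

theorem onFibre_add {a t s : X} (ht : t = a) (hs : s = a) (S T : H s →L[ℂ] H t) :
    onFibre a ⟨t, s, S + T⟩ = onFibre a ⟨t, s, S⟩ + onFibre a ⟨t, s, T⟩ := by
  subst ht; subst hs
  simp only [onFibre_mk]

theorem onFibre_smul {a t s : X} (ht : t = a) (hs : s = a) (c : ℂ) (T : H s →L[ℂ] H t) :
    onFibre a ⟨t, s, c • T⟩ = c • onFibre a ⟨t, s, T⟩ := by
  subst ht; subst hs
  simp only [onFibre_mk]

theorem onFibre_comp {a : X} {S T : BundleEnd H} (h : S.src = T.tgt) (hS : S.tgt = a)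
    (hS' : S.src = a) (hT : T.src = a) :
    onFibre a (S.comp T h) = onFibre a S * onFibre a T := by
  obtain ⟨t, s, S⟩ := S
  obtain ⟨t', s', T⟩ := T
  have h' : s = t' := h
  dsimp only at hS hS' hT
  subst h'; subst hS'; subst hS; subst hT
  simp only [onFibre_mk]
  exact onFibre_mk _ _

theorem norm_onFibre {a : X} {T : BundleEnd H} (h : T.tgt = a) (h' : T.src = a) :
    ‖onFibre a T‖ = ‖T.op‖ := by
  obtain ⟨t, s, T⟩ := T
  dsimp only at *
  subst h; subst h'
  simp only [onFibre_mk]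

variable [∀ a, CompleteSpace (H a)]

theorem onFibre_adjoint {a : X} {T : BundleEnd H} (h : T.tgt = a) (h' : T.src = a) :
    onFibre a T.adjoint = star (onFibre a T) := by
  obtain ⟨t, s, T⟩ := T
  dsimp only at *
  subst h; subst h'
  simp only [onFibre_mk]
  exact onFibre_mk _ _

theorem norm_comp_adjoint (T : BundleEnd H) : ‖(T.adjoint.comp T rfl).op‖ = ‖T.op‖ ^ 2 := by
  obtain ⟨t, s, T⟩ := T
  rw [sq]
  exact ContinuousLinearMap.norm_adjoint_comp_self T

end BundleEnd

namespace TopologicalGroupoid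

variable {G₀ : Type u₀} {G : Type u} [TopologicalSpace G₀] [TopologicalSpace G]
  [TopologicalGroupoid G₀ G]

theorem one_mul_one (a : G₀) : (one a * one a : G) = one a := by
  have h := one_mul (one a : G)
  rwa [r_one] at h

theorem inv_one (a : G₀) : (one a : G)⁻¹ = one a := by
  have h1 := mul_inv (one a : G)
  have h2 := one_mul ((one a : G)⁻¹)
  rw [r_inv, s_one] at h2
  rw [r_one] at h1
  exact h2.symm.trans h1

end TopologicalGroupoid

namespace FellBundle

open TopologicalGroupoid

variable {G₀ : Type u₀} {G : Type u} [TopologicalSpace G₀] [TopologicalSpace G]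
  [TopologicalGroupoid G₀ G] {E : G → Type v}
  [∀ x, NormedAddCommGroup (E x)] [∀ x, NormedSpace ℂ (E x)] [∀ x, CompleteSpace (E x)]
  [TopologicalSpace (Tot E)] [FellBundle E]

/-- The product of composable elements of the total space. -/
def totMul (a b : Tot E) (h : s a.proj = r b.proj) : Tot E :=
  ⟨a.proj * b.proj, m h a.snd b.snd⟩

/-- The involution of the total space. -/
def totStar (a : Tot E) : Tot E := ⟨a.proj⁻¹, st a.snd⟩

/-- The composability proof depends on the factors, so the factors are replaced together with it. -/
theorem totMul_congr {a a' b b' : Tot E} (h : s a.proj = r b.proj) (ha : a = a') (hb : b = b') :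
    totMul a b h = totMul a' b' (ha ▸ hb ▸ h) := by
  subst ha; subst hb; rfl

theorem totMul_assoc {a b c : Tot E} (h : s a.proj = r b.proj) (h' : s b.proj = r c.proj) :
    totMul (totMul a b h) c ((s_mul _ _ h).trans h') =
      totMul a (totMul b c h') (h.trans (r_mul _ _ h').symm) :=
  m_assoc h h' a.snd b.snd c.snd

theorem totStar_totStar (a : Tot E) : totStar (totStar a) = a := st_st a.snd

theorem totStar_totMul {a b : Tot E} (h : s a.proj = r b.proj) :
    totStar (totMul a b h) = totMul (totStar b) (totStar a)
      (((s_inv _).trans h.symm).trans (r_inv _).symm) :=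
  st_m h a.snd b.snd

/-- The product of the `C*`-algebra over a unit. -/
noncomputable def unitMul {e : G₀} (a b : E (one e)) : E (one e) :=
  Tot.toFib (one e) (totMul (⟨one e, a⟩ : Tot E) ⟨one e, b⟩ ((s_one e).trans (r_one e).symm))

/-- The involution of the `C*`-algebra over a unit. -/
noncomputable def unitStar {e : G₀} (a : E (one e)) : E (one e) :=
  Tot.toFib (one e) (totStar (⟨one e, a⟩ : Tot E))

theorem mk_unitMul {e : G₀} (a b : E (one e)) : (⟨one e, unitMul a b⟩ : Tot E) =
    totMul (⟨one e, a⟩ : Tot E) ⟨one e, b⟩ ((s_one e).trans (r_one e).symm) :=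
  Tot.mk_toFib (one_mul_one e)

theorem mk_unitStar {e : G₀} (a : E (one e)) : (⟨one e, unitStar a⟩ : Tot E) =
    totStar (⟨one e, a⟩ : Tot E) :=
  Tot.mk_toFib (inv_one e)

end FellBundle

namespace StarFunctor

open TopologicalGroupoid FellBundle

variable {G₀ : Type u₀} {G : Type u} [TopologicalSpace G₀] [TopologicalSpace G]
  [TopologicalGroupoid G₀ G] {E : G → Type v}
  [∀ x, NormedAddCommGroup (E x)] [∀ x, NormedSpace ℂ (E x)] [∀ x, CompleteSpace (E x)]
  [TopologicalSpace (Tot E)] [FellBundle E]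
  {H : G₀ → Type w} [∀ a, NormedAddCommGroup (H a)] [∀ a, InnerProductSpace ℂ (H a)]
  [∀ a, CompleteSpace (H a)] (F : StarFunctor E H)

theorem hat_totMul {a b : Tot E} (h : s a.proj = r b.proj) :
    F.hat (totMul a b h) = (F.hat a).comp (F.hat b) h :=
  F.map_m h a.snd b.snd

theorem hat_totStar (a : Tot E) : F.hat (totStar a) = (F.hat a).adjoint := F.map_st a.snd

/-- Over a unit, `π` is a `*`-homomorphism between `C*`-algebras, hence contractive. The fibres over
`one e * one e` and `(one e)⁻¹`, and the spaces over `r (one e)` and `s (one e)`, are only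
propositionally the right ones. The algebraic laws are therefore checked in the total space, and
operators are carried to `H e` by `onFibre`. -/
theorem norm_π_unit_le {e : G₀} (a : E (one e)) : ‖F.π a‖ ≤ ‖a‖ := by
  have key := norm_map_le_of_cstar (A := E (one e)) (B := H e →L[ℂ] H e) unitMul unitStar
    (fun a b c => by
      simp only [unitMul, totMul, map_add]
      exact Tot.toFib_add (one_mul_one e) _ _)
    (fun a b c => by
      simp only [unitMul, totMul, map_add, LinearMap.add_apply]
      exact Tot.toFib_add (one_mul_one e) _ _)
    (fun z a b => by
      simp only [unitMul, totMul, map_smul, LinearMap.smul_apply]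
      exact Tot.toFib_smul (one_mul_one e) _ _)
    (fun z a b => by
      simp only [unitMul, totMul, map_smul]
      exact Tot.toFib_smul (one_mul_one e) _ _)
    (fun a b c => Tot.mk_injective (E := E) ((mk_unitMul _ _).trans
      ((totMul_congr _ (mk_unitMul a b) rfl).trans
        ((totMul_assoc _ _).trans ((totMul_congr _ rfl (mk_unitMul b c)).symm.trans
          (mk_unitMul _ _).symm)))))
    (fun a => Tot.mk_injective (E := E) (by
      rw [mk_unitStar, mk_unitStar, totStar_totStar]))
    (fun a b => Tot.mk_injective (E := E) (by
      rw [mk_unitStar, mk_unitMul, mk_unitMul, totMul_congr _ (mk_unitStar b) (mk_unitStar a)]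
      exact totStar_totMul _))
    (fun a b => by
      simp only [unitStar, totStar, map_add]
      exact Tot.toFib_add (inv_one e) _ _)
    (fun z a => by
      simp only [unitStar, totStar, map_smulₛₗ]
      exact Tot.toFib_smul (inv_one e) _ _)
    (fun a b => by
      rw [unitMul, Tot.norm_toFib (one_mul_one e)]
      exact norm_m_unit e a b)
    (fun a => by
      rw [← cstar_unit e a]
      have h := congrArg (fun b : Tot E => ‖b.snd‖) (mk_unitMul (unitStar a) a)
      refine h.trans ?_
      rw [totMul_congr _ (mk_unitStar a) rfl]
      rfl)
    { toFun := fun a => BundleEnd.onFibre e (F.hat ⟨one e, a⟩)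
      map_add' := fun a b => by
        simp only [hat, map_add]
        exact BundleEnd.onFibre_add (r_one e) (s_one e) _ _
      map_smul' := fun z a => by
        simp only [hat, map_smul]
        exact BundleEnd.onFibre_smul (r_one e) (s_one e) _ _ }
    (fun a b => by
      change BundleEnd.onFibre e (F.hat ⟨one e, unitMul a b⟩) = _
      rw [mk_unitMul, hat_totMul]
      exact BundleEnd.onFibre_comp _ (r_one e) (s_one e) (s_one e))
    (fun a => by
      change BundleEnd.onFibre e (F.hat ⟨one e, unitStar a⟩) = _
      rw [mk_unitStar, hat_totStar]
      exact BundleEnd.onFibre_adjoint (r_one e) (s_one e)) a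
  refine le_trans (le_of_eq ?_) key
  exact (BundleEnd.norm_onFibre (T := F.hat ⟨one e, a⟩) (r_one e) (s_one e)).symm

/-- The `C*`-identity for operators and the norm axiom of the right Hilbert module reduce the claim
to `a* a`, which lies over a unit. -/
theorem norm_π_le {x : G} (a : E x) : ‖F.π a‖ ≤ ‖a‖ := by
  let b : Tot E := totMul (totStar ⟨x, a⟩) ⟨x, a⟩ (s_inv x)
  have hb : b.proj = one (s x) := inv_mul x
  have h1 : ‖(F.hat b).op‖ = ‖F.π a‖ ^ 2 := by
    -- The composition carries a proof about its left factor, so the factor is generalised before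
    -- the adjoint is substituted.
    have h : ∀ T : BundleEnd H, ∀ hT : T = (F.hat ⟨x, a⟩).adjoint,
        ‖(T.comp (F.hat ⟨x, a⟩) (by rw [hT]; rfl)).op‖ = ‖F.π a‖ ^ 2 := by
      rintro _ rfl
      exact BundleEnd.norm_comp_adjoint _
    have hm : F.hat b = (F.hat (totStar ⟨x, a⟩)).comp (F.hat ⟨x, a⟩) (s_inv x) := F.hat_totMul _
    rw [hm]
    exact h _ (F.hat_totStar _)
  have h2 : ‖(F.hat b).op‖ ≤ ‖b.snd‖ := by
    have h : ‖(F.hat b).op‖ = ‖F.π (Tot.toFib (one (s x)) b)‖ :=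
      congrArg (fun c => ‖(F.hat c).op‖) (Tot.mk_toFib hb).symm
    rw [h, ← Tot.norm_toFib hb]
    exact F.norm_π_unit_le _
  have h3 : ‖b.snd‖ = ‖a‖ ^ 2 := right_norm a
  rw [h1, h3] at h2
  exact (sq_le_sq₀ (norm_nonneg _) (norm_nonneg _)).1 h2

end StarFunctor

/-! ## Continuous sections of upper semicontinuous Banach bundles -/

namespace USCBanachBundle

variable {X : Type u} [TopologicalSpace X] {E : X → Type v}
  [∀ x, NormedAddCommGroup (E x)] [∀ x, NormedSpace ℂ (E x)] [∀ x, CompleteSpace (E x)]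
  [TopologicalSpace (Tot E)] [USCBanachBundle E]

theorem tendsto_add {Y : Type*} {l : Filter Y} {p : Y → X} {σ τ : ∀ y, E (p y)} {x : X}
    {a b : E x} (hσ : Tendsto (fun y => (⟨p y, σ y⟩ : Tot E)) l (𝓝 ⟨x, a⟩))
    (hτ : Tendsto (fun y => (⟨p y, τ y⟩ : Tot E)) l (𝓝 ⟨x, b⟩)) :
    Tendsto (fun y => (⟨p y, σ y + τ y⟩ : Tot E)) l (𝓝 ⟨x, a + b⟩) := by
  have h := continuousOn_add (E := E) (⟨x, a⟩, ⟨x, b⟩) rfl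
  have h1 : Tendsto (fun y => ((⟨p y, σ y⟩, ⟨p y, τ y⟩) : Tot E × Tot E)) l
      (𝓝[{q | q.1.proj = q.2.proj}] (⟨x, a⟩, ⟨x, b⟩)) :=
    tendsto_nhdsWithin_iff.2 ⟨by rw [nhds_prod_eq]; exact hσ.prodMk hτ,
      Eventually.of_forall fun _ => rfl⟩
  have h2 := Tendsto.comp h h1
  simpa [Function.comp_def, Tot.toFib_mk] using h2

variable {Y : Type*} [TopologicalSpace Y] {p : Y → X} {σ τ : ∀ y, E (p y)}

theorem continuous_add (hσ : Continuous fun y => (⟨p y, σ y⟩ : Tot E))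
    (hτ : Continuous fun y => (⟨p y, τ y⟩ : Tot E)) :
    Continuous fun y => (⟨p y, σ y + τ y⟩ : Tot E) :=
  continuous_iff_continuousAt.2 fun _ => tendsto_add hσ.continuousAt hτ.continuousAt

theorem continuous_sub (hσ : Continuous fun y => (⟨p y, σ y⟩ : Tot E))
    (hτ : Continuous fun y => (⟨p y, τ y⟩ : Tot E)) :
    Continuous fun y => (⟨p y, σ y - τ y⟩ : Tot E) := by
  have h : Continuous fun y => (⟨p y, (-1 : ℂ) • τ y⟩ : Tot E) :=
    (continuous_smul (E := E) (-1)).comp hτ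
  simpa [sub_eq_add_neg] using continuous_add hσ h

theorem upperSemicontinuous_norm_comp (hσ : Continuous fun y => (⟨p y, σ y⟩ : Tot E)) :
    UpperSemicontinuous fun y => ‖σ y‖ :=
  (usc_norm (E := E)).comp hσ

/-- The relative topology of the fibres of the total space is the norm topology. -/
theorem continuous_of_continuous_mk {x : X} {σ : Y → E x}
    (hσ : Continuous fun y => (⟨x, σ y⟩ : Tot E)) : Continuous σ := by
  rw [continuous_iff_continuousAt]
  intro y
  rw [ContinuousAt, tendsto_iff_norm_sub_tendsto_zero]
  have h := upperSemicontinuous_norm_comp (p := fun _ : Y => x)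
    (continuous_sub (p := fun _ : Y => x) hσ (continuous_const (y := (⟨x, σ y⟩ : Tot E))))
  rw [Metric.tendsto_nhds]
  intro ε hε
  filter_upwards [h y ε (by simpa using hε)] with z hz
  simpa using hz

/-- A section that is locally uniformly close to continuous sections is continuous. -/
theorem continuousAt_of_approx {F : ∀ x, E x} {x₀ : X}
    (hF : ∀ ε : ℝ, 0 < ε → ∃ h : ∀ x, E x, Continuous (fun x => (⟨x, h x⟩ : Tot E)) ∧
      ∀ᶠ x in 𝓝 x₀, ‖F x - h x‖ ≤ ε) :
    ContinuousAt (fun x => (⟨x, F x⟩ : Tot E)) x₀ := by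
  obtain ⟨g, hg, hgx⟩ := enough_sections (E := E) x₀ (F x₀)
  -- Upper semicontinuity suffices: `h - g` is continuous and small at `x₀`, where `g` agrees with
  -- `F`, and so it stays small nearby. The axiom `tendsto_zero` then gives convergence of `F - g`
  -- in the total space.
  have hlim : Tendsto (fun x => ‖F x - g x‖) (𝓝 x₀) (𝓝 0) := by
    rw [Metric.tendsto_nhds]
    intro ε hε
    obtain ⟨h, hh, hFh⟩ := hF (ε / 3) (by positivity)
    have h1 : ‖h x₀ - g x₀‖ < 2 * ε / 3 := by
      rw [hgx, norm_sub_rev]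
      exact hFh.self_of_nhds.trans_lt (by linarith)
    filter_upwards [hFh, upperSemicontinuous_norm_comp (continuous_sub hh hg) x₀ _ h1] with x hx hx'
    rw [dist_zero_right, norm_norm]
    calc ‖F x - g x‖ = ‖(F x - h x) + (h x - g x)‖ := by rw [sub_add_sub_cancel]
      _ ≤ ‖F x - h x‖ + ‖h x - g x‖ := norm_add_le _ _
      _ < ε := by linarith
  have h0 : Tendsto (fun x => (⟨x, F x - g x⟩ : Tot E)) (𝓝 x₀) (𝓝 ⟨x₀, 0⟩) := by
    refine tendsto_zero x₀ _ ?_ ?_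
    · rw [tendsto_map'_iff]; exact tendsto_id
    · rw [tendsto_map'_iff]; exact hlim
  have h1 := tendsto_add (p := fun x => x) h0 hg.continuousAt
  simpa [ContinuousAt, hgx] using h1

/-- The axioms give continuity only for a fixed scalar. Near `x₀` the section `c x₀ • h` is a
uniform approximation, because `‖h‖` is locally bounded by upper semicontinuity. -/
theorem continuous_smul_section {c : X → ℂ} (hc : Continuous c) {h : ∀ x, E x}
    (hh : Continuous fun x => (⟨x, h x⟩ : Tot E)) :
    Continuous fun x => (⟨x, c x • h x⟩ : Tot E) := by
  rw [continuous_iff_continuousAt]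
  intro x₀
  refine continuousAt_of_approx fun ε hε =>
    ⟨fun x => c x₀ • h x, (continuous_smul (E := E) (c x₀)).comp hh, ?_⟩
  have h1 : ∀ᶠ x in 𝓝 x₀, ‖h x‖ < ‖h x₀‖ + 1 :=
    upperSemicontinuous_norm_comp hh x₀ _ (by linarith)
  have h2 : ∀ᶠ x in 𝓝 x₀, ‖c x - c x₀‖ < ε / (‖h x₀‖ + 1) := by
    have := Metric.tendsto_nhds.1 (hc.continuousAt (x := x₀)) (ε / (‖h x₀‖ + 1)) (by positivity)
    simpa [dist_eq_norm] using this
  filter_upwards [h1, h2] with x hx hx'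
  rw [← sub_smul, norm_smul]
  calc ‖c x - c x₀‖ * ‖h x‖ ≤ ε / (‖h x₀‖ + 1) * (‖h x₀‖ + 1) := by gcongr
    _ = ε := by field_simp

theorem continuous_zero_section : Continuous fun x => (⟨x, 0⟩ : Tot E) := (GammaC E).zero_mem.1

theorem continuous_sum_section {ι : Type*} (t : Finset ι) {h : ι → ∀ x, E x}
    (hh : ∀ i ∈ t, Continuous fun x => (⟨x, h i x⟩ : Tot E)) :
    Continuous fun x => (⟨x, ∑ i ∈ t, h i x⟩ : Tot E) := by
  classical
  induction t using Finset.induction_on with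
  | empty => simpa using continuous_zero_section
  | insert i t hi ih =>
    simp only [Finset.sum_insert hi]
    exact continuous_add (hh i (by simp)) (ih fun j hj => hh j (by simp [hj]))

end USCBanachBundle

namespace GammaC

variable {X : Type u} [TopologicalSpace X] {E : X → Type v}
  [∀ x, NormedAddCommGroup (E x)] [∀ x, NormedSpace ℂ (E x)] [∀ x, CompleteSpace (E x)]
  [TopologicalSpace (Tot E)] [USCBanachBundle E] (f : GammaC E)

/-- The closed support of a section. -/
def supp : Set X := closure {x | f.1 x ≠ 0}

theorem isCompact_supp : IsCompact (GammaC.supp f) := f.2.2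

theorem eq_zero_of_notMem_supp {x : X} (h : x ∉ (GammaC.supp f)) : f.1 x = 0 := by
  by_contra h'
  exact h (subset_closure h')

theorem upperSemicontinuous_norm : UpperSemicontinuous fun x => ‖f.1 x‖ :=
  USCBanachBundle.upperSemicontinuous_norm_comp (p := fun x => x) f.2.1

theorem measurable_norm [MeasurableSpace X] [BorelSpace X] : Measurable fun x => ‖f.1 x‖ :=
  (GammaC.upperSemicontinuous_norm f).measurable

theorem exists_norm_le : ∃ C : ℝ, 0 ≤ C ∧ ∀ x, ‖f.1 x‖ ≤ C := by
  obtain ⟨C, hC⟩ := ((GammaC.upperSemicontinuous_norm f).upperSemicontinuousOn (GammaC.supp f)).bddAbove_of_isCompact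
    (GammaC.isCompact_supp f)
  refine ⟨max C 0, le_max_right _ _, fun x => ?_⟩
  by_cases hx : x ∈ (GammaC.supp f)
  · exact (hC ⟨x, hx, rfl⟩).trans (le_max_left _ _)
  · simp [(GammaC.eq_zero_of_notMem_supp f) hx]

end GammaC

/-! ## Topology of the unit space and uniform bounds for Haar systems -/

namespace TopologicalGroupoid

variable {G₀ : Type u₀} (G : Type u) [TopologicalSpace G₀] [TopologicalSpace G]
  [TopologicalGroupoid G₀ G]

/-- The range map is a continuous left inverse of `one`. Through this embedding the unit space
inherits its separation and countability from `G`. -/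
theorem isClosedEmbedding_one [T2Space G] : IsClosedEmbedding (one : G₀ → G) :=
  Function.LeftInverse.isClosedEmbedding r_one continuous_r continuous_one

theorem t2Space_base [T2Space G] : T2Space G₀ := (isClosedEmbedding_one G).isEmbedding.t2Space

theorem secondCountableTopology_base [T2Space G] [SecondCountableTopology G] :
    SecondCountableTopology G₀ :=
  (isClosedEmbedding_one G).isEmbedding.secondCountableTopology

variable {G}

theorem continuous_inv_mul :
    Continuous fun p : {p : G × G // r p.1 = r p.2} => p.1.1⁻¹ * p.1.2 :=
  continuousOn_mul.comp_continuous
    ((continuous_inv.comp (continuous_fst.comp continuous_subtype_val)).prodMk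
      (continuous_snd.comp continuous_subtype_val))
    fun p => (s_inv _).trans p.2

theorem mul_inv_mul {x y : G} (h : r y = r x) : y * (y⁻¹ * x) = x := by
  rw [← mul_assoc _ _ _ (r_inv y).symm ((s_inv y).trans h), mul_inv, h, one_mul]

theorem inv_mul_mul {x y : G} (h : s x = r y) : x⁻¹ * (x * y) = y := by
  rw [← mul_assoc _ _ _ (s_inv x) h, inv_mul, h, one_mul]

/-- Multiplication is continuous only on composable pairs, but these form a closed set because `G₀`
is Hausdorff. -/
theorem isCompact_image_mul [T2Space G] {K L : Set G} (hK : IsCompact K) (hL : IsCompact L) :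
    IsCompact ((fun q : G × G => q.1 * q.2) '' ((K ×ˢ L) ∩ {q | s q.1 = r q.2})) := by
  have := t2Space_base G
  refine IsCompact.image_of_continuousOn ?_ (continuousOn_mul.mono inter_subset_right)
  exact (hK.prod hL).inter_right (isClosed_eq (continuous_s.comp continuous_fst)
    (continuous_r.comp continuous_snd))

end TopologicalGroupoid

namespace HaarSystem

open TopologicalGroupoid

variable {G₀ : Type u₀} {G : Type u} [TopologicalSpace G₀] [TopologicalSpace G]
  [TopologicalGroupoid G₀ G] [MeasurableSpace G] (lam : HaarSystem G₀ G)

instance (a : G₀) : IsLocallyFiniteMeasure (lam.lam a) := lam.locallyFinite a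

theorem ae_r_eq (a : G₀) : ∀ᵐ x ∂(lam.lam a), r x = a := lam.null_off_fibre a

variable [T2Space G] [LocallyCompactSpace G] [BorelSpace G]

/-- For a bump function `φ` equal to `1` on `K`, the integral `∫ φ dλ^a` dominates `λ^a(K)`. It is
continuous in `a` and vanishes off the compact set `r(supp φ)`, hence is bounded. -/
theorem exists_measure_le {K : Set G} (hK : IsCompact K) :
    ∃ C : ℝ, 0 ≤ C ∧ ∀ a, lam.lam a K ≤ ENNReal.ofReal C := by
  obtain ⟨φ, hφ1, -, hφc, hφ⟩ := exists_continuous_one_zero_of_isCompact hK isClosed_empty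
    (disjoint_empty K)
  have hcont := lam.continuous_integral φ φ.continuous hφc
  obtain ⟨C, hC⟩ := (IsCompact.image hφc continuous_r).bddAbove_image hcont.continuousOn
  refine ⟨max C 0, le_max_right _ _, fun a => ?_⟩
  have hint : Integrable φ (lam.lam a) := φ.continuous.integrable_of_hasCompactSupport hφc
  have h1 : lam.lam a K ≤ ENNReal.ofReal (∫ x, φ x ∂(lam.lam a)) := by
    rw [ofReal_integral_eq_lintegral_ofReal hint (Eventually.of_forall fun x => (hφ x).1)]
    rw [← lintegral_indicator_one hK.measurableSet]
    refine lintegral_mono fun x => ?_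
    by_cases hx : x ∈ K
    · simp [hx, hφ1 hx]
    · simp [hx]
  refine h1.trans (ENNReal.ofReal_le_ofReal ?_)
  by_cases ha : a ∈ r '' tsupport φ
  · exact (hC ⟨a, ha, rfl⟩).trans (le_max_left _ _)
  · refine le_trans (le_of_eq ?_) (le_max_right _ _)
    refine integral_eq_zero_of_ae ?_
    filter_upwards [lam.ae_r_eq a] with x hx
    refine image_eq_zero_of_notMem_tsupport fun h => ha ⟨x, h, hx⟩

end HaarSystem

/-! ## The convolution product -/

section Convolution

open TopologicalGroupoid FellBundle

variable {G₀ : Type u₀} {G : Type u} [TopologicalSpace G₀] [TopologicalSpace G]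
  [TopologicalGroupoid G₀ G] {E : G → Type v}
  [∀ x, NormedAddCommGroup (E x)] [∀ x, NormedSpace ℂ (E x)] [∀ x, CompleteSpace (E x)]
  [TopologicalSpace (Tot E)] [FellBundle E]

/-- Stated in the total space, the identity hides the transport along `y (y⁻¹ x) = x`. Continuity of
the product and functoriality of `π` apply to this form. -/
theorem mk_convIntegrand (f g : ∀ x, E x) {x y : G} (h : r y = r x) :
    (⟨x, convIntegrand f g x y⟩ : Tot E) =
      totMul (⟨y, f y⟩ : Tot E) ⟨y⁻¹ * x, g (y⁻¹ * x)⟩ (composable_conv h) := by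
  rw [convIntegrand, dif_pos h]
  exact Tot.mk_toFib (mul_inv_mul h)

theorem convIntegrand_of_ne (f g : ∀ x, E x) {x y : G} (h : r y ≠ r x) :
    convIntegrand f g x y = 0 := by
  rw [convIntegrand, dif_neg h]

theorem convIntegrand_eq_zero_left {f : ∀ x, E x} (g : ∀ x, E x) {x y : G} (hf : f y = 0) :
    convIntegrand f g x y = 0 := by
  by_cases h : r y = r x
  · rw [convIntegrand, dif_pos h, hf, map_zero, LinearMap.zero_apply, ← norm_eq_zero,
      Tot.norm_toFib (mul_inv_mul h), norm_zero]
  · exact convIntegrand_of_ne _ _ h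

theorem convIntegrand_eq_zero_right (f : ∀ x, E x) {g : ∀ x, E x} {x y : G}
    (hg : g (y⁻¹ * x) = 0) : convIntegrand f g x y = 0 := by
  by_cases h : r y = r x
  · rw [convIntegrand, dif_pos h, hg, map_zero, ← norm_eq_zero,
      Tot.norm_toFib (mul_inv_mul h), norm_zero]
  · exact convIntegrand_of_ne _ _ h

/-- The extension by zero breaks continuity in general, so joint continuity is claimed only on pairs
with common range. -/
theorem continuous_convIntegrand (f g : GammaC E) :
    Continuous fun p : {p : G × G // r p.1 = r p.2} =>
      (⟨p.1.2, convIntegrand f.1 g.1 p.1.2 p.1.1⟩ : Tot E) := by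
  have h1 : Continuous fun p : {p : G × G // r p.1 = r p.2} => (⟨p.1.1, f.1 p.1.1⟩ : Tot E) :=
    f.2.1.comp (continuous_fst.comp continuous_subtype_val)
  have h2 : Continuous fun p : {p : G × G // r p.1 = r p.2} =>
      (⟨p.1.1⁻¹ * p.1.2, g.1 (p.1.1⁻¹ * p.1.2)⟩ : Tot E) :=
    g.2.1.comp continuous_inv_mul
  have h3 := (continuous_m (E := E)).comp
    ((h1.prodMk h2).subtype_mk fun p => composable_conv p.2)
  refine h3.congr fun p => ?_
  exact (mk_convIntegrand f.1 g.1 p.2).symm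

theorem conv_eq_zero [MeasurableSpace G] (lam : HaarSystem G₀ G) {f g : GammaC E} {x : G}
    (h : x ∉ (fun q : G × G => q.1 * q.2) '' (((GammaC.supp f) ×ˢ (GammaC.supp g)) ∩ {q | s q.1 = r q.2})) :
    conv lam f.1 g.1 x = 0 := by
  refine integral_eq_zero_of_ae (Eventually.of_forall fun y => ?_)
  by_cases hr : r y = r x
  · by_cases hf : y ∈ (GammaC.supp f)
    · by_cases hg : y⁻¹ * x ∈ (GammaC.supp g)
      · exact (h ⟨(y, y⁻¹ * x), ⟨⟨hf, hg⟩, composable_conv hr⟩, mul_inv_mul hr⟩).elim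
      · exact convIntegrand_eq_zero_right _ ((GammaC.eq_zero_of_notMem_supp g) hg)
    · exact convIntegrand_eq_zero_left _ ((GammaC.eq_zero_of_notMem_supp f) hf)
  · exact convIntegrand_of_ne _ _ hr

/-- For fixed `x` the integrand stays in the single fibre `E x`, where the topology of the total
space is the norm topology. -/
theorem continuousOn_convIntegrand (f g : GammaC E) (x : G) :
    ContinuousOn (convIntegrand f.1 g.1 x) {y | r y = r x} := by
  rw [continuousOn_iff_continuous_domRestrict]
  refine USCBanachBundle.continuous_of_continuous_mk ?_
  exact (continuous_convIntegrand f g).comp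
    (g := fun p : {p : G × G // r p.1 = r p.2} =>
      (⟨p.1.2, convIntegrand f.1 g.1 p.1.2 p.1.1⟩ : Tot E))
    (f := fun y : {y : G // r y = r x} => ⟨(y.1, x), y.2⟩)
    ((continuous_subtype_val.prodMk continuous_const).subtype_mk _)

variable [T2Space G] [LocallyCompactSpace G] [MeasurableSpace G] [BorelSpace G]
  (lam : HaarSystem G₀ G)

theorem integrable_convIntegrand (f g : GammaC E) (x : G) :
    Integrable (convIntegrand f.1 g.1 x) (lam.lam (r x)) := by
  have := t2Space_base G
  have hK : IsCompact ((GammaC.supp f) ∩ {y | r y = r x}) :=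
    (GammaC.isCompact_supp f).inter_right (isClosed_eq continuous_r continuous_const)
  have h1 : IntegrableOn (convIntegrand f.1 g.1 x) ((GammaC.supp f) ∩ {y | r y = r x}) (lam.lam (r x)) := by
    have hcont := (continuousOn_convIntegrand f g x).mono
      (inter_subset_right (s := (GammaC.supp f)) (t := {y | r y = r x}))
    obtain ⟨C, hC⟩ := hK.exists_bound_of_continuousOn hcont
    exact IntegrableOn.of_bound hK.measure_lt_top
      (hcont.aestronglyMeasurable_of_isCompact hK hK.measurableSet) C
      (ae_restrict_of_forall_mem hK.measurableSet hC)
  refine (integrableOn_iff_integrable_of_support_subset fun y hy => ?_).1 h1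
  by_contra h
  refine hy ?_
  by_cases hf : y ∈ (GammaC.supp f)
  · exact convIntegrand_of_ne _ _ fun h' => h ⟨hf, h'⟩
  · exact convIntegrand_eq_zero_left _ ((GammaC.eq_zero_of_notMem_supp f) hf)

/-- Near `x₀`, and for `y` in a small open set `V i`, the integrand is uniformly close to a
continuous section `h i` of `x` alone. Gluing with a partition of unity `φ` on the support of `f`
gives the approximation `∑ (∫ φ i dλ^{r(x)}) h i`, which is continuous by the continuity of the Haar
system. -/
theorem continuous_conv (f g : GammaC E) :
    Continuous fun x => (⟨x, conv lam f.1 g.1 x⟩ : Tot E) := by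
  have ht2 := t2Space_base G
  rw [continuous_iff_continuousAt]
  intro x₀
  refine USCBanachBundle.continuousAt_of_approx fun ε hε => ?_
  obtain ⟨K, hK, hfK⟩ := exists_compact_superset (GammaC.isCompact_supp f)
  obtain ⟨C, hC0, hC⟩ := lam.exists_measure_le hK
  -- The integration will cost a factor `λ^{r(x)}(K) ≤ C`; adding `1` keeps the denominator
  -- positive.
  set δ : ℝ := ε / (C + 1) with hδ_def
  have hδ : 0 < δ := by positivity
  have hloc : ∀ y : G, ∃ V : Set G, IsOpen V ∧ y ∈ V ∧ ∃ U ∈ 𝓝 x₀, ∃ h : ∀ x, E x,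
      Continuous (fun x => (⟨x, h x⟩ : Tot E)) ∧ ∀ y' ∈ V, ∀ x ∈ U, r y' = r x →
        ‖convIntegrand f.1 g.1 x y' - h x‖ ≤ δ := by
    intro y
    by_cases hy : r y = r x₀
    · obtain ⟨h, hh, hhx⟩ := USCBanachBundle.enough_sections (E := E) x₀
        (convIntegrand f.1 g.1 x₀ y)
      have hc := USCBanachBundle.upperSemicontinuous_norm_comp
        (USCBanachBundle.continuous_sub
          (p := fun p : {p : G × G // r p.1 = r p.2} => p.1.2)
          (τ := fun p => h p.1.2) (continuous_convIntegrand f g)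
          (hh.comp (continuous_snd.comp continuous_subtype_val)))
        ⟨(y, x₀), hy⟩ δ (by simpa [hhx] using hδ)
      rw [nhds_subtype_eq_comap, eventually_comap, nhds_prod_eq] at hc
      obtain ⟨V, hV, U, hU, hVU⟩ := eventually_prod_iff.1 hc
      obtain ⟨V', hV', hV'o, hyV'⟩ := mem_nhds_iff.1 hV
      exact ⟨V', hV'o, hyV', U, hU, h, hh, fun y' hy' x hx hr =>
        (hVU (hV' hy') hx ⟨(y', x), hr⟩ rfl).le⟩
    -- If `r y ≠ r x₀`, neighbourhoods with disjoint ranges contain no pair with common range, so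
    -- the zero section works vacuously.
    · obtain ⟨A, B, hA, hB, hyA, hxB, hAB⟩ := t2_separation hy
      refine ⟨r ⁻¹' A, hA.preimage continuous_r, hyA, r ⁻¹' B,
        (hB.preimage continuous_r).mem_nhds hxB, fun x => 0,
        USCBanachBundle.continuous_zero_section, fun y' hy' x hx hr => ?_⟩
      exact (Set.disjoint_left.1 hAB hy' (by rw [hr]; exact hx)).elim
  choose V hVo hyV U hU h hh hest using hloc
  obtain ⟨t, ht⟩ := (GammaC.isCompact_supp f).elim_nhds_subcover (fun y => V y ∩ interior K)
    (fun y hy => ((hVo y).inter isOpen_interior).mem_nhds ⟨hyV y, hfK hy⟩)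
  have hcov : (GammaC.supp f) ⊆ ⋃ i : t, V i ∩ interior K := by
    intro y hy
    obtain ⟨i, hi, hyi⟩ := mem_iUnion₂.1 (ht.2 hy)
    exact mem_iUnion.2 ⟨⟨i, hi⟩, hyi⟩
  obtain ⟨φ, hφ, hφc⟩ := PartitionOfUnity.exists_isSubordinate_of_locallyFinite_t2space
    (GammaC.isCompact_supp f) (fun i : t => V i ∩ interior K)
    (fun i => (hVo i).inter isOpen_interior) (locallyFinite_of_finite _) hcov
  have hφ0 : ∀ (i : t) y, y ∉ V i ∩ interior K → φ i y = 0 := fun i y hy =>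
    image_eq_zero_of_notMem_tsupport fun h => hy (hφ i h)
  have hφint : ∀ i a, Integrable (φ i) (lam.lam a) := fun i a =>
    (φ i).continuous.integrable_of_hasCompactSupport (hφc i)
  refine ⟨fun x => ∑ i, ((∫ y, φ i y ∂(lam.lam (r x)) : ℝ) : ℂ) • h i x, ?_, ?_⟩
  · refine USCBanachBundle.continuous_sum_section _ fun i _ => ?_
    refine USCBanachBundle.continuous_smul_section ?_ (hh i)
    exact Complex.continuous_ofReal.comp
      ((lam.continuous_integral (φ i) (φ i).continuous (hφc i)).comp continuous_r)
  have hUt : (⋂ i ∈ t, U i) ∈ 𝓝 x₀ := (biInter_finset_mem t).2 fun i _ => hU i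
  filter_upwards [hUt] with x hx
  have hx : ∀ i : t, x ∈ U i := fun i => mem_iInter₂.1 hx i i.2
  have hterm : ∀ i ∈ (Finset.univ : Finset t),
      Integrable (fun y => (φ i y : ℂ) • h i x) (lam.lam (r x)) :=
    fun i _ => ((hφint i (r x)).ofReal).smul_const _
  have hsum : ∑ i, ((∫ y, φ i y ∂(lam.lam (r x)) : ℝ) : ℂ) • h i x =
      ∫ y, ∑ i, (φ i y : ℂ) • h i x ∂(lam.lam (r x)) := by
    rw [integral_finsetSum _ hterm]
    refine Finset.sum_congr rfl fun i _ => ?_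
    rw [integral_smul_const, integral_complex_ofReal]
  rw [hsum, conv, ← integral_sub (integrable_convIntegrand lam f g x)
    (integrable_finsetSum _ hterm)]
  have hKt : lam.lam (r x) K ≠ ∞ := hK.measure_lt_top.ne
  have hbound : ∀ᵐ y ∂(lam.lam (r x)),
      ‖convIntegrand f.1 g.1 x y - ∑ i, (φ i y : ℂ) • h i x‖ ≤ K.indicator (fun _ => δ) y := by
    filter_upwards [lam.ae_r_eq (r x)] with y hy
    have hs : ∑ i, φ i y ≤ 1 := by
      have := φ.sum_le_one y
      rwa [finsum_eq_sum_of_fintype] at this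
    -- The `φ i` sum to `1` on the support of `f`, and the integrand vanishes elsewhere.
    have hk : convIntegrand f.1 g.1 x y = ∑ i, (φ i y : ℂ) • convIntegrand f.1 g.1 x y := by
      by_cases hyf : y ∈ (GammaC.supp f)
      · have h1 : ∑ i, φ i y = 1 := by
          have := φ.sum_eq_one hyf
          rwa [finsum_eq_sum_of_fintype] at this
        rw [← Finset.sum_smul, ← Complex.ofReal_sum, h1, Complex.ofReal_one, one_smul]
      · simp [convIntegrand_eq_zero_left g.1 ((GammaC.eq_zero_of_notMem_supp f) hyf)]
    rw [hk, ← Finset.sum_sub_distrib]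
    simp only [← smul_sub]
    have hi : ∀ i, ‖(φ i y : ℂ) • (convIntegrand f.1 g.1 x y - h i x)‖ ≤ φ i y * δ := by
      intro i
      rw [norm_smul, Complex.norm_real, Real.norm_of_nonneg (φ.nonneg i y)]
      by_cases hyi : y ∈ V i ∩ interior K
      · exact mul_le_mul_of_nonneg_left (hest i y hyi.1 x (hx i) hy) (φ.nonneg i y)
      · simp [hφ0 i y hyi]
    refine (norm_sum_le_of_le _ fun i _ => hi i).trans ?_
    by_cases hyK : y ∈ K
    · rw [indicator_of_mem hyK, ← Finset.sum_mul]
      nlinarith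
    · rw [indicator_of_notMem hyK]
      refine le_of_eq (Finset.sum_eq_zero fun i _ => ?_)
      rw [hφ0 i y fun h' => hyK (interior_subset h'.2), zero_mul]
  refine (norm_integral_le_of_norm_le
    ((integrable_indicator_iff hK.measurableSet).2 (integrableOn_const hKt)) hbound).trans ?_
  rw [integral_indicator_const _ hK.measurableSet, smul_eq_mul]
  have h1 : (lam.lam (r x)).real K ≤ C :=
    ENNReal.toReal_le_of_le_ofReal hC0 (hC (r x))
  calc (lam.lam (r x)).real K * δ ≤ (C + 1) * δ := by gcongr; linarith
    _ = ε := by rw [hδ_def]; field_simp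

/-- The convolution as an operation on `Γ_c(G; E)`. -/
noncomputable def GammaC.conv (f g : GammaC E) : GammaC E :=
  ⟨_root_.conv lam f.1 g.1, continuous_conv lam f g, by
    have hc := isCompact_image_mul (GammaC.isCompact_supp f) (GammaC.isCompact_supp g)
    refine hc.of_isClosed_subset isClosed_closure (closure_minimal (fun x hx => ?_) hc.isClosed)
    by_contra h
    exact hx (conv_eq_zero lam h)⟩

end Convolution

/-! ## Measure theory of Haar systems and quasi-invariant measures -/

namespace TopologicalGroupoid

variable {G₀ : Type u₀} {G : Type u} [TopologicalSpace G₀] [TopologicalSpace G]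
  [TopologicalGroupoid G₀ G]

theorem inv_mul_rev {x y : G} (h : s x = r y) : (x * y)⁻¹ = y⁻¹ * x⁻¹ := by
  have h1 : s y⁻¹ = r x⁻¹ := by rw [s_inv, r_inv, h]
  have h2 : s (x * y) = r (y⁻¹ * x⁻¹) := by rw [s_mul _ _ h, r_mul _ _ h1, r_inv]
  have h3 : x * y * (y⁻¹ * x⁻¹) = one (r x) := by
    rw [mul_assoc _ _ _ h (by rw [r_mul _ _ h1, r_inv]), ← mul_assoc _ _ _ (r_inv y).symm h1,
      mul_inv, ← h, ← r_inv x, one_mul, mul_inv]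
  have h4 := inv_mul_mul h2
  rw [h3] at h4
  rw [← h4]
  have h5 := mul_one (x * y)⁻¹
  rw [s_inv, r_mul _ _ h] at h5
  exact h5.symm

variable (G) in
/-- Inversion as a homeomorphism. -/
def invHomeomorph : G ≃ₜ G where
  toFun x := x⁻¹
  invFun x := x⁻¹
  left_inv := inv_inv
  right_inv := inv_inv
  continuous_toFun := continuous_inv
  continuous_invFun := continuous_inv

variable (G) in
/-- Inversion as a measurable equivalence. -/
def invMeasurableEquiv [MeasurableSpace G] [BorelSpace G] : G ≃ᵐ G :=
  (invHomeomorph G).toMeasurableEquiv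

theorem measurable_arrow_inv [MeasurableSpace G] [BorelSpace G] : Measurable fun x : G => x⁻¹ :=
  (continuous_inv (G := G)).measurable

/-- Left translation by `x`, extended to a Borel map on `G`. -/
noncomputable def leftMul (x : G) : G → G :=
  open Classical in {y | s x = r y}.piecewise (fun y => x * y) id

open scoped Classical in
theorem leftMul_of_eq {x y : G} (h : s x = r y) : leftMul x y = x * y :=
  piecewise_eq_of_mem _ _ _ h

variable (G) in
/-- The set of pairs of arrows with common range. -/
def commonRange : Set (G × G) := {p | r p.1 = r p.2}

/-- The map `(x, y) ↦ (x⁻¹, x⁻¹ y)` on pairs with common range, extended to `G × G` by the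
identity. -/
noncomputable def reorigin : G × G → G × G :=
  open Classical in (commonRange G).piecewise (fun p => (p.1⁻¹, p.1⁻¹ * p.2)) id

open scoped Classical in
theorem reorigin_of_mem {p : G × G} (h : p ∈ commonRange G) :
    reorigin p = (p.1⁻¹, p.1⁻¹ * p.2) :=
  piecewise_eq_of_mem _ _ _ h

open scoped Classical in
theorem reorigin_of_notMem {p : G × G} (h : p ∉ commonRange G) : reorigin p = p :=
  piecewise_eq_of_notMem _ _ _ h

theorem reorigin_mem {p : G × G} (h : p ∈ commonRange G) : reorigin p ∈ commonRange G := by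
  rw [reorigin_of_mem h]
  exact (r_mul _ _ ((s_inv p.1).trans h)).symm

theorem involutive_reorigin : Function.Involutive (reorigin : G × G → G × G) := by
  intro p
  by_cases h : p ∈ commonRange G
  · rw [reorigin_of_mem (reorigin_mem h), reorigin_of_mem h]
    simp only [inv_inv]
    rw [mul_inv_mul h]
  · rw [reorigin_of_notMem h, reorigin_of_notMem h]

theorem swap_mem {p : G × G} (h : p ∈ commonRange G) : p.swap ∈ commonRange G := by
  have h' : r p.1 = r p.2 := h
  exact h'.symm

/-- The braid relation. A pair `(x, y)` with common range has three end units `r x`, `s x`, `s y`;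
`reorigin` exchanges the first two and `swap` the last two. Both sides, after rearrangement of the
involutions, are the transposition of `r x` and `s y`. -/
theorem reorigin_swap_reorigin {p : G × G} (h : p ∈ commonRange G) :
    reorigin (reorigin p).swap = (reorigin p.swap).swap := by
  have h' : r p.1 = r p.2 := h
  rw [reorigin_of_mem (swap_mem (reorigin_mem h)), reorigin_of_mem h, reorigin_of_mem (swap_mem h)]
  have h1 : (p.1⁻¹ * p.2)⁻¹ = p.2⁻¹ * p.1 := by
    rw [inv_mul_rev ((s_inv _).trans h'), inv_inv]
  simp only [Prod.swap, h1, Prod.mk.injEq, true_and]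
  rw [mul_assoc _ _ _ ((s_inv _).trans h'.symm) (r_inv _).symm, mul_inv, h', ← s_inv, mul_one]

variable [T2Space G] [SecondCountableTopology G]

theorem isClosed_commonRange : IsClosed (commonRange G) := by
  have := t2Space_base G
  exact isClosed_eq (continuous_r.comp continuous_fst) (continuous_r.comp continuous_snd)

variable [MeasurableSpace G] [BorelSpace G]

open scoped Classical in
theorem measurable_leftMul (x : G) : Measurable (leftMul x) := by
  have := t2Space_base G
  have hc : IsClosed {y : G | s x = r y} := isClosed_eq continuous_const continuous_r
  refine ContinuousOn.measurable_piecewise ?_ continuousOn_id hc.measurableSet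
  exact (continuousOn_mul (G := G)).comp
    (Continuous.prodMk continuous_const continuous_id).continuousOn fun y hy => hy

open scoped Classical in
theorem measurable_reorigin : Measurable (reorigin : G × G → G × G) := by
  refine ContinuousOn.measurable_piecewise ?_ continuousOn_id isClosed_commonRange.measurableSet
  have h1 : ContinuousOn (fun p : G × G => p.1⁻¹) (commonRange G) :=
    (continuous_inv.comp continuous_fst).continuousOn
  exact h1.prodMk (continuousOn_mul.comp (h1.prodMk continuousOn_snd)
    fun p hp => (s_inv _).trans hp)

end TopologicalGroupoid

theorem map_withDensity_of_involutive {α : Type*} [MeasurableSpace α] {m : Measure α} {T : α → α}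
    (hT : Measurable T) (hT' : Function.Involutive T) {g : α → ℝ≥0∞} (hg : Measurable g) :
    (m.withDensity g).map T = (m.map T).withDensity (g ∘ T) := by
  ext s hs
  rw [Measure.map_apply hT hs, withDensity_apply _ (hT hs), withDensity_apply _ hs,
    setLIntegral_map hs (hg.comp hT) hT]
  simp only [Function.comp_apply, hT' _]

namespace HaarSystem

open TopologicalGroupoid ProbabilityTheory

variable {G₀ : Type u₀} {G : Type u} [TopologicalSpace G₀] [TopologicalSpace G]
  [TopologicalGroupoid G₀ G] [T2Space G] [LocallyCompactSpace G] [SecondCountableTopology G]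
  [MeasurableSpace G₀] [BorelSpace G₀] [MeasurableSpace G] [BorelSpace G] (lam : HaarSystem G₀ G)

omit [MeasurableSpace G₀] [BorelSpace G₀] in
-- Left invariance is given on compactly supported continuous functions, and these determine a
-- measure finite on compact sets. The image measure is finite on a compact `K` because almost all
-- of its preimage lies in the compact set `x⁻¹ K`.
theorem map_leftMul (x : G) : (lam.lam (s x)).map (leftMul x) = lam.lam (r x) := by
  have hfin : IsFiniteMeasureOnCompacts ((lam.lam (s x)).map (leftMul x)) := ⟨fun K hK => by
    rw [Measure.map_apply (measurable_leftMul x) hK.measurableSet]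
    have hL := isCompact_image_mul (isCompact_singleton (x := x⁻¹)) hK
    refine lt_of_le_of_lt (measure_mono_ae ?_) hL.measure_lt_top
    filter_upwards [lam.ae_r_eq (s x)] with y hy hyK
    have hyK' : leftMul x y ∈ K := hyK
    rw [leftMul_of_eq hy.symm] at hyK'
    refine ⟨(x⁻¹, x * y), ⟨⟨rfl, hyK'⟩, ?_⟩, inv_mul_mul hy.symm⟩
    exact (s_inv x).trans (r_mul _ _ hy.symm).symm⟩
  refine Measure.ext_of_integral_eq_on_compactlySupported fun f => ?_
  rw [integral_map (f := f) (measurable_leftMul x).aemeasurable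
    f.continuous.measurable.aestronglyMeasurable]
  refine Eq.trans ?_ (lam.left_invariant f f.continuous f.hasCompactSupport x)
  refine integral_congr_ae ?_
  filter_upwards [lam.ae_r_eq (s x)] with y hy
  rw [leftMul_of_eq hy.symm]

omit [MeasurableSpace G₀] [BorelSpace G₀] in
theorem lintegral_inv_mul (x : G) {h : G → ℝ≥0∞} (hh : Measurable h) :
    ∫⁻ y, h (x⁻¹ * y) ∂(lam.lam (r x)) = ∫⁻ y, h y ∂(lam.lam (s x)) := by
  have h1 := lam.map_leftMul x⁻¹
  rw [s_inv, r_inv] at h1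
  rw [← h1, lintegral_map hh (measurable_leftMul _)]
  refine lintegral_congr_ae ?_
  filter_upwards [lam.ae_r_eq (r x)] with y hy
  rw [leftMul_of_eq ((s_inv x).trans hy.symm)]

/-- A Haar system as a kernel. -/
noncomputable def kernel : Kernel G₀ G := ⟨lam.lam, lam.measurable_lam⟩

theorem kernel_apply (a : G₀) : lam.kernel a = lam.lam a := rfl

/-- Each piece of a disjointed compact exhaustion carries a kernel bounded uniformly in the base
point, by `exists_measure_le`. -/
instance : IsSFiniteKernel lam.kernel := by
  let c := CompactExhaustion.choice G
  have hm : ∀ n, MeasurableSet (disjointed c n) := fun n =>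
    MeasurableSet.disjointed (fun i => (c.isCompact i).measurableSet) n
  refine ⟨fun n => lam.kernel.restrict (hm n), fun n => ?_, ?_⟩
  · obtain ⟨C, -, hC⟩ := lam.exists_measure_le (c.isCompact n)
    refine ⟨ENNReal.ofReal C, ENNReal.ofReal_lt_top, fun a => ?_⟩
    rw [Kernel.restrict_apply, Measure.restrict_apply MeasurableSet.univ, univ_inter]
    exact (measure_mono (disjointed_subset _ _)).trans (hC a)
  · ext a E hE
    rw [Kernel.sum_apply, Measure.sum_apply _ hE]
    simp only [Kernel.restrict_apply, Measure.restrict_apply hE]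
    rw [← measure_iUnion, ← inter_iUnion, iUnion_disjointed, c.iUnion_eq, inter_univ]
    · exact fun i j hij => (disjoint_disjointed (f := c) hij).mono inter_subset_right
        inter_subset_right
    · exact fun n => hE.inter (hm n)

instance (a : G₀) : SFinite (lam.lam a) := by
  rw [← kernel_apply]
  infer_instance

omit [MeasurableSpace G₀] [BorelSpace G₀] in
theorem lintegral_lamInv (a : G₀) {h : G → ℝ≥0∞} (hh : Measurable h) :
    ∫⁻ x, h x ∂(lam.lamInv a) = ∫⁻ x, h x⁻¹ ∂(lam.lam a) :=
  lintegral_map hh measurable_arrow_inv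

variable (μ : Measure G₀)

theorem lintegral_nu {h : G → ℝ≥0∞} (hh : Measurable h) :
    ∫⁻ x, h x ∂(lam.nu μ) = ∫⁻ a, ∫⁻ x, h x ∂(lam.lam a) ∂μ :=
  Measure.lintegral_bind lam.measurable_lam.aemeasurable hh.aemeasurable

/-- Since `λ^a` is concentrated over `a`, the preimage under `r` of a `μ`-null set is `ν`-null. -/
theorem ae_nu_of_ae_base {p : G₀ → Prop} (h : ∀ᵐ a ∂μ, p a) : ∀ᵐ x ∂(lam.nu μ), p (r x) := by
  obtain ⟨N, hN, hNm, hN0⟩ := exists_measurable_superset_of_null (ae_iff.1 h)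
  have h1 : lam.nu μ (r ⁻¹' N) = 0 := by
    rw [nu, Measure.bind_apply (continuous_r.measurable hNm) lam.measurable_lam.aemeasurable,
      lintegral_eq_zero_iff' (f := fun a => lam.lam a (r ⁻¹' N)) ((Measure.measurable_coe
        (continuous_r.measurable hNm)).comp lam.measurable_lam).aemeasurable]
    filter_upwards [measure_eq_zero_iff_ae_notMem.1 hN0] with a ha
    refine measure_mono_null (t := {x | r x ≠ a}) (fun x hx hxa => ha ?_) (lam.null_off_fibre a)
    have hx' : r x ∈ N := hx
    rwa [hxa] at hx'
  filter_upwards [measure_eq_zero_iff_ae_notMem.1 h1] with x hx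
  by_contra hp
  exact hx (hN hp)

/-- The measure `ν` is the composition of the constant kernel `μ` with the Haar kernel, so this is
Fubini's theorem for composed kernels. -/
theorem integrable_nu {h : G → ℂ} (hh : Integrable h (lam.nu μ)) :
    (∀ᵐ a ∂μ, Integrable h (lam.lam a)) ∧ Integrable (fun a => ∫ x, h x ∂(lam.lam a)) μ ∧
      ∫ x, h x ∂(lam.nu μ) = ∫ a, ∫ x, h x ∂(lam.lam a) ∂μ := by
  have h1 : lam.nu μ = (lam.kernel ∘ₖ Kernel.const Unit μ) () := by
    rw [← Measure.comp_eq_comp_const_apply]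
    rfl
  rw [h1] at hh ⊢
  refine ⟨?_, ?_, ?_⟩
  · simpa [kernel_apply] using hh.ae_of_comp
  · simpa [kernel_apply] using hh.integral_comp
  · simpa [kernel_apply] using Kernel.integral_comp hh

variable [IsLocallyFiniteMeasure μ]

instance : IsLocallyFiniteMeasure (lam.nu μ) := by
  have ht2 := t2Space_base G
  have : IsFiniteMeasureOnCompacts (lam.nu μ) := ⟨fun K hK => by
    obtain ⟨C, -, hC⟩ := lam.exists_measure_le hK
    have hrK : IsCompact (r '' K) := hK.image continuous_r
    rw [nu, Measure.bind_apply hK.measurableSet lam.measurable_lam.aemeasurable]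
    calc ∫⁻ a, lam.lam a K ∂μ ≤ ∫⁻ a, (r '' K).indicator (fun _ => ENNReal.ofReal C) a ∂μ := by
          refine lintegral_mono fun a => ?_
          by_cases ha : a ∈ r '' K
          · simpa [ha] using hC a
          · simp only [indicator_of_notMem ha, nonpos_iff_eq_zero]
            refine measure_mono_null (fun x hx hxa => ha ⟨x, hx, hxa⟩) (lam.null_off_fibre a)
      _ = ENNReal.ofReal C * μ (r '' K) := by
          rw [lintegral_indicator_const hrK.measurableSet]
      _ < ∞ := ENNReal.mul_lt_top ENNReal.ofReal_lt_top hrK.measure_lt_top⟩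
  exact isLocallyFiniteMeasure_of_isFiniteMeasureOnCompacts

theorem nuInv_eq : lam.nuInv μ = (lam.nu μ).map (invMeasurableEquiv G) := rfl

instance : SigmaFinite (lam.nuInv μ) := by
  rw [nuInv_eq]
  exact (invMeasurableEquiv G).sigmaFinite_map

theorem map_inv_nuInv : (lam.nuInv μ).map (fun x : G => x⁻¹) = lam.nu μ := by
  rw [nuInv, Measure.map_map measurable_arrow_inv measurable_arrow_inv]
  have : (fun x : G => x⁻¹) ∘ (fun x : G => x⁻¹) = id := funext inv_inv
  rw [this, Measure.map_id]

/-- The modular function with values in `[0, ∞]`. -/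
noncomputable def modular (x : G) : ℝ≥0∞ := (lam.nu μ).rnDeriv (lam.nuInv μ) x

theorem measurable_modular : Measurable (lam.modular μ) := Measure.measurable_rnDeriv _ _

theorem measurable_inv_modular : Measurable fun x => (lam.modular μ x)⁻¹ :=
  (lam.measurable_modular μ).inv

theorem measurable_Delta : Measurable (lam.Delta μ) := (lam.measurable_modular μ).ennreal_toReal

variable {μ} (hμ : lam.QuasiInvariant μ)
include hμ

/-- This makes the passage from `modular` to the real-valued `Delta` lossless up to a `ν`-null set.
-/
theorem modular_pos_lt_top : ∀ᵐ x ∂(lam.nu μ), 0 < lam.modular μ x ∧ lam.modular μ x < ∞ := by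
  filter_upwards [Measure.rnDeriv_pos hμ.1, hμ.1 (Measure.rnDeriv_lt_top (lam.nu μ) (lam.nuInv μ))] with x h1 h2
  exact ⟨h1, h2⟩

theorem withDensity_modular : (lam.nuInv μ).withDensity (lam.modular μ) = lam.nu μ :=
  Measure.withDensity_rnDeriv_eq _ _ hμ.1

theorem withDensity_modular_inv :
    (lam.nu μ).withDensity (fun x => (lam.modular μ x)⁻¹) = lam.nuInv μ := by
  have h : (fun x => (lam.modular μ x)⁻¹) =ᵐ[lam.nu μ] (lam.nuInv μ).rnDeriv (lam.nu μ) :=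
    Measure.inv_rnDeriv hμ.1
  rw [withDensity_congr_ae h, Measure.withDensity_rnDeriv_eq _ _ hμ.2]

/-- Pushing `ν = Δ ν⁻¹` forward under inversion gives `ν⁻¹ = (Δ ∘ inv) ν`, while also `ν⁻¹ = Δ^{-1}
ν`. Densities with respect to a `σ`-finite measure are unique. -/
theorem modular_inv : ∀ᵐ x ∂(lam.nu μ), lam.modular μ x⁻¹ = (lam.modular μ x)⁻¹ := by
  have h1 : (lam.nu μ).withDensity (lam.modular μ ∘ fun x => x⁻¹) = lam.nuInv μ := by
    have h := map_withDensity_of_involutive (m := lam.nuInv μ) measurable_arrow_inv inv_inv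
      (lam.measurable_modular μ)
    rw [lam.withDensity_modular hμ, lam.map_inv_nuInv μ] at h
    exact h.symm
  rw [← lam.withDensity_modular_inv hμ] at h1
  exact (withDensity_eq_iff_of_sigmaFinite
    ((lam.measurable_modular μ).comp measurable_arrow_inv).aemeasurable
    (lam.measurable_inv_modular μ).aemeasurable).1 h1

theorem Delta_pos : ∀ᵐ x ∂(lam.nu μ), 0 < lam.Delta μ x := by
  filter_upwards [lam.modular_pos_lt_top hμ] with x hx
  exact ENNReal.toReal_pos hx.1.ne' hx.2.ne

theorem Delta_inv : ∀ᵐ x ∂(lam.nu μ), lam.Delta μ x⁻¹ = (lam.Delta μ x)⁻¹ := by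
  filter_upwards [lam.modular_inv hμ] with x hx
  rw [Delta, Delta, ← ENNReal.toReal_inv]
  exact congrArg ENNReal.toReal hx

theorem lintegral_comp_inv {h : G → ℝ≥0∞} (hh : Measurable h) :
    ∫⁻ x, h x⁻¹ ∂(lam.nu μ) = ∫⁻ x, (lam.modular μ x)⁻¹ * h x ∂(lam.nu μ) := by
  rw [← lintegral_map hh measurable_arrow_inv]
  change ∫⁻ x, h x ∂(lam.nuInv μ) = _
  rw [← lam.withDensity_modular_inv hμ,
    lintegral_withDensity_eq_lintegral_mul _ (lam.measurable_inv_modular μ) hh]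
  rfl

theorem inv_modular_lt_top : ∀ᵐ x ∂(lam.nu μ), (lam.modular μ x)⁻¹ < ∞ := by
  filter_upwards [lam.modular_pos_lt_top hμ] with x hx
  exact ENNReal.inv_lt_top.2 hx.1

/-- The measure `Δ^{-1/2} ν` is invariant under inversion. -/
theorem integral_comp_inv_mul_Delta (h : G → ℂ) :
    ∫ x, h x⁻¹ * ((lam.Delta μ x ^ (-1 / 2 : ℝ) : ℝ) : ℂ) ∂(lam.nu μ) =
      ∫ x, h x * ((lam.Delta μ x ^ (-1 / 2 : ℝ) : ℝ) : ℂ) ∂(lam.nu μ) := by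
  -- The weight is taken at `x⁻¹` so that pulling back along inversion produces the left-hand side.
  have h1 := integral_map_equiv (μ := lam.nu μ) (invMeasurableEquiv G)
    (fun x : G => h x * ((lam.Delta μ x⁻¹ ^ (-1 / 2 : ℝ) : ℝ) : ℂ))
  rw [← lam.nuInv_eq μ, ← lam.withDensity_modular_inv hμ,
    integral_withDensity_eq_integral_toReal_smul (lam.measurable_inv_modular μ)
      (lam.inv_modular_lt_top hμ)] at h1
  have h2 : ∀ x : G, invMeasurableEquiv G x = x⁻¹ := fun x => rfl
  simp only [h2, TopologicalGroupoid.inv_inv] at h1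
  rw [← h1]
  refine integral_congr_ae ?_
  filter_upwards [lam.Delta_inv hμ, lam.Delta_pos hμ] with x hx hx0
  rw [hx, ENNReal.toReal_inv]
  change (lam.Delta μ x)⁻¹ • _ = _
  rw [Complex.real_smul, mul_left_comm, ← Complex.ofReal_mul]
  congr 3
  -- The exponents combine as `Δ^{-1} (Δ^{-1})^{-1/2} = Δ^{-1 + 1/2} = Δ^{-1/2}`.
  rw [Real.inv_rpow hx0.le, ← Real.rpow_neg hx0.le, ← Real.rpow_neg_one, ← Real.rpow_add hx0]
  norm_num

end HaarSystem

/-! ## Pairs of arrows with common range, and the cocycle identity -/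

namespace HaarSystem

open TopologicalGroupoid ProbabilityTheory

variable {G₀ : Type u₀} {G : Type u} [TopologicalSpace G₀] [TopologicalSpace G]
  [TopologicalGroupoid G₀ G] [T2Space G] [LocallyCompactSpace G] [SecondCountableTopology G]
  [MeasurableSpace G₀] [BorelSpace G₀] [MeasurableSpace G] [BorelSpace G] (lam : HaarSystem G₀ G)

/-- The kernel `x ↦ λ^{r(x)}` on `G`. -/
noncomputable def rangeKernel : Kernel G G := lam.kernel.comap r continuous_r.measurable

theorem rangeKernel_apply (x : G) : lam.rangeKernel x = lam.lam (r x) := rfl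

instance : IsSFiniteKernel lam.rangeKernel := by
  unfold rangeKernel
  infer_instance

/-- The measure `∫ λ^a × λ^a dμ(a)` on the pairs of arrows with common range. -/
noncomputable def pairMeasure (μ : Measure G₀) : Measure (G × G) := lam.nu μ ⊗ₘ lam.rangeKernel

variable (μ : Measure G₀) [IsLocallyFiniteMeasure μ]

theorem lintegral_pairMeasure {h : G × G → ℝ≥0∞} (hh : Measurable h) :
    ∫⁻ p, h p ∂(lam.pairMeasure μ) = ∫⁻ x, ∫⁻ y, h (x, y) ∂(lam.lam (r x)) ∂(lam.nu μ) :=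
  Measure.lintegral_compProd hh

theorem ae_commonRange : ∀ᵐ p ∂(lam.pairMeasure μ), p ∈ commonRange G := by
  refine (Measure.ae_compProd_iff isClosed_commonRange.measurableSet).2
    (Eventually.of_forall fun x => ?_)
  filter_upwards [lam.ae_r_eq (r x)] with y hy
  exact hy.symm

theorem lintegral_pairMeasure_base {h : G × G → ℝ≥0∞} (hh : Measurable h) :
    ∫⁻ p, h p ∂(lam.pairMeasure μ) =
      ∫⁻ a, ∫⁻ x, ∫⁻ y, h (x, y) ∂(lam.lam a) ∂(lam.lam a) ∂μ := by
  rw [lintegral_pairMeasure lam μ hh, lintegral_nu]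
  · refine lintegral_congr fun a => lintegral_congr_ae ?_
    filter_upwards [lam.ae_r_eq a] with x hx
    rw [hx]
  · exact hh.lintegral_kernel_prod_right' (κ := lam.rangeKernel)

/-- Disintegrated over the base, the measure is the symmetric product `λ^a × λ^a`, and Tonelli's
theorem applies fibre by fibre. -/
theorem map_swap_pairMeasure : (lam.pairMeasure μ).map Prod.swap = lam.pairMeasure μ := by
  refine Measure.ext_of_lintegral _ fun h hh => ?_
  rw [lintegral_map hh measurable_swap,
    lintegral_pairMeasure_base lam μ (h := fun p => h p.swap) (hh.comp measurable_swap),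
    lintegral_pairMeasure_base lam μ hh]
  refine lintegral_congr fun a => ?_
  exact lintegral_lintegral_swap (f := fun x y => h (y, x)) (hh.comp measurable_swap).aemeasurable

/-- The uniqueness of densities in `modular_cocycle` depends on this. A compact set lies in the
product of its projections, and the second projection has uniformly bounded Haar measure. -/
instance : SigmaFinite (lam.pairMeasure μ) := by
  have : IsFiniteMeasureOnCompacts (lam.pairMeasure μ) := ⟨fun K hK => by
    have h1 := hK.image continuous_fst
    have h2 := hK.image continuous_snd
    obtain ⟨C, -, hC⟩ := lam.exists_measure_le h2
    refine (measure_mono (subset_prod (s := K))).trans_lt ?_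
    rw [pairMeasure, Measure.compProd_apply_prod h1.measurableSet h2.measurableSet]
    calc ∫⁻ x in Prod.fst '' K, lam.rangeKernel x (Prod.snd '' K) ∂(lam.nu μ)
        ≤ ∫⁻ x in Prod.fst '' K, ENNReal.ofReal C ∂(lam.nu μ) :=
          lintegral_mono fun x => hC (r x)
      _ = ENNReal.ofReal C * lam.nu μ (Prod.fst '' K) := setLIntegral_const _ _
      _ < ∞ := ENNReal.mul_lt_top ENNReal.ofReal_lt_top h1.measure_lt_top⟩
  have : IsLocallyFiniteMeasure (lam.pairMeasure μ) :=
    isLocallyFiniteMeasure_of_isFiniteMeasureOnCompacts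
  infer_instance

theorem ae_pairMeasure_fst {p : G → Prop} (h : ∀ᵐ x ∂(lam.nu μ), p x) :
    ∀ᵐ q ∂(lam.pairMeasure μ), p q.1 := by
  obtain ⟨N, hN, hNm, hN0⟩ := exists_measurable_superset_of_null (ae_iff.1 h)
  have h1 := Measure.ae_compProd_of_ae_fst lam.rangeKernel (p := fun x => x ∉ N) hNm.compl
    (measure_eq_zero_iff_ae_notMem.1 hN0)
  filter_upwards [h1] with q hq
  by_contra hp
  exact hq (hN hp)

variable {μ} (hμ : lam.QuasiInvariant μ)
include hμ

/-- For fixed `x`, left invariance absorbs the translation `y ↦ x⁻¹ y`. What remains is the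
inversion of `x` under `ν`, which contributes the density `Δ(x)^{-1}`. -/
theorem map_reorigin_pairMeasure : (lam.pairMeasure μ).map reorigin =
    (lam.pairMeasure μ).withDensity (fun p => (lam.modular μ p.1)⁻¹) := by
  refine Measure.ext_of_lintegral _ fun h hh => ?_
  have hm : Measurable fun p : G × G => (lam.modular μ p.1)⁻¹ :=
    (lam.measurable_inv_modular μ).comp measurable_fst
  have h3 : Measurable fun x => ∫⁻ y, h (x, y) ∂(lam.lam (r x)) :=
    hh.lintegral_kernel_prod_right' (κ := lam.rangeKernel)
  rw [lintegral_map hh measurable_reorigin,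
    lintegral_pairMeasure lam μ (h := fun p => h (reorigin p)) (hh.comp measurable_reorigin),
    lintegral_withDensity_eq_lintegral_mul _ hm hh, lintegral_pairMeasure lam μ (hm.mul hh)]
  have h1 : ∀ x, ∫⁻ y, h (reorigin (x, y)) ∂(lam.lam (r x)) =
      ∫⁻ z, h (x⁻¹, z) ∂(lam.lam (r x⁻¹)) := by
    intro x
    rw [r_inv, ← lam.lintegral_inv_mul x (h := fun z => h (x⁻¹, z))
      (hh.comp measurable_prodMk_left)]
    refine lintegral_congr_ae ?_
    filter_upwards [lam.ae_r_eq (r x)] with y hy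
    rw [reorigin_of_mem (show (x, y) ∈ commonRange G from hy.symm)]
  simp only [h1]
  rw [lam.lintegral_comp_inv hμ h3]
  refine lintegral_congr fun x => ?_
  rw [← lintegral_const_mul _ (f := fun y => h (x, y)) (hh.comp measurable_prodMk_left)]
  rfl

/-- The modular function is a homomorphism almost everywhere. -/
theorem modular_cocycle : ∀ᵐ p ∂(lam.pairMeasure μ),
    (lam.modular μ p.1)⁻¹ * (lam.modular μ (p.1⁻¹ * p.2))⁻¹ = (lam.modular μ p.2)⁻¹ := by
  set m := lam.pairMeasure μ with hm_def
  set ρ : G × G → ℝ≥0∞ := fun p => (lam.modular μ p.1)⁻¹ with hρ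
  have hρm : Measurable ρ := (lam.measurable_inv_modular μ).comp measurable_fst
  have hσ : Measurable (reorigin : G × G → G × G) := measurable_reorigin
  have hmσ : m.map reorigin = m.withDensity ρ := lam.map_reorigin_pairMeasure hμ
  have hmτ : m.map Prod.swap = m := lam.map_swap_pairMeasure μ
  have hinv : Function.Involutive (Prod.swap : G × G → G × G) := Prod.swap_swap
  -- The two sides of the braid relation push `m` forward to measures with densities `Δ(x)^{-1}
  -- Δ(x⁻¹ y)^{-1}` and `Δ(y)^{-1}`.
  have h1 : ((m.map reorigin).map Prod.swap).map reorigin =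
      m.withDensity (ρ * (ρ ∘ Prod.swap ∘ reorigin)) := by
    rw [hmσ, map_withDensity_of_involutive measurable_swap hinv hρm, hmτ,
      map_withDensity_of_involutive hσ involutive_reorigin (hρm.comp measurable_swap), hmσ,
      withDensity_mul _ hρm (hρm.comp (measurable_swap.comp hσ))]
    rfl
  have h2 : ((m.map Prod.swap).map reorigin).map Prod.swap = m.withDensity (ρ ∘ Prod.swap) := by
    rw [hmτ, hmσ, map_withDensity_of_involutive measurable_swap hinv hρm, hmτ]
  have h3 : ((m.map reorigin).map Prod.swap).map reorigin =
      ((m.map Prod.swap).map reorigin).map Prod.swap := by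
    rw [Measure.map_map measurable_swap hσ, Measure.map_map hσ (measurable_swap.comp hσ),
      Measure.map_map hσ measurable_swap,
      Measure.map_map measurable_swap (hσ.comp measurable_swap)]
    refine Measure.map_congr ?_
    filter_upwards [lam.ae_commonRange μ] with p hp
    exact reorigin_swap_reorigin hp
  rw [h1, h2, withDensity_eq_iff_of_sigmaFinite
    (hρm.mul (hρm.comp (measurable_swap.comp hσ))).aemeasurable
    (hρm.comp measurable_swap).aemeasurable] at h3
  filter_upwards [h3, lam.ae_commonRange μ] with p hp hp'
  simp only [Pi.mul_apply, Function.comp_apply, hρ, Prod.fst_swap, reorigin_of_mem hp'] at hp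
  exact hp

theorem Delta_cocycle : ∀ᵐ p ∂(lam.pairMeasure μ),
    lam.Delta μ p.1 * lam.Delta μ (p.1⁻¹ * p.2) = lam.Delta μ p.2 := by
  filter_upwards [lam.modular_cocycle hμ] with p hp
  have h := congrArg ENNReal.toReal hp
  rw [ENNReal.toReal_mul, ENNReal.toReal_inv, ENNReal.toReal_inv, ENNReal.toReal_inv,
    ← _root_.mul_inv] at h
  exact inv_injective h

theorem integrable_comp_reorigin {h : G × G → ℂ}
    (hh : AEStronglyMeasurable h (lam.pairMeasure μ)) :
    Integrable (fun p => h (reorigin p)) (lam.pairMeasure μ) ↔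
      Integrable (fun p => (lam.Delta μ p.1)⁻¹ • h p) (lam.pairMeasure μ) := by
  have hm : Measurable fun p : G × G => (lam.modular μ p.1)⁻¹ :=
    (lam.measurable_inv_modular μ).comp measurable_fst
  have h0 : AEStronglyMeasurable h ((lam.pairMeasure μ).map reorigin) := by
    rw [lam.map_reorigin_pairMeasure hμ]
    exact hh.mono_ac (withDensity_absolutelyContinuous _ _)
  have h1 := integrable_map_measure h0 measurable_reorigin.aemeasurable
  rw [lam.map_reorigin_pairMeasure hμ, integrable_withDensity_iff_integrable_smul' hm
      (lam.ae_pairMeasure_fst μ (lam.inv_modular_lt_top hμ))] at h1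
  simp only [ENNReal.toReal_inv] at h1
  exact h1.symm

/-- Change of variables `(x, y) ↦ (x⁻¹, x⁻¹ y)`. -/
theorem integral_comp_reorigin {h : G × G → ℂ} (hh : AEStronglyMeasurable h (lam.pairMeasure μ)) :
    ∫ p, h (reorigin p) ∂(lam.pairMeasure μ) =
      ∫ p, (lam.Delta μ p.1)⁻¹ • h p ∂(lam.pairMeasure μ) := by
  have hm : Measurable fun p : G × G => (lam.modular μ p.1)⁻¹ :=
    (lam.measurable_inv_modular μ).comp measurable_fst
  have h0 : AEStronglyMeasurable h ((lam.pairMeasure μ).map reorigin) := by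
    rw [lam.map_reorigin_pairMeasure hμ]
    exact hh.mono_ac (withDensity_absolutelyContinuous _ _)
  rw [← integral_map measurable_reorigin.aemeasurable h0, lam.map_reorigin_pairMeasure hμ,
    integral_withDensity_eq_integral_toReal_smul hm
      (lam.ae_pairMeasure_fst μ (lam.inv_modular_lt_top hμ))]
  simp only [ENNReal.toReal_inv]
  rfl

end HaarSystem

/-! ## The integrated form as a family of bounded operators -/

/-- A bounded sesquilinear form on a complete semi-inner product space is given by a bounded operator
on the associated Hilbert space. -/
theorem exists_clm_of_sesquilinear {V : Type*} [SeminormedAddCommGroup V] [InnerProductSpace ℂ V]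
    [CompleteSpace V] (B : V → V → ℂ) (C : ℝ)
    (add_left : ∀ η η' ξ, B (η + η') ξ = B η ξ + B η' ξ)
    (smul_left : ∀ (c : ℂ) η ξ, B (c • η) ξ = starRingEnd ℂ c * B η ξ)
    (add_right : ∀ η ξ ξ', B η (ξ + ξ') = B η ξ + B η ξ')
    (smul_right : ∀ (c : ℂ) η ξ, B η (c • ξ) = c * B η ξ)
    (bound : ∀ η ξ, ‖B η ξ‖ ≤ C * ‖η‖ * ‖ξ‖) (hC : 0 ≤ C) :
    ∃ L : SeparationQuotient V →L[ℂ] SeparationQuotient V,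
      (∀ η ξ, inner ℂ (SeparationQuotient.mk η) (L (SeparationQuotient.mk ξ)) = B η ξ) ∧
        ‖L‖ ≤ C := by
  -- The conjugate makes the form linear in `η`, as the Riesz representation requires.
  let ℓ : V → V →L[ℂ] ℂ := fun ξ => LinearMap.mkContinuous
    { toFun := fun η => starRingEnd ℂ (B η ξ)
      map_add' := fun η η' => by rw [add_left, map_add]
      map_smul' := fun c η => by simp [smul_left] }
    (C * ‖ξ‖) (fun η => by
      have := bound η ξ
      rw [LinearMap.coe_mk, AddHom.coe_mk, RCLike.norm_conj]
      linarith)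
  let ℓ' : V → SeparationQuotient V →L[ℂ] ℂ := fun ξ =>
    SeparationQuotient.liftCLM (ℓ ξ) fun x y h => (h.map (ℓ ξ).continuous).eq
  let T : V → SeparationQuotient V := fun ξ =>
    (InnerProductSpace.toDual ℂ (SeparationQuotient V)).symm (ℓ' ξ)
  have hT : ∀ ξ η, inner ℂ (T ξ) (SeparationQuotient.mk η) = starRingEnd ℂ (B η ξ) := by
    intro ξ η
    simp only [T, InnerProductSpace.toDual_symm_apply]
    rfl
  have hT' : ∀ η ξ, inner ℂ (SeparationQuotient.mk η) (T ξ) = B η ξ := by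
    intro η ξ
    rw [← inner_conj_symm, hT, Complex.conj_conj]
  have hbound : ∀ ξ, ‖T ξ‖ ≤ C * ‖ξ‖ := by
    intro ξ
    -- Testing the form against a representative of `T ξ` itself gives `‖T ξ‖² ≤ C ‖T ξ‖ ‖ξ‖`.
    obtain ⟨η, hη⟩ := SeparationQuotient.surjective_mk (T ξ)
    have h1 : ‖T ξ‖ * ‖T ξ‖ ≤ C * ‖T ξ‖ * ‖ξ‖ := by
      have h2 := bound η ξ
      rw [← hT' η ξ, hη, ← SeparationQuotient.norm_mk η, hη, inner_self_eq_norm_sq_to_K] at h2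
      simpa [sq] using h2
    rcases (norm_nonneg (T ξ)).eq_or_lt with h | h
    · rw [← h]; positivity
    · nlinarith
  let L₀ : V →L[ℂ] SeparationQuotient V := LinearMap.mkContinuous
    { toFun := T
      map_add' := fun ξ ξ' => by
        refine ext_inner_left ℂ fun v => ?_
        obtain ⟨η, rfl⟩ := SeparationQuotient.surjective_mk v
        rw [inner_add_right, hT', hT', hT', add_right]
      map_smul' := fun c ξ => by
        refine ext_inner_left ℂ fun v => ?_
        obtain ⟨η, rfl⟩ := SeparationQuotient.surjective_mk v
        rw [inner_smul_right, hT', hT', smul_right]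
        rfl } C hbound
  refine ⟨SeparationQuotient.liftCLM L₀ fun x y h => (h.map L₀.continuous).eq, fun η ξ => hT' η ξ,
    ContinuousLinearMap.opNorm_le_bound _ hC fun v => ?_⟩
  obtain ⟨ξ, rfl⟩ := SeparationQuotient.surjective_mk v
  rw [SeparationQuotient.norm_mk]
  exact hbound ξ

/-! ### Schur's test -/

namespace HaarSystem

open TopologicalGroupoid

variable {G₀ : Type u₀} {G : Type u} [TopologicalSpace G₀] [TopologicalSpace G]
  [TopologicalGroupoid G₀ G] [T2Space G] [LocallyCompactSpace G] [SecondCountableTopology G]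
  [MeasurableSpace G₀] [BorelSpace G₀] [MeasurableSpace G] [BorelSpace G] (lam : HaarSystem G₀ G)
  {μ : Measure G₀} [IsLocallyFiniteMeasure μ] (hμ : lam.QuasiInvariant μ)

/-- On the fibre over `a` the factor `β ∘ r` is the constant `β a`. This is the half of Schur's test
that uses the measures `λ^a`. -/
theorem lintegral_mul_comp_r_le {φ : G → ℝ≥0∞} (hφ : Measurable φ) {N : ℝ≥0∞}
    (hN : ∀ a, ∫⁻ x, φ x ∂(lam.lam a) ≤ N) {β : G₀ → ℝ≥0∞} (hβ : Measurable β) :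
    ∫⁻ x, φ x * β (r x) ∂(lam.nu μ) ≤ N * ∫⁻ a, β a ∂μ := by
  have hr : Measurable (r : G → G₀) := continuous_r.measurable
  rw [lam.lintegral_nu μ (h := fun x => φ x * β (r x)) (hφ.mul (hβ.comp hr)), ← lintegral_const_mul _ hβ]
  refine lintegral_mono fun a => ?_
  calc ∫⁻ x, φ x * β (r x) ∂(lam.lam a) = ∫⁻ x, φ x * β a ∂(lam.lam a) := by
        refine lintegral_congr_ae ?_
        filter_upwards [lam.ae_r_eq a] with x hx
        rw [hx]
    _ = (∫⁻ x, φ x ∂(lam.lam a)) * β a := lintegral_mul_const _ hφ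
    _ ≤ N * β a := by gcongr; exact hN a

include hμ

/-- The square of `Δ^{-1/2}` is the density of `ν⁻¹` with respect to `ν`. Inversion therefore
exchanges `s` with `r` and `λ_a` with `λ^a`, and reduces the claim to the other half. -/
theorem lintegral_mul_sq_comp_s_le {φ : G → ℝ≥0∞} (hφ : Measurable φ) {N : ℝ≥0∞}
    (hN : ∀ a, ∫⁻ x, φ x ∂(lam.lamInv a) ≤ N) {α : G₀ → ℝ≥0∞} (hα : Measurable α) :
    ∫⁻ x, φ x * (α (s x) * ENNReal.ofReal (lam.Delta μ x ^ (-1 / 2 : ℝ))) ^ 2 ∂(lam.nu μ) ≤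
      N * ∫⁻ a, α a ^ 2 ∂μ := by
  have hs : Measurable (s : G → G₀) := continuous_s.measurable
  have h4 : ∫⁻ x, φ x * (α (s x) * ENNReal.ofReal (lam.Delta μ x ^ (-1 / 2 : ℝ))) ^ 2
      ∂(lam.nu μ) = ∫⁻ x, (lam.modular μ x)⁻¹ * (φ x * α (s x) ^ 2) ∂(lam.nu μ) := by
    refine lintegral_congr_ae ?_
    filter_upwards [lam.Delta_pos hμ, lam.modular_pos_lt_top hμ] with x hx hx'
    have h5 : ENNReal.ofReal (lam.Delta μ x ^ (-1 / 2 : ℝ)) ^ 2 = (lam.modular μ x)⁻¹ := by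
      rw [← ENNReal.ofReal_pow (by positivity), ← Real.rpow_natCast, ← Real.rpow_mul hx.le]
      norm_num
      rw [Real.rpow_neg_one, ENNReal.ofReal_inv_of_pos hx]
      congr 1
      exact ENNReal.ofReal_toReal hx'.2.ne
    rw [mul_pow, h5]
    ring
  rw [h4, ← lam.lintegral_comp_inv hμ (h := fun x => φ x * α (s x) ^ 2)
    (hφ.mul ((hα.comp hs).pow_const 2))]
  simp only [s_inv]
  refine lam.lintegral_mul_comp_r_le (hφ.comp measurable_arrow_inv) (fun a => ?_)
    (hα.pow_const 2)
  have h5 := hN a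
  rwa [lam.lintegral_lamInv a hφ] at h5

/-- Schur's test for the measure `Δ^{-1/2} ν`. -/
theorem lintegral_schur {φ : G → ℝ≥0∞} (hφ : Measurable φ) {N : ℝ≥0∞}
    (hN : ∀ a, ∫⁻ x, φ x ∂(lam.lam a) ≤ N) (hN' : ∀ a, ∫⁻ x, φ x ∂(lam.lamInv a) ≤ N)
    {α β : G₀ → ℝ≥0∞} (hα : Measurable α) (hβ : Measurable β) :
    ∫⁻ x, φ x * β (r x) * α (s x) * ENNReal.ofReal (lam.Delta μ x ^ (-1 / 2 : ℝ)) ∂(lam.nu μ) ≤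
      N * (∫⁻ a, β a ^ 2 ∂μ) ^ (1 / 2 : ℝ) * (∫⁻ a, α a ^ 2 ∂μ) ^ (1 / 2 : ℝ) := by
  have hr : Measurable (r : G → G₀) := continuous_r.measurable
  have hs : Measurable (s : G → G₀) := continuous_s.measurable
  have hw : Measurable fun x => ENNReal.ofReal (lam.Delta μ x ^ (-1 / 2 : ℝ)) :=
    ENNReal.measurable_ofReal.comp ((lam.measurable_Delta μ).pow_const _)
  have hφ' : Measurable fun x => φ x ^ (1 / 2 : ℝ) := hφ.pow_const _
  have hsq : ∀ t : ℝ≥0∞, t ^ (1 / 2 : ℝ) * t ^ (1 / 2 : ℝ) = t := fun t => by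
    rw [← ENNReal.rpow_add_of_nonneg _ _ (by norm_num) (by norm_num)]
    norm_num
  have hsq' : ∀ t : ℝ≥0∞, (t ^ (1 / 2 : ℝ)) ^ (2 : ℝ) = t := fun t => by
    rw [← ENNReal.rpow_mul]
    norm_num
  have hr2 : ∀ t : ℝ≥0∞, t ^ (2 : ℝ) = t ^ 2 := fun t => ENNReal.rpow_natCast t 2
  -- Cauchy–Schwarz with `φ` shared equally between the two factors and the whole weight `Δ^{-1/2}`
  -- attached to `α ∘ s`.
  have h1 := ENNReal.lintegral_mul_le_Lp_mul_Lq (lam.nu μ) (p := 2) (q := 2)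
    ⟨by norm_num, by norm_num, by norm_num⟩
    (f := fun x => φ x ^ (1 / 2 : ℝ) * β (r x))
    (g := fun x => φ x ^ (1 / 2 : ℝ) * (α (s x) * ENNReal.ofReal (lam.Delta μ x ^ (-1 / 2 : ℝ))))
    (hφ'.mul (hβ.comp hr)).aemeasurable (hφ'.mul ((hα.comp hs).mul hw)).aemeasurable
  have h2 : ∫⁻ x, (φ x ^ (1 / 2 : ℝ) * β (r x)) ^ (2 : ℝ) ∂(lam.nu μ) ≤ N * ∫⁻ a, β a ^ 2 ∂μ := by
    simp only [ENNReal.mul_rpow_of_nonneg _ _ (zero_le_two (α := ℝ)), hsq', hr2]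
    exact lam.lintegral_mul_comp_r_le hφ hN (hβ.pow_const 2)
  have h3 : ∫⁻ x, (φ x ^ (1 / 2 : ℝ) *
      (α (s x) * ENNReal.ofReal (lam.Delta μ x ^ (-1 / 2 : ℝ)))) ^ (2 : ℝ) ∂(lam.nu μ) ≤
      N * ∫⁻ a, α a ^ 2 ∂μ := by
    have h4 : ∀ t c : ℝ≥0∞, (t ^ (1 / 2 : ℝ) * c) ^ (2 : ℝ) = t * c ^ 2 := fun t c => by
      rw [ENNReal.mul_rpow_of_nonneg _ _ (zero_le_two (α := ℝ)), hsq', hr2]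
    simp only [h4]
    exact lam.lintegral_mul_sq_comp_s_le hμ hφ hN' hα
  calc ∫⁻ x, φ x * β (r x) * α (s x) * ENNReal.ofReal (lam.Delta μ x ^ (-1 / 2 : ℝ)) ∂(lam.nu μ)
      = ∫⁻ x, ((fun x => φ x ^ (1 / 2 : ℝ) * β (r x)) * fun x => φ x ^ (1 / 2 : ℝ) *
          (α (s x) * ENNReal.ofReal (lam.Delta μ x ^ (-1 / 2 : ℝ)))) x ∂(lam.nu μ) := by
        refine lintegral_congr fun x => ?_
        rw [Pi.mul_apply]
        nth_rewrite 1 [← hsq (φ x)]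
        ring
    _ ≤ (N * ∫⁻ a, β a ^ 2 ∂μ) ^ (1 / 2 : ℝ) * (N * ∫⁻ a, α a ^ 2 ∂μ) ^ (1 / 2 : ℝ) := by
        refine h1.trans ?_
        gcongr
    _ = N * (∫⁻ a, β a ^ 2 ∂μ) ^ (1 / 2 : ℝ) * (∫⁻ a, α a ^ 2 ∂μ) ^ (1 / 2 : ℝ) := by
        rw [ENNReal.mul_rpow_of_nonneg _ _ (by norm_num), ENNReal.mul_rpow_of_nonneg _ _ (by norm_num)]
        nth_rewrite 3 [← hsq N]
        ring

/-- Schur's test, with the second function integrated out. -/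
theorem lintegral_fibre_sq_le {φ : G → ℝ≥0∞} (hφ : Measurable φ) {N : ℝ≥0∞}
    (hN : ∀ a, ∫⁻ x, φ x ∂(lam.lam a) ≤ N) (hN' : ∀ a, ∫⁻ x, φ x ∂(lam.lamInv a) ≤ N)
    {α : G₀ → ℝ≥0∞} (hα : Measurable α) :
    ∫⁻ a, (∫⁻ x, φ x * (α (s x) * ENNReal.ofReal (lam.Delta μ x ^ (-1 / 2 : ℝ)))
      ∂(lam.lam a)) ^ 2 ∂μ ≤ N * (N * ∫⁻ a, α a ^ 2 ∂μ) := by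
  have hs : Measurable (s : G → G₀) := continuous_s.measurable
  have hw : Measurable fun x => α (s x) * ENNReal.ofReal (lam.Delta μ x ^ (-1 / 2 : ℝ)) :=
    (hα.comp hs).mul (ENNReal.measurable_ofReal.comp ((lam.measurable_Delta μ).pow_const _))
  have hm : Measurable fun x => φ x *
      (α (s x) * ENNReal.ofReal (lam.Delta μ x ^ (-1 / 2 : ℝ))) ^ 2 := hφ.mul (hw.pow_const 2)
  have hφ' : Measurable fun x => φ x ^ (1 / 2 : ℝ) := hφ.pow_const _
  have hsq : ∀ t : ℝ≥0∞, t ^ (1 / 2 : ℝ) * t ^ (1 / 2 : ℝ) = t := fun t => by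
    rw [← ENNReal.rpow_add_of_nonneg _ _ (by norm_num) (by norm_num)]
    norm_num
  have hsq' : ∀ t : ℝ≥0∞, (t ^ (1 / 2 : ℝ)) ^ (2 : ℝ) = t := fun t => by
    rw [← ENNReal.rpow_mul]
    norm_num
  have hr2 : ∀ t : ℝ≥0∞, t ^ (2 : ℝ) = t ^ 2 := fun t => ENNReal.rpow_natCast t 2
  refine le_trans ?_ (mul_le_mul_right (lam.lintegral_mul_sq_comp_s_le hμ hφ hN' hα) N)
  rw [lam.lintegral_nu μ hm, ← lintegral_const_mul N
    (f := fun a => ∫⁻ x, φ x * (α (s x) * ENNReal.ofReal (lam.Delta μ x ^ (-1 / 2 : ℝ))) ^ 2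
      ∂(lam.lam a)) (hm.lintegral_kernel (κ := lam.kernel))]
  refine lintegral_mono fun a => ?_
  -- Cauchy–Schwarz on one fibre bounds the square of the integral by `∫ φ dλ^a ≤ N` times the
  -- integral treated in `lintegral_mul_sq_comp_s_le`.
  have h1 := ENNReal.lintegral_mul_le_Lp_mul_Lq (lam.lam a) (p := 2) (q := 2)
    ⟨by norm_num, by norm_num, by norm_num⟩ (f := fun x => φ x ^ (1 / 2 : ℝ))
    (g := fun x => φ x ^ (1 / 2 : ℝ) *
      (α (s x) * ENNReal.ofReal (lam.Delta μ x ^ (-1 / 2 : ℝ))))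
    hφ'.aemeasurable (hφ'.mul hw).aemeasurable
  have h2 : ∀ t c : ℝ≥0∞, (t ^ (1 / 2 : ℝ) * c) ^ (2 : ℝ) = t * c ^ 2 := fun t c => by
    rw [ENNReal.mul_rpow_of_nonneg _ _ (zero_le_two (α := ℝ)), hsq', hr2]
  have h3 : ∀ t : ℝ≥0∞, (t ^ (1 / (2 : ℝ))) ^ 2 = t := fun t => by rw [← hr2, hsq']
  simp only [Pi.mul_apply, ← _root_.mul_assoc] at h1
  simp only [hsq, hsq', _root_.mul_assoc, h2] at h1
  refine (pow_le_pow_left' h1 2).trans ?_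
  rw [mul_pow, h3, h3]
  gcongr
  exact hN a

end HaarSystem

theorem BorelHilbertBundle.PreL2.lintegral_enorm_sq {X : Type u₀} [MeasurableSpace X]
    {H : X → Type w} [∀ a, NormedAddCommGroup (H a)] [∀ a, InnerProductSpace ℂ (H a)]
    [∀ a, CompleteSpace (H a)] {𝓗 : BorelHilbertBundle H} {μ : Measure X} (ξ : 𝓗.PreL2 μ) :
    (∫⁻ a, ‖ξ.sec a‖ₑ ^ 2 ∂μ) ^ (1 / 2 : ℝ) = ENNReal.ofReal ‖ξ‖ := by
  have h : ∀ a, ‖ξ.sec a‖ₑ ^ 2 = ENNReal.ofReal (‖ξ.sec a‖ ^ 2) := fun a => by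
    rw [ENNReal.ofReal_pow (norm_nonneg _), ofReal_norm]
  simp only [h]
  rw [ξ.lintegral_sq, ENNReal.ofReal_rpow_of_nonneg (by positivity) (by norm_num),
    ← Real.sqrt_eq_rpow, Real.sqrt_sq (norm_nonneg _)]

theorem BorelHilbertBundle.IsBorelSection.measurable_enorm {X : Type u₀} [MeasurableSpace X]
    {H : X → Type w} [∀ a, NormedAddCommGroup (H a)] [∀ a, InnerProductSpace ℂ (H a)]
    [∀ a, CompleteSpace (H a)] {𝓗 : BorelHilbertBundle H} {ξ : ∀ a, H a}
    (hξ : 𝓗.IsBorelSection ξ) : Measurable fun a => ‖ξ a‖ₑ := by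
  simp only [← ofReal_norm]
  exact ENNReal.measurable_ofReal.comp hξ.measurable_norm

/-! ### Matrix coefficients and the bounded form they define -/

section IntegratedForm

open TopologicalGroupoid BorelHilbertBundle

variable {G₀ : Type u₀} {G : Type u} [TopologicalSpace G₀] [TopologicalSpace G]
  [TopologicalGroupoid G₀ G]
  {E : G → Type v} [∀ x, NormedAddCommGroup (E x)] [∀ x, NormedSpace ℂ (E x)]
  [∀ x, CompleteSpace (E x)] [TopologicalSpace (Tot E)] [FellBundle E]
  {H : G₀ → Type w} [∀ a, NormedAddCommGroup (H a)] [∀ a, InnerProductSpace ℂ (H a)]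
  [∀ a, CompleteSpace (H a)] (F : StarFunctor E H)

/-- The matrix coefficient `x ↦ ⟪η(r(x)), π(f(x)) ξ(s(x))⟫`. -/
noncomputable def StarFunctor.coeff (f : ∀ x, E x) (ξ η : ∀ a, H a) (x : G) : ℂ :=
  inner ℂ (η (r x)) (F.π (f x) (ξ (s x)))

theorem StarFunctor.enorm_coeff_le (f : ∀ x, E x) (ξ η : ∀ a, H a) (x : G) :
    ‖F.coeff f ξ η x‖ₑ ≤ ‖f x‖ₑ * ‖η (r x)‖ₑ * ‖ξ (s x)‖ₑ := by
  simp only [← ofReal_norm]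
  rw [← ENNReal.ofReal_mul (norm_nonneg _), ← ENNReal.ofReal_mul (by positivity)]
  refine ENNReal.ofReal_le_ofReal ?_
  calc ‖F.coeff f ξ η x‖ ≤ ‖η (r x)‖ * ‖F.π (f x) (ξ (s x))‖ := norm_inner_le_norm _ _
    _ ≤ ‖η (r x)‖ * (‖f x‖ * ‖ξ (s x)‖) := by
        gcongr
        exact (F.π (f x)).le_of_opNorm_le (F.norm_π_le _) _
    _ = ‖f x‖ * ‖η (r x)‖ * ‖ξ (s x)‖ := by ring

variable [T2Space G] [LocallyCompactSpace G] [SecondCountableTopology G]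
  [MeasurableSpace G₀] [BorelSpace G₀] [MeasurableSpace G] [BorelSpace G]

theorem GammaC.measurable_enorm (f : GammaC E) : Measurable fun x => ‖f.1 x‖ₑ := by
  simp only [← ofReal_norm]
  exact ENNReal.measurable_ofReal.comp (GammaC.measurable_norm f)

variable (lam : HaarSystem G₀ G)

/-- The real number `normI` is obtained by `toReal`, which sends `∞` to `0`; finiteness makes it the
true `I`-norm. It holds because `f` is bounded and Haar measures of its compact support, and of the
inverse of that set, are uniformly bounded. -/
theorem iSup_lintegral_ne_top (f : GammaC E) :
    max (⨆ a : G₀, ∫⁻ x, ‖f.1 x‖ₑ ∂(lam.lam a)) (⨆ a : G₀, ∫⁻ x, ‖f.1 x‖ₑ ∂(lam.lamInv a)) ≠ ∞ := by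
  obtain ⟨C, -, hC⟩ := GammaC.exists_norm_le f
  have hK : IsCompact (GammaC.supp f) := GammaC.isCompact_supp f
  have hK' : IsCompact ((fun x : G => x⁻¹) ⁻¹' GammaC.supp f) :=
    (invHomeomorph G).isCompact_preimage.2 hK
  obtain ⟨A, -, hA⟩ := lam.exists_measure_le hK
  obtain ⟨A', -, hA'⟩ := lam.exists_measure_le hK'
  have hf : ∀ x, ‖f.1 x‖ₑ ≤ (GammaC.supp f).indicator (fun _ => ENNReal.ofReal C) x := by
    intro x
    by_cases hx : x ∈ GammaC.supp f
    · rw [indicator_of_mem hx, ← ofReal_norm]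
      exact ENNReal.ofReal_le_ofReal (hC x)
    · simp [GammaC.eq_zero_of_notMem_supp f hx]
  refine (max_lt ?_ ?_).ne
  · refine lt_of_le_of_lt (iSup_le fun a => (lintegral_mono hf).trans ?_)
      (ENNReal.mul_lt_top (ENNReal.ofReal_lt_top (r := C)) (ENNReal.ofReal_lt_top (r := A)))
    rw [lintegral_indicator_const hK.measurableSet]
    gcongr
    exact hA a
  · refine lt_of_le_of_lt (iSup_le fun a => (lintegral_mono hf).trans ?_)
      (ENNReal.mul_lt_top (ENNReal.ofReal_lt_top (r := C)) (ENNReal.ofReal_lt_top (r := A')))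
    rw [lintegral_indicator_const hK.measurableSet, HaarSystem.lamInv,
      Measure.map_apply measurable_arrow_inv hK.measurableSet]
    gcongr
    exact hA' a

theorem ofReal_normI (f : GammaC E) : ENNReal.ofReal (normI lam f.1) =
    max (⨆ a : G₀, ∫⁻ x, ‖f.1 x‖ₑ ∂(lam.lam a)) (⨆ a : G₀, ∫⁻ x, ‖f.1 x‖ₑ ∂(lam.lamInv a)) :=
  ENNReal.ofReal_toReal (iSup_lintegral_ne_top lam f)

theorem normI_nonneg (f : ∀ x, E x) : 0 ≤ normI lam f := ENNReal.toReal_nonneg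

theorem lintegral_le_normI (f : GammaC E) (a : G₀) :
    ∫⁻ x, ‖f.1 x‖ₑ ∂(lam.lam a) ≤ ENNReal.ofReal (normI lam f.1) := by
  rw [ofReal_normI]
  exact (le_iSup (fun a => ∫⁻ x, ‖f.1 x‖ₑ ∂(lam.lam a)) a).trans (le_max_left _ _)

theorem lintegral_lamInv_le_normI (f : GammaC E) (a : G₀) :
    ∫⁻ x, ‖f.1 x‖ₑ ∂(lam.lamInv a) ≤ ENNReal.ofReal (normI lam f.1) := by
  rw [ofReal_normI]
  exact (le_iSup (fun a => ∫⁻ x, ‖f.1 x‖ₑ ∂(lam.lamInv a)) a).trans (le_max_right _ _)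

variable {𝓗 : BorelHilbertBundle H} {F} (hF : F.IsBorel 𝓗)

include hF in
theorem StarFunctor.IsBorel.measurable_coeff (f : GammaC E) {ξ η : ∀ a, H a}
    (hξ : 𝓗.IsBorelSection ξ) (hη : 𝓗.IsBorelSection η) : Measurable (F.coeff f.1 ξ η) := by
  have h1 : Measurable[BundleEnd.measurableSpace 𝓗]
      fun T : BundleEnd H => inner ℂ (η T.tgt) (T.op (ξ T.src)) := by
    refine Measurable.mono (comap_measurable _) ?_ le_rfl
    exact le_iSup₂ (f := fun (ξ : {ξ : ∀ a, H a // 𝓗.IsBorelSection ξ})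
      (η : {η : ∀ a, H a // 𝓗.IsBorelSection η}) => MeasurableSpace.comap
        (fun T : BundleEnd H => inner ℂ (η.1 T.tgt) (T.op (ξ.1 T.src))) inferInstance)
      ⟨ξ, hξ⟩ ⟨η, hη⟩
  exact @Measurable.comp _ _ _ _ (BundleEnd.measurableSpace 𝓗) _ _ _ h1 (hF f.1 f.2)

variable {μ : Measure G₀} [IsLocallyFiniteMeasure μ]

variable (F μ) in
/-- The integrand of the integrated form. -/
noncomputable def StarFunctor.integrand (f : ∀ x, E x) (ξ η : ∀ a, H a) (x : G) : ℂ :=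
  F.coeff f ξ η x * ((lam.Delta μ x ^ (-1 / 2 : ℝ) : ℝ) : ℂ)

theorem HaarSystem.measurable_Delta_rpow :
    Measurable fun x => ((lam.Delta μ x ^ (-1 / 2 : ℝ) : ℝ) : ℂ) :=
  Complex.measurable_ofReal.comp ((lam.measurable_Delta μ).pow_const _)

theorem HaarSystem.Delta_nonneg (x : G) : 0 ≤ lam.Delta μ x := ENNReal.toReal_nonneg

theorem HaarSystem.enorm_Delta_rpow (x : G) :
    ‖((lam.Delta μ x ^ (-1 / 2 : ℝ) : ℝ) : ℂ)‖ₑ = ENNReal.ofReal (lam.Delta μ x ^ (-1 / 2 : ℝ)) := by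
  rw [← ofReal_norm, Complex.norm_real, Real.norm_of_nonneg]
  exact Real.rpow_nonneg (lam.Delta_nonneg x) _

include hF in
theorem StarFunctor.IsBorel.measurable_integrand (f : GammaC E) {ξ η : ∀ a, H a}
    (hξ : 𝓗.IsBorelSection ξ) (hη : 𝓗.IsBorelSection η) :
    Measurable (F.integrand lam μ f.1 ξ η) :=
  (hF.measurable_coeff f hξ hη).mul (lam.measurable_Delta_rpow)

theorem StarFunctor.enorm_integrand_le (f : ∀ x, E x) (ξ η : ∀ a, H a) (x : G) :
    ‖F.integrand lam μ f ξ η x‖ₑ ≤ ‖f x‖ₑ * ‖η (r x)‖ₑ * ‖ξ (s x)‖ₑ *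
      ENNReal.ofReal (lam.Delta μ x ^ (-1 / 2 : ℝ)) := by
  rw [integrand, enorm_mul, lam.enorm_Delta_rpow]
  gcongr
  exact F.enorm_coeff_le f ξ η x

variable {lam} (hμ : lam.QuasiInvariant μ)
include hμ

theorem StarFunctor.lintegral_integrand_le (f : GammaC E) (ξ η : 𝓗.PreL2 μ) :
    ∫⁻ x, ‖F.integrand lam μ f.1 ξ.sec η.sec x‖ₑ ∂(lam.nu μ) ≤
      ENNReal.ofReal (normI lam f.1 * ‖η‖ * ‖ξ‖) := by
  refine (lintegral_mono fun x => F.enorm_integrand_le lam f.1 ξ.sec η.sec x).trans ?_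
  refine (lam.lintegral_schur hμ (GammaC.measurable_enorm f) (lintegral_le_normI lam f)
    (lintegral_lamInv_le_normI lam f) ξ.borel.measurable_enorm η.borel.measurable_enorm).trans ?_
  rw [ξ.lintegral_enorm_sq, η.lintegral_enorm_sq, ← ENNReal.ofReal_mul (normI_nonneg _ _),
    ← ENNReal.ofReal_mul (mul_nonneg (normI_nonneg _ _) (norm_nonneg _))]

include hF

theorem StarFunctor.IsBorel.integrable_integrand (f : GammaC E) (ξ η : 𝓗.PreL2 μ) :
    Integrable (F.integrand lam μ f.1 ξ.sec η.sec) (lam.nu μ) :=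
  ⟨(hF.measurable_integrand lam f ξ.borel η.borel).aestronglyMeasurable,
    (StarFunctor.lintegral_integrand_le hμ f ξ η).trans_lt ENNReal.ofReal_lt_top⟩

/-- The integrals form a sesquilinear form whose bound by the `I`-norm is Schur's test. -/
theorem StarFunctor.IsBorel.exists_operator (f : GammaC E) :
    ∃ L : 𝓗.L2 μ →L[ℂ] 𝓗.L2 μ,
      (∀ η ξ : 𝓗.PreL2 μ, inner ℂ (SeparationQuotient.mk η) (L (SeparationQuotient.mk ξ)) =
        ∫ x, F.integrand lam μ f.1 ξ.sec η.sec x ∂(lam.nu μ)) ∧ ‖L‖ ≤ normI lam f.1 := by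
  have hi := hF.integrable_integrand hμ f
  refine exists_clm_of_sesquilinear (V := 𝓗.PreL2 μ)
    (fun η ξ => ∫ x, F.integrand lam μ f.1 ξ.sec η.sec x ∂(lam.nu μ)) (normI lam f.1)
    (fun η η' ξ => ?_) (fun c η ξ => ?_) (fun η ξ ξ' => ?_) (fun c η ξ => ?_) (fun η ξ => ?_)
    (normI_nonneg _ _)
  · rw [← integral_add (hi ξ η) (hi ξ η')]
    refine integral_congr_ae (Eventually.of_forall fun x => ?_)
    simp only [StarFunctor.integrand, StarFunctor.coeff]
    rw [← add_mul, ← inner_add_left]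
    rfl
  · rw [← integral_const_mul]
    refine integral_congr_ae (Eventually.of_forall fun x => ?_)
    simp only [StarFunctor.integrand, StarFunctor.coeff]
    rw [← _root_.mul_assoc, ← inner_smul_left]
    rfl
  · rw [← integral_add (hi ξ η) (hi ξ' η)]
    refine integral_congr_ae (Eventually.of_forall fun x => ?_)
    simp only [StarFunctor.integrand, StarFunctor.coeff]
    rw [← add_mul, ← inner_add_right, ← map_add]
    rfl
  · rw [← integral_const_mul]
    refine integral_congr_ae (Eventually.of_forall fun x => ?_)
    simp only [StarFunctor.integrand, StarFunctor.coeff]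
    rw [← _root_.mul_assoc, ← inner_smul_right, ← map_smul]
    rfl
  · have h1 := (enorm_integral_le_lintegral_enorm
      (F.integrand lam μ f.1 ξ.sec η.sec) (μ := lam.nu μ)).trans
      (StarFunctor.lintegral_integrand_le hμ f ξ η)
    rwa [← ofReal_norm, ENNReal.ofReal_le_ofReal_iff
      (mul_nonneg (mul_nonneg (normI_nonneg _ _) (norm_nonneg _)) (norm_nonneg _))] at h1

end IntegratedForm

/-! ## The integrated form fibrewise -/

namespace BorelHilbertBundle

variable {X : Type u₀} [MeasurableSpace X] {H : X → Type w}
  [∀ a, NormedAddCommGroup (H a)] [∀ a, InnerProductSpace ℂ (H a)] [∀ a, CompleteSpace (H a)]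
  {𝓗 : BorelHilbertBundle H}

theorem isBorelSection_fund (i : ℕ) : 𝓗.IsBorelSection (𝓗.fund i) :=
  fun j => 𝓗.measurable_inner_fund j i

theorem IsBorelSection.smul_fun {c : X → ℂ} (hc : Measurable c) {ξ : ∀ a, H a}
    (hξ : 𝓗.IsBorelSection ξ) : 𝓗.IsBorelSection fun a => c a • ξ a := fun i => by
  simp only [inner_smul_right]
  exact hc.mul (hξ i)

/-- The section with value `v` at `a` and `0` elsewhere. -/
noncomputable def pointSection (a : X) (v : H a) : ∀ b, H b :=
  open Classical in Function.update 0 a v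

omit [MeasurableSpace X] [∀ a, InnerProductSpace ℂ (H a)] [∀ a, CompleteSpace (H a)] in
theorem pointSection_self (a : X) (v : H a) : pointSection a v a = v := by
  simp [pointSection]

omit [MeasurableSpace X] [∀ a, InnerProductSpace ℂ (H a)] [∀ a, CompleteSpace (H a)] in
theorem pointSection_of_ne {a b : X} (v : H a) (h : b ≠ a) : pointSection a v b = 0 := by
  simp [pointSection, h]

omit [MeasurableSpace X] [∀ a, InnerProductSpace ℂ (H a)] [∀ a, CompleteSpace (H a)] in
theorem enorm_pointSection_le (a b : X) (v : H a) : ‖pointSection a v b‖ₑ ≤ ‖v‖ₑ := by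
  by_cases h : b = a
  · subst h
    rw [pointSection_self]
  · simp [pointSection_of_ne v h]

theorem isBorelSection_pointSection [MeasurableSingletonClass X] (a : X) (v : H a) :
    𝓗.IsBorelSection (pointSection a v) := fun i => by
  have h : (fun b => inner ℂ (𝓗.fund i b) (pointSection a v b)) =
      ({a} : Set X).indicator fun _ => inner ℂ (𝓗.fund i a) v := by
    funext b
    by_cases hb : b = a
    · subst hb
      simp [pointSection_self]
    · simp [pointSection_of_ne v hb, hb]
  rw [h]
  exact measurable_const.indicator (measurableSet_singleton a)

variable {μ : Measure X}

/-- The section `1_B ξ`. -/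
noncomputable def PreL2.restrict (ξ : 𝓗.PreL2 μ) {B : Set X} (hB : MeasurableSet B) : 𝓗.PreL2 μ :=
  (⟨fun a => B.indicator (fun _ => (1 : ℂ)) a • ξ.sec a,
    ξ.borel.smul_fun (measurable_const.indicator hB), by
      refine (ξ.integrable_sq.indicator hB).congr (Eventually.of_forall fun a => ?_)
      by_cases ha : a ∈ B <;> simp [ha]⟩ : 𝓗.sqIntegrable μ)

theorem PreL2.restrict_sec (ξ : 𝓗.PreL2 μ) {B : Set X} (hB : MeasurableSet B) (a : X) :
    (ξ.restrict hB).sec a = B.indicator (fun _ => (1 : ℂ)) a • ξ.sec a := rfl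

/-- Every Borel section agrees with square-integrable ones on sets covering the base. -/
theorem IsBorelSection.exists_preL2 [SigmaFinite μ] {ξ : ∀ a, H a} (hξ : 𝓗.IsBorelSection ξ) :
    ∃ e : ℕ → 𝓗.PreL2 μ, ∀ a, ∃ n, (e n).sec a = ξ a := by
  -- On `S n` the section is bounded and the measure is finite, so the truncation is square
  -- integrable. Every point lies in some `S n`.
  let S : ℕ → Set X := fun n => {a | ‖ξ a‖ ≤ n} ∩ spanningSets μ n
  have hS : ∀ n, MeasurableSet (S n) := fun n =>
    (measurableSet_le hξ.measurable_norm measurable_const).inter (measurableSet_spanningSets μ n)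
  refine ⟨fun n => (⟨fun a => (S n).indicator (fun _ => (1 : ℂ)) a • ξ a,
    hξ.smul_fun (measurable_const.indicator (hS n)), ?_⟩ : 𝓗.sqIntegrable μ), fun a => ?_⟩
  · have h1 : Integrable ((S n).indicator fun _ => (n : ℝ) ^ 2) μ := by
      refine (integrable_indicator_iff (hS n)).2 (integrableOn_const ?_)
      exact ((measure_mono inter_subset_right).trans_lt (measure_spanningSets_lt_top μ n)).ne
    refine h1.mono' (((hξ.smul_fun (measurable_const.indicator
      (hS n))).measurable_norm.pow_const 2).aestronglyMeasurable)
      (Eventually.of_forall fun a => ?_)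
    by_cases ha : a ∈ S n
    · simp only [indicator_of_mem ha, one_smul, norm_pow, norm_norm]
      exact pow_le_pow_left₀ (norm_nonneg _) ha.1 2
    · simp [ha]
  · obtain ⟨n, hn⟩ := exists_nat_ge ‖ξ a‖
    have ha : a ∈ S (max n (spanningSetsIndex μ a)) := by
      refine ⟨hn.trans ?_, monotone_spanningSets μ (le_max_right _ _)
        (mem_spanningSetsIndex μ a)⟩
      exact_mod_cast le_max_left _ _
    refine ⟨max n (spanningSetsIndex μ a), ?_⟩
    change (S _).indicator (fun _ => (1 : ℂ)) a • ξ a = ξ a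
    rw [indicator_of_mem ha, one_smul]

end BorelHilbertBundle

section FibrewiseForm

open TopologicalGroupoid BorelHilbertBundle

variable {G₀ : Type u₀} {G : Type u} [TopologicalSpace G₀] [TopologicalSpace G]
  [TopologicalGroupoid G₀ G]
  {E : G → Type v} [∀ x, NormedAddCommGroup (E x)] [∀ x, NormedSpace ℂ (E x)]
  [∀ x, CompleteSpace (E x)] [TopologicalSpace (Tot E)] [FellBundle E]
  {H : G₀ → Type w} [∀ a, NormedAddCommGroup (H a)] [∀ a, InnerProductSpace ℂ (H a)]
  [∀ a, CompleteSpace (H a)] {F : StarFunctor E H}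
  [T2Space G] [LocallyCompactSpace G] [SecondCountableTopology G]
  [MeasurableSpace G₀] [BorelSpace G₀] [MeasurableSpace G] [BorelSpace G]
  {lam : HaarSystem G₀ G} {𝓗 : BorelHilbertBundle H}
  {μ : Measure G₀} [IsLocallyFiniteMeasure μ]

theorem StarFunctor.integrand_congr {f : ∀ x, E x} {ξ η η' : ∀ a, H a} {x : G}
    (h : η (r x) = η' (r x)) : F.integrand lam μ f ξ η x = F.integrand lam μ f ξ η' x := by
  rw [integrand, integrand, coeff, coeff, h]

theorem StarFunctor.integrand_pointSection {f : ∀ x, E x} {ξ η : ∀ a, H a} {a : G₀} {x : G}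
    (h : r x = a) :
    F.integrand lam μ f ξ (pointSection a (η a)) x = F.integrand lam μ f ξ η x := by
  refine integrand_congr ?_
  rw [h, pointSection_self]

theorem sigmaFinite_base (G : Type u) [TopologicalSpace G] [TopologicalGroupoid G₀ G] [T2Space G]
    [SecondCountableTopology G] (μ : Measure G₀) [IsLocallyFiniteMeasure μ] : SigmaFinite μ := by
  have := secondCountableTopology_base (G₀ := G₀) G
  infer_instance

/-- Schur's test with `β = 1` would give this at once, but `1` need not be square integrable.
Indicators of sets of finite measure exhausting the base are used in its place. -/
theorem ae_lintegral_fibre_lt_top (hμ : lam.QuasiInvariant μ) (f : GammaC E) (ξ : 𝓗.PreL2 μ) :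
    ∀ᵐ a ∂μ, ∫⁻ x, ‖f.1 x‖ₑ * ‖ξ.sec (s x)‖ₑ *
      ENNReal.ofReal (lam.Delta μ x ^ (-1 / 2 : ℝ)) ∂(lam.lam a) < ∞ := by
  have hσ := sigmaFinite_base G μ
  have hr : Measurable (r : G → G₀) := continuous_r.measurable
  have hs : Measurable (s : G → G₀) := continuous_s.measurable
  have hw : Measurable fun x => ENNReal.ofReal (lam.Delta μ x ^ (-1 / 2 : ℝ)) :=
    ENNReal.measurable_ofReal.comp ((lam.measurable_Delta μ).pow_const _)
  let β : ℕ → G₀ → ℝ≥0∞ := fun n => (spanningSets μ n).indicator fun _ => 1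
  have hβ : ∀ n, Measurable (β n) := fun n =>
    measurable_const.indicator (measurableSet_spanningSets μ n)
  have hm : ∀ n, Measurable fun x => ‖f.1 x‖ₑ * β n (r x) * ‖ξ.sec (s x)‖ₑ *
      ENNReal.ofReal (lam.Delta μ x ^ (-1 / 2 : ℝ)) := fun n =>
    (((GammaC.measurable_enorm f).mul ((hβ n).comp hr)).mul
      (ξ.borel.measurable_enorm.comp hs)).mul hw
  have h1 : ∀ n, ∀ᵐ a ∂μ, ∫⁻ x, ‖f.1 x‖ₑ * β n (r x) * ‖ξ.sec (s x)‖ₑ *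
      ENNReal.ofReal (lam.Delta μ x ^ (-1 / 2 : ℝ)) ∂(lam.lam a) < ∞ := by
    intro n
    refine ae_lt_top ((hm n).lintegral_kernel (κ := lam.kernel)) ?_
    rw [← lam.lintegral_nu μ (hm n)]
    refine ((lam.lintegral_schur hμ (GammaC.measurable_enorm f) (lintegral_le_normI lam f)
      (lintegral_lamInv_le_normI lam f) ξ.borel.measurable_enorm (hβ n)).trans_lt ?_).ne
    rw [ξ.lintegral_enorm_sq]
    refine ENNReal.mul_lt_top (ENNReal.mul_lt_top ENNReal.ofReal_lt_top ?_) ENNReal.ofReal_lt_top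
    refine ENNReal.rpow_lt_top_of_nonneg (by norm_num) ?_
    have h2 : ∀ a, β n a ^ 2 = (spanningSets μ n).indicator (fun _ => 1) a := by
      intro a
      by_cases ha : a ∈ spanningSets μ n <;> simp [β, ha]
    simp only [h2]
    rw [lintegral_indicator_const (measurableSet_spanningSets μ n), _root_.one_mul]
    exact (measure_spanningSets_lt_top μ n).ne
  filter_upwards [ae_all_iff.2 h1] with a ha
  refine lt_of_eq_of_lt (lintegral_congr_ae ?_) (ha (spanningSetsIndex μ a))
  filter_upwards [lam.ae_r_eq a] with x hx
  simp only [hx, β, indicator_of_mem (mem_spanningSetsIndex μ a), _root_.mul_one]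

variable (hF : F.IsBorel 𝓗)
include hF

/-- Testing the hypothesis on `1_B η` shows that the two functions of `a` have the same integral
over `B`, for the sets `B` that decide equality almost everywhere. The exceptional null set depends
on `η`. -/
theorem ae_inner_eq_integral_fibre (hμ : lam.QuasiInvariant μ) (f : GammaC E)
    {ξ ζ : 𝓗.PreL2 μ} (hζ : ∀ η : 𝓗.PreL2 μ, ∫ a, inner ℂ (η.sec a) (ζ.sec a) ∂μ =
      ∫ x, F.integrand lam μ f.1 ξ.sec η.sec x ∂(lam.nu μ)) (η : 𝓗.PreL2 μ) :
    ∀ᵐ a ∂μ, inner ℂ (η.sec a) (ζ.sec a) =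
      ∫ x, F.integrand lam μ f.1 ξ.sec η.sec x ∂(lam.lam a) := by
  obtain ⟨-, hi, -⟩ := lam.integrable_nu μ (hF.integrable_integrand hμ f ξ η)
  refine Integrable.ae_eq_of_forall_setIntegral_eq _ _ (η.integrable_inner ζ) hi fun B hB _ => ?_
  have h1 := hζ (η.restrict hB)
  rw [(lam.integrable_nu μ (hF.integrable_integrand hμ f ξ (η.restrict hB))).2.2] at h1
  rw [← integral_indicator hB, ← integral_indicator hB]
  refine Eq.trans ?_ (h1.trans ?_)
  · refine integral_congr_ae (Eventually.of_forall fun a => ?_)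
    by_cases ha : a ∈ B <;> simp [PreL2.restrict_sec, ha]
  · refine integral_congr_ae (Eventually.of_forall fun a => ?_)
    by_cases ha : a ∈ B
    · simp only [indicator_of_mem ha]
      refine integral_congr_ae ?_
      filter_upwards [lam.ae_r_eq a] with x hx
      refine StarFunctor.integrand_congr ?_
      rw [PreL2.restrict_sec, hx, indicator_of_mem ha, one_smul]
    · simp only [indicator_of_notMem ha]
      refine integral_eq_zero_of_ae ?_
      filter_upwards [lam.ae_r_eq a] with x hx
      simp [StarFunctor.integrand, StarFunctor.coeff, PreL2.restrict_sec, hx, ha]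

/-- Almost everywhere, the value of a representative `ζ` of `L(f) ξ` is the weak integral of
`x ↦ π(f(x)) ξ(s(x)) Δ(x)^{-1/2}` over the fibre. -/
theorem ae_inner_eq_integral_pointSection (hμ : lam.QuasiInvariant μ) (f : GammaC E)
    {ξ ζ : 𝓗.PreL2 μ} (hζ : ∀ η : 𝓗.PreL2 μ, ∫ a, inner ℂ (η.sec a) (ζ.sec a) ∂μ =
      ∫ x, F.integrand lam μ f.1 ξ.sec η.sec x ∂(lam.nu μ)) :
    ∀ᵐ a ∂μ, ∀ v : H a, inner ℂ v (ζ.sec a) =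
      ∫ x, F.integrand lam μ f.1 ξ.sec (pointSection a v) x ∂(lam.lam a) := by
  have hσ := sigmaFinite_base G μ
  have ht2 := t2Space_base (G₀ := G₀) G
  -- The fundamental sections need not be square integrable. Cutting each into countably many
  -- square-integrable pieces leaves countably many null sets, hence one that serves all of them.
  choose e he using fun i => (isBorelSection_fund (𝓗 := 𝓗) i).exists_preL2 (μ := μ)
  have h1 : ∀ᵐ a ∂μ, ∀ i n, inner ℂ ((e i n).sec a) (ζ.sec a) =
      ∫ x, F.integrand lam μ f.1 ξ.sec (e i n).sec x ∂(lam.lam a) :=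
    ae_all_iff.2 fun i => ae_all_iff.2 fun n => ae_inner_eq_integral_fibre hF hμ f hζ (e i n)
  filter_upwards [h1, ae_lintegral_fibre_lt_top hμ f ξ] with a ha hfin
  set M := ∫⁻ x, ‖f.1 x‖ₑ * ‖ξ.sec (s x)‖ₑ *
      ENNReal.ofReal (lam.Delta μ x ^ (-1 / 2 : ℝ)) ∂(lam.lam a) with hM
  have hbound : ∀ v : H a, ∫⁻ x, ‖F.integrand lam μ f.1 ξ.sec (pointSection a v) x‖ₑ
      ∂(lam.lam a) ≤ ‖v‖ₑ * M := by
    intro v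
    rw [hM, ← lintegral_const_mul' _ _ enorm_ne_top]
    refine lintegral_mono fun x => (F.enorm_integrand_le lam _ _ _ x).trans ?_
    calc ‖f.1 x‖ₑ * ‖pointSection a v (r x)‖ₑ * ‖ξ.sec (s x)‖ₑ *
          ENNReal.ofReal (lam.Delta μ x ^ (-1 / 2 : ℝ))
        ≤ ‖f.1 x‖ₑ * ‖v‖ₑ * ‖ξ.sec (s x)‖ₑ * ENNReal.ofReal (lam.Delta μ x ^ (-1 / 2 : ℝ)) := by
          gcongr
          exact enorm_pointSection_le _ _ _
      _ = _ := by ring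
  have hint : ∀ v : H a, Integrable (F.integrand lam μ f.1 ξ.sec (pointSection a v))
      (lam.lam a) := fun v =>
    ⟨(hF.measurable_integrand lam f ξ.borel
      (isBorelSection_pointSection a v)).aestronglyMeasurable,
      (hbound v).trans_lt (ENNReal.mul_lt_top enorm_lt_top hfin)⟩
  let I : H a → ℂ := fun v => ∫ x, F.integrand lam μ f.1 ξ.sec (pointSection a v) x ∂(lam.lam a)
  have hadd : ∀ v v', I (v + v') = I v + I v' := by
    intro v v'
    rw [← integral_add (hint v) (hint v')]
    refine integral_congr_ae ?_
    filter_upwards [lam.ae_r_eq a] with x hx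
    subst hx
    simp only [StarFunctor.integrand, StarFunctor.coeff, pointSection_self, inner_add_left, add_mul]
  have hsmul : ∀ (c : ℂ) v, I (c • v) = starRingEnd ℂ c * I v := by
    intro c v
    rw [← integral_const_mul]
    refine integral_congr_ae ?_
    filter_upwards [lam.ae_r_eq a] with x hx
    subst hx
    simp only [StarFunctor.integrand, StarFunctor.coeff, pointSection_self, inner_smul_left,
      _root_.mul_assoc]
  let Λ : H a →L[ℂ] ℂ := LinearMap.mkContinuous
    { toFun := fun v => starRingEnd ℂ (I v)
      map_add' := fun v v' => by rw [hadd, map_add]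
      map_smul' := fun c v => by simp [hsmul] } M.toReal (fun v => by
        have h2 := (enorm_integral_le_lintegral_enorm (μ := lam.lam a)
          (F.integrand lam μ f.1 ξ.sec (pointSection a v))).trans (hbound v)
        have h3 := ENNReal.toReal_mono (ENNReal.mul_lt_top enorm_lt_top hfin).ne h2
        rw [ENNReal.toReal_mul, toReal_enorm, toReal_enorm, mul_comm] at h3
        simpa [I] using h3)
  -- After conjugation both sides are bounded linear functionals of `v`, so agreement on the
  -- fundamental vectors, which are total in `H a`, is enough.
  have hΛ : innerSL ℂ (ζ.sec a) = Λ := by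
    refine ContinuousLinearMap.ext_on (dense_iff_closure_eq.2 (𝓗.total a)) ?_
    rintro _ ⟨i, rfl⟩
    obtain ⟨n, hn⟩ := he i a
    have h4 := ha i n
    rw [hn] at h4
    change inner ℂ (ζ.sec a) (𝓗.fund i a) = starRingEnd ℂ (I (𝓗.fund i a))
    rw [← inner_conj_symm, h4]
    congr 1
    refine integral_congr_ae ?_
    filter_upwards [lam.ae_r_eq a] with x hx
    rw [← hn, StarFunctor.integrand_pointSection hx]
  intro v
  have h5 : inner ℂ (ζ.sec a) v = starRingEnd ℂ (I v) := congrArg (fun T : H a →L[ℂ] ℂ => T v) hΛ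
  rw [← inner_conj_symm, h5, Complex.conj_conj]

end FibrewiseForm

/-! ## Multiplicativity of the integrated form -/

namespace BundleEnd

open BorelHilbertBundle

variable {X : Type u₀} {H : X → Type w}
  [∀ a, NormedAddCommGroup (H a)] [∀ a, InnerProductSpace ℂ (H a)] [∀ a, CompleteSpace (H a)]

/-- The matrix coefficient `⟪η(tgt), op ξ(src)⟫`. -/
noncomputable def mat (T : BundleEnd H) (ξ η : ∀ a, H a) : ℂ := inner ℂ (η T.tgt) (T.op (ξ T.src))

theorem mat_adjoint (T : BundleEnd H) (ξ η : ∀ a, H a) :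
    T.adjoint.mat ξ η = starRingEnd ℂ (T.mat η ξ) := by
  rw [mat, mat, inner_conj_symm]
  exact ContinuousLinearMap.adjoint_inner_right T.op _ _

/-- This moves `S` to the other side of the inner product. The vector `T ξ` becomes a point section
so that the result is again a matrix coefficient, now of the adjoint of `S`. -/
theorem mat_comp (S T : BundleEnd H) (h : S.src = T.tgt) (ξ η : ∀ a, H a) :
    (S.comp T h).mat ξ η =
      starRingEnd ℂ (S.adjoint.mat η (pointSection T.tgt (T.op (ξ T.src)))) := by
  rw [mat_adjoint, Complex.conj_conj]
  obtain ⟨t, s, S⟩ := S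
  obtain ⟨t', s', T⟩ := T
  obtain rfl : s = t' := h
  simp only [mat, comp, pointSection_self]
  rfl

end BundleEnd

namespace BorelHilbertBundle

variable {X : Type u₀} [MeasurableSpace X] {H : X → Type w}
  [∀ a, NormedAddCommGroup (H a)] [∀ a, InnerProductSpace ℂ (H a)] [∀ a, CompleteSpace (H a)]

/-- The pull-back of a Borel Hilbert bundle along a Borel map. -/
def pullback (𝓗 : BorelHilbertBundle H) {Y : Type*} [MeasurableSpace Y] {φ : Y → X}
    (hφ : Measurable φ) : BorelHilbertBundle fun y => H (φ y) where
  fund i y := 𝓗.fund i (φ y)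
  measurable_inner_fund i j := (𝓗.measurable_inner_fund i j).comp hφ
  total y := 𝓗.total (φ y)

theorem inner_pointSection {a b : X} (h : b = a) (ζ : ∀ a, H a) (v : H a) :
    inner ℂ (ζ b) (pointSection a v b) = inner ℂ (ζ a) v := by
  subst h
  rw [pointSection_self]

end BorelHilbertBundle

section Multiplicative

open TopologicalGroupoid BorelHilbertBundle

variable {G₀ : Type u₀} {G : Type u} [TopologicalSpace G₀] [TopologicalSpace G]
  [TopologicalGroupoid G₀ G]
  {E : G → Type v} [∀ x, NormedAddCommGroup (E x)] [∀ x, NormedSpace ℂ (E x)]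
  [∀ x, CompleteSpace (E x)] [TopologicalSpace (Tot E)] [FellBundle E]
  {H : G₀ → Type w} [∀ a, NormedAddCommGroup (H a)] [∀ a, InnerProductSpace ℂ (H a)]
  [∀ a, CompleteSpace (H a)] (F : StarFunctor E H)

theorem GammaC.mk_star (f : GammaC E) (x : G) :
    (⟨x, (GammaC.star f).1 x⟩ : Tot E) = FellBundle.totStar ⟨x⁻¹, f.1 x⁻¹⟩ :=
  Tot.mk_toFib (TopologicalGroupoid.inv_inv x)

namespace StarFunctor

theorem coeff_eq_mat (f : ∀ x, E x) (ξ η : ∀ a, H a) (x : G) :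
    F.coeff f ξ η x = (F.hat ⟨x, f x⟩).mat ξ η := rfl

theorem coeff_star (f : GammaC E) (ξ η : ∀ a, H a) (x : G) :
    F.coeff (GammaC.star f).1 ξ η x = starRingEnd ℂ (F.coeff f.1 η ξ x⁻¹) := by
  rw [coeff_eq_mat, GammaC.mk_star, hat_totStar, BundleEnd.mat_adjoint]
  rfl

/-- The function `(z, w) ↦ ⟪π(g(w)) ξ(s(w)), π(f(z)) η(s(z))⟫` on pairs with common range,
extended by zero. -/
noncomputable def pairCoeff (f g : ∀ x, E x) (ξ η : ∀ a, H a) (p : G × G) : ℂ :=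
  F.coeff f η (pointSection (r p.2) (F.π (g p.2) (ξ (s p.2)))) p.1

/-- The operator `π(f(y))` passes to the other side as `π(f(y)*) = π(f*(y⁻¹))`. The resulting pair
`(y⁻¹, y⁻¹ x)` is the image of `(y, x)` under `reorigin`. -/
theorem coeff_convIntegrand (f : GammaC E) (g : ∀ x, E x) (ξ η : ∀ a, H a) {x y : G}
    (h : r y = r x) :
    inner ℂ (η (r x)) (F.π (convIntegrand f.1 g x y) (ξ (s x))) =
      starRingEnd ℂ (F.pairCoeff (GammaC.star f).1 g ξ η (y⁻¹, y⁻¹ * x)) := by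
  change (F.hat ⟨x, convIntegrand f.1 g x y⟩).mat ξ η = _
  have h1 : (⟨y⁻¹⁻¹, f.1 y⁻¹⁻¹⟩ : Tot E) = ⟨y, f.1 y⟩ := by rw [TopologicalGroupoid.inv_inv]
  rw [mk_convIntegrand f.1 g h, hat_totMul]
  refine (BundleEnd.mat_comp (F.hat ⟨y, f.1 y⟩) (F.hat ⟨y⁻¹ * x, g (y⁻¹ * x)⟩)
    (composable_conv h) ξ η).trans ?_
  rw [← hat_totStar, pairCoeff, coeff_eq_mat, GammaC.mk_star, h1]
  rfl

theorem enorm_pairCoeff_le (f g : ∀ x, E x) (ξ η : ∀ a, H a) (p : G × G) :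
    ‖F.pairCoeff f g ξ η p‖ₑ ≤
      ‖f p.1‖ₑ * (‖g p.2‖ₑ * ‖ξ (s p.2)‖ₑ) * ‖η (s p.1)‖ₑ := by
  refine (F.enorm_coeff_le _ _ _ _).trans ?_
  gcongr
  refine (enorm_pointSection_le _ _ _).trans ?_
  simp only [← ofReal_norm]
  rw [← ENNReal.ofReal_mul (norm_nonneg _)]
  exact ENNReal.ofReal_le_ofReal ((F.π (g p.2)).le_of_opNorm_le (F.norm_π_le _) _)

end StarFunctor

variable [T2Space G] [LocallyCompactSpace G] [SecondCountableTopology G]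
  [MeasurableSpace G₀] [BorelSpace G₀] [MeasurableSpace G] [BorelSpace G]
  {lam : HaarSystem G₀ G} {𝓗 : BorelHilbertBundle H} {F} (hF : F.IsBorel 𝓗)

include hF in
-- On pairs with common range the two vectors lie in the same fibre and are Borel sections of a
-- pulled-back Hilbert bundle, so their inner product is Borel. On other pairs the function is zero.
theorem StarFunctor.IsBorel.measurable_pairCoeff (f g : GammaC E) {ξ η : ∀ a, H a}
    (hξ : 𝓗.IsBorelSection ξ) (hη : 𝓗.IsBorelSection η) :
    Measurable (F.pairCoeff f.1 g.1 ξ η) := by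
  have hr : Measurable (r : G → G₀) := continuous_r.measurable
  refine measurable_of_restrict_of_restrict_compl
    (isClosed_commonRange (G := G)).measurableSet ?_ ?_
  · have hφ : Measurable fun p : commonRange G => r p.1.1 :=
      hr.comp (measurable_fst.comp measurable_subtype_coe)
    refine IsBorelSection.measurable_inner (𝓗 := 𝓗.pullback hφ)
      (ξ := fun p => pointSection (r p.1.2) (F.π (g.1 p.1.2) (ξ (s p.1.2))) (r p.1.1))
      (η := fun p => F.π (f.1 p.1.1) (η (s p.1.1))) (fun i => ?_) (fun i => ?_)
    · have h1 := (hF.measurable_coeff g hξ (isBorelSection_fund i)).comp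
        (measurable_snd.comp (measurable_subtype_coe (p := (· ∈ commonRange G))))
      refine (congrArg Measurable (funext fun p => ?_)).mp h1
      exact (inner_pointSection p.2 (𝓗.fund i) _).symm
    · exact (hF.measurable_coeff f hη (isBorelSection_fund i)).comp
        (measurable_fst.comp measurable_subtype_coe)
  · refine (congrArg Measurable (funext fun p => ?_)).mp (measurable_const (a := (0 : ℂ)))
    have h1 : r p.1.1 ≠ r p.1.2 := p.2
    simp [domRestrict, StarFunctor.pairCoeff, StarFunctor.coeff, pointSection_of_ne _ h1]

variable {μ : Measure G₀} [IsLocallyFiniteMeasure μ] (hμ : lam.QuasiInvariant μ)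
include hF hμ

namespace StarFunctor

/-- Integrating out the variable of `f` leaves the Schur integral of `g` with `B`, the fibre
integral of `‖f‖ ‖η ∘ s‖ Δ^{-1/2}`, as the function on the range side. That `B` is square integrable
is `lintegral_fibre_sq_le`. -/
theorem IsBorel.integrable_pairCoeff (f g : GammaC E) (ξ η : 𝓗.PreL2 μ) :
    Integrable (fun q : G × G => F.pairCoeff f.1 g.1 ξ.sec η.sec q.swap *
      ((lam.Delta μ q.2 ^ (-1 / 2 : ℝ) : ℝ) : ℂ) * ((lam.Delta μ q.1 ^ (-1 / 2 : ℝ) : ℝ) : ℂ))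
      (lam.pairMeasure μ) := by
  have hr : Measurable (r : G → G₀) := continuous_r.measurable
  have hs : Measurable (s : G → G₀) := continuous_s.measurable
  have hw : Measurable fun x => ENNReal.ofReal (lam.Delta μ x ^ (-1 / 2 : ℝ)) :=
    ENNReal.measurable_ofReal.comp ((lam.measurable_Delta μ).pow_const _)
  have hmf : Measurable fun z => ‖f.1 z‖ₑ *
      (‖η.sec (s z)‖ₑ * ENNReal.ofReal (lam.Delta μ z ^ (-1 / 2 : ℝ))) :=
    (GammaC.measurable_enorm f).mul ((η.borel.measurable_enorm.comp hs).mul hw)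
  have hmg : Measurable fun x => ‖g.1 x‖ₑ * ‖ξ.sec (s x)‖ₑ *
      ENNReal.ofReal (lam.Delta μ x ^ (-1 / 2 : ℝ)) :=
    ((GammaC.measurable_enorm g).mul (ξ.borel.measurable_enorm.comp hs)).mul hw
  have hm : Measurable fun q : G × G => F.pairCoeff f.1 g.1 ξ.sec η.sec q.swap *
      ((lam.Delta μ q.2 ^ (-1 / 2 : ℝ) : ℝ) : ℂ) *
      ((lam.Delta μ q.1 ^ (-1 / 2 : ℝ) : ℝ) : ℂ) :=
    (((hF.measurable_pairCoeff f g ξ.borel η.borel).comp measurable_swap).mul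
      (lam.measurable_Delta_rpow.comp measurable_snd)).mul
      (lam.measurable_Delta_rpow.comp measurable_fst)
  refine ⟨hm.aestronglyMeasurable, ?_⟩
  let B : G₀ → ℝ≥0∞ := fun a => ∫⁻ z, ‖f.1 z‖ₑ *
    (‖η.sec (s z)‖ₑ * ENNReal.ofReal (lam.Delta μ z ^ (-1 / 2 : ℝ))) ∂(lam.lam a)
  have hB : Measurable B := hmf.lintegral_kernel (κ := lam.kernel)
  have hL2 : ∀ ζ : 𝓗.PreL2 μ, ∫⁻ a, ‖ζ.sec a‖ₑ ^ 2 ∂μ < ∞ := by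
    intro ζ
    have h1 : ∀ a, ‖ζ.sec a‖ₑ ^ 2 = ENNReal.ofReal (‖ζ.sec a‖ ^ 2) := fun a => by
      rw [ENNReal.ofReal_pow (norm_nonneg _), ofReal_norm]
    simp only [h1]
    rw [ζ.lintegral_sq]
    exact ENNReal.ofReal_lt_top
  calc ∫⁻ q : G × G, ‖F.pairCoeff f.1 g.1 ξ.sec η.sec q.swap *
        ((lam.Delta μ q.2 ^ (-1 / 2 : ℝ) : ℝ) : ℂ) *
        ((lam.Delta μ q.1 ^ (-1 / 2 : ℝ) : ℝ) : ℂ)‖ₑ ∂(lam.pairMeasure μ)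
      ≤ ∫⁻ q : G × G, (‖g.1 q.1‖ₑ * ‖ξ.sec (s q.1)‖ₑ *
          ENNReal.ofReal (lam.Delta μ q.1 ^ (-1 / 2 : ℝ))) * (‖f.1 q.2‖ₑ * (‖η.sec (s q.2)‖ₑ *
          ENNReal.ofReal (lam.Delta μ q.2 ^ (-1 / 2 : ℝ)))) ∂(lam.pairMeasure μ) := by
        refine lintegral_mono fun q => ?_
        rw [enorm_mul, enorm_mul, lam.enorm_Delta_rpow, lam.enorm_Delta_rpow]
        calc _ ≤ ‖f.1 q.2‖ₑ * (‖g.1 q.1‖ₑ * ‖ξ.sec (s q.1)‖ₑ) * ‖η.sec (s q.2)‖ₑ *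
              ENNReal.ofReal (lam.Delta μ q.2 ^ (-1 / 2 : ℝ)) *
              ENNReal.ofReal (lam.Delta μ q.1 ^ (-1 / 2 : ℝ)) := by
              gcongr
              exact F.enorm_pairCoeff_le f.1 g.1 ξ.sec η.sec q.swap
          _ = _ := by ring
    _ = ∫⁻ x, ‖g.1 x‖ₑ * B (r x) * ‖ξ.sec (s x)‖ₑ *
          ENNReal.ofReal (lam.Delta μ x ^ (-1 / 2 : ℝ)) ∂(lam.nu μ) := by
        rw [lam.lintegral_pairMeasure μ (h := fun q : G × G => (‖g.1 q.1‖ₑ * ‖ξ.sec (s q.1)‖ₑ *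
          ENNReal.ofReal (lam.Delta μ q.1 ^ (-1 / 2 : ℝ))) * (‖f.1 q.2‖ₑ * (‖η.sec (s q.2)‖ₑ *
          ENNReal.ofReal (lam.Delta μ q.2 ^ (-1 / 2 : ℝ)))))
          ((hmg.comp measurable_fst).mul (hmf.comp measurable_snd))]
        refine lintegral_congr fun x => ?_
        have h1 : ∫⁻ y, (‖g.1 x‖ₑ * ‖ξ.sec (s x)‖ₑ *
            ENNReal.ofReal (lam.Delta μ x ^ (-1 / 2 : ℝ))) * (‖f.1 y‖ₑ * (‖η.sec (s y)‖ₑ *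
            ENNReal.ofReal (lam.Delta μ y ^ (-1 / 2 : ℝ)))) ∂(lam.lam (r x)) =
            (‖g.1 x‖ₑ * ‖ξ.sec (s x)‖ₑ * ENNReal.ofReal (lam.Delta μ x ^ (-1 / 2 : ℝ))) *
              B (r x) := lintegral_const_mul _ hmf
        refine h1.trans ?_
        ring
    _ ≤ _ := lam.lintegral_schur hμ (GammaC.measurable_enorm g) (lintegral_le_normI lam g)
        (lintegral_lamInv_le_normI lam g) ξ.borel.measurable_enorm hB
    _ < ∞ := by
        refine ENNReal.mul_lt_top (ENNReal.mul_lt_top ENNReal.ofReal_lt_top ?_) ?_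
        · refine ENNReal.rpow_lt_top_of_nonneg (by norm_num) (ne_of_lt ?_)
          refine (lam.lintegral_fibre_sq_le hμ (GammaC.measurable_enorm f)
            (lintegral_le_normI lam f) (lintegral_lamInv_le_normI lam f)
            η.borel.measurable_enorm).trans_lt ?_
          exact ENNReal.mul_lt_top ENNReal.ofReal_lt_top
            (ENNReal.mul_lt_top ENNReal.ofReal_lt_top (hL2 η))
        · exact ENNReal.rpow_lt_top_of_nonneg (by norm_num) (hL2 ξ).ne

/-- Fubini's theorem for the pair form, `θ` being a representative of `L(f) η`. -/
theorem IsBorel.integral_pairCoeff (f g : GammaC E) {ξ η θ : 𝓗.PreL2 μ}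
    (hθ : ∀ ζ : 𝓗.PreL2 μ, ∫ a, inner ℂ (ζ.sec a) (θ.sec a) ∂μ =
      ∫ x, F.integrand lam μ f.1 η.sec ζ.sec x ∂(lam.nu μ)) :
    ∫ q : G × G, starRingEnd ℂ (F.pairCoeff f.1 g.1 ξ.sec η.sec q.swap *
      ((lam.Delta μ q.2 ^ (-1 / 2 : ℝ) : ℝ) : ℂ) * ((lam.Delta μ q.1 ^ (-1 / 2 : ℝ) : ℝ) : ℂ))
      ∂(lam.pairMeasure μ) = ∫ x, F.integrand lam μ g.1 ξ.sec θ.sec x ∂(lam.nu μ) := by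
  have hi := hF.integrable_pairCoeff hμ f g ξ η
  rw [integral_conj, HaarSystem.pairMeasure, Measure.integral_compProd hi, ← integral_conj]
  refine integral_congr_ae ?_
  -- The vector tested is `π(g(x)) ξ(s(x))`, which varies within one fibre of `r`. The null set in
  -- the base must therefore be independent of the vector.
  filter_upwards [lam.ae_nu_of_ae_base μ (ae_inner_eq_integral_pointSection hF hμ f hθ)] with x hx
  rw [lam.rangeKernel_apply, integral_mul_const, integrand, map_mul, Complex.conj_ofReal, coeff,
    ← inner_conj_symm, hx]
  rfl

/-- The change of variables `(x, y) ↦ (y⁻¹, y⁻¹ x)` in the integrated form of a convolution. -/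
theorem IsBorel.integral_integrand_conv (f g : GammaC E) (ξ η : 𝓗.PreL2 μ) :
    ∫ x, F.integrand lam μ (GammaC.conv lam f g).1 ξ.sec η.sec x ∂(lam.nu μ) =
      ∫ q : G × G, starRingEnd ℂ (F.pairCoeff (GammaC.star f).1 g.1 ξ.sec η.sec q.swap *
        ((lam.Delta μ q.2 ^ (-1 / 2 : ℝ) : ℝ) : ℂ) *
        ((lam.Delta μ q.1 ^ (-1 / 2 : ℝ) : ℝ) : ℂ)) ∂(lam.pairMeasure μ) := by
  have hswap : MeasurePreserving (Prod.swap : G × G → G × G) (lam.pairMeasure μ)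
      (lam.pairMeasure μ) := ⟨measurable_swap, lam.map_swap_pairMeasure μ⟩
  have hemb : MeasurableEmbedding (Prod.swap : G × G → G × G) :=
    MeasurableEquiv.prodComm.measurableEmbedding
  let w : G → ℂ := fun x => ((lam.Delta μ x ^ (-1 / 2 : ℝ) : ℝ) : ℂ)
  have hw : Measurable w := lam.measurable_Delta_rpow
  let K : G × G → ℂ := fun p => starRingEnd ℂ (F.pairCoeff (GammaC.star f).1 g.1 ξ.sec η.sec p)
  have hK : Measurable K := Complex.continuous_conj.measurable.comp
    (hF.measurable_pairCoeff (GammaC.star f) g ξ.borel η.borel)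
  -- The weight is chosen so that `h (reorigin (y, x))` carries `Δ(x)^{-1/2}`, because `reorigin` is
  -- an involution.
  let h : G × G → ℂ := fun p => K p * w (reorigin p).2
  have hh : Measurable h := hK.mul (hw.comp (measurable_snd.comp measurable_reorigin))
  have h1 : (fun p => (lam.Delta μ p.1)⁻¹ • h p) =ᵐ[lam.pairMeasure μ] fun p =>
      starRingEnd ℂ (F.pairCoeff (GammaC.star f).1 g.1 ξ.sec η.sec p *
        ((lam.Delta μ p.1 ^ (-1 / 2 : ℝ) : ℝ) : ℂ) *
        ((lam.Delta μ p.2 ^ (-1 / 2 : ℝ) : ℝ) : ℂ)) := by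
    filter_upwards [lam.Delta_cocycle hμ, lam.ae_commonRange μ,
      lam.ae_pairMeasure_fst μ (lam.Delta_pos hμ)] with p hp hp' hpos
    -- Here the cocycle identity splits the Jacobian and the weight symmetrically between the two
    -- variables.
    have h2 : (lam.Delta μ p.1)⁻¹ * lam.Delta μ (p.1⁻¹ * p.2) ^ (-1 / 2 : ℝ) =
        lam.Delta μ p.1 ^ (-1 / 2 : ℝ) * lam.Delta μ p.2 ^ (-1 / 2 : ℝ) := by
      rw [← hp, Real.mul_rpow hpos.le (lam.Delta_nonneg _), ← _root_.mul_assoc,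
        ← Real.rpow_add hpos, show (-1 / 2 : ℝ) + -1 / 2 = -1 by norm_num, Real.rpow_neg_one]
    simp only [h, K, w, reorigin_of_mem hp', map_mul, Complex.conj_ofReal, Complex.real_smul]
    rw [_root_.mul_assoc, ← Complex.ofReal_mul, ← h2, Complex.ofReal_mul]
    ring
  -- Fubini's theorem needs integrability before the change of variables; it is read off from the
  -- pair form obtained after it.
  have hint : Integrable (fun p => h (reorigin p)) (lam.pairMeasure μ) := by
    refine (lam.integrable_comp_reorigin hμ hh.aestronglyMeasurable).2 ?_
    refine Integrable.congr ?_ h1.symm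
    have h2 := hswap.integrable_comp_emb hemb |>.2
      (hF.integrable_pairCoeff hμ (GammaC.star f) g ξ η)
    exact (Complex.conjLIE.integrable_comp_iff).2 h2
  have h3 := (hswap.integrable_comp_emb hemb).2 hint
  have h4 : ∫ x, F.integrand lam μ (GammaC.conv lam f g).1 ξ.sec η.sec x ∂(lam.nu μ) =
      ∫ x, ∫ y, h (reorigin (y, x)) ∂(lam.lam (r x)) ∂(lam.nu μ) := by
    refine integral_congr_ae (Eventually.of_forall fun x => ?_)
    have h5 : ∀ᵐ y ∂(lam.lam (r x)), h (reorigin (y, x)) =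
        inner ℂ (η.sec (r x)) (F.π (convIntegrand f.1 g.1 x y) (ξ.sec (s x))) * w x := by
      filter_upwards [lam.ae_r_eq (r x)] with y hy
      have h6 : (y, x) ∈ commonRange G := hy
      simp only [h, involutive_reorigin (y, x)]
      rw [reorigin_of_mem h6, F.coeff_convIntegrand f g.1 _ _ hy]
    simp only
    rw [integral_congr_ae h5, integral_mul_const]
    -- The matrix coefficient is a bounded functional on `E x`, so it commutes with the Bochner
    -- integral defining `f * g (x)`.
    let ℓ : E x →L[ℂ] ℂ := LinearMap.mkContinuous
      { toFun := fun a => inner ℂ (η.sec (r x)) (F.π a (ξ.sec (s x)))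
        map_add' := fun a b => by simp
        map_smul' := fun c a => by simp }
      (‖η.sec (r x)‖ * ‖ξ.sec (s x)‖) (fun a => by
        refine (norm_inner_le_norm _ _).trans ?_
        calc ‖η.sec (r x)‖ * ‖F.π a (ξ.sec (s x))‖
            ≤ ‖η.sec (r x)‖ * (‖a‖ * ‖ξ.sec (s x)‖) := by
              gcongr
              exact (F.π a).le_of_opNorm_le (F.norm_π_le _) _
          _ = _ := by ring)
    have h7 := ℓ.integral_comp_comm (integrable_convIntegrand lam f g x)
    exact congrArg (· * w x) h7.symm
  have h5 := Measure.integral_compProd (μ := lam.nu μ) (κ := lam.rangeKernel) h3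
  simp only [Function.comp_apply, Prod.swap_prod_mk, lam.rangeKernel_apply] at h5
  rw [h4, ← h5]
  change ∫ q : G × G, h (reorigin q.swap) ∂(lam.pairMeasure μ) = _
  rw [hswap.integral_comp hemb (fun p => h (reorigin p)),
    lam.integral_comp_reorigin hμ hh.aestronglyMeasurable, integral_congr_ae h1,
    ← hswap.integral_comp hemb]
  rfl

omit hF in
-- The coefficient of `f*` at `x` is the conjugate of that of `f` at `x⁻¹`, and `Δ^{-1/2} ν` is
-- invariant under inversion.
theorem integral_integrand_star (f : GammaC E) (ξ η : 𝓗.PreL2 μ) :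
    ∫ x, F.integrand lam μ (GammaC.star f).1 ξ.sec η.sec x ∂(lam.nu μ) =
      starRingEnd ℂ (∫ x, F.integrand lam μ f.1 η.sec ξ.sec x ∂(lam.nu μ)) := by
  have h := lam.integral_comp_inv_mul_Delta hμ
    (fun x => starRingEnd ℂ (F.coeff f.1 η.sec ξ.sec x))
  simp only [← F.coeff_star] at h
  rw [← integral_conj]
  simp only [integrand, map_mul, Complex.conj_ofReal]
  exact h

end StarFunctor

end Multiplicative

/-! ### The integrated form as a `*`-homomorphism -/

theorem BorelHilbertBundle.L2.clm_ext {X : Type u₀} [MeasurableSpace X] {H : X → Type w}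
    [∀ a, NormedAddCommGroup (H a)] [∀ a, InnerProductSpace ℂ (H a)] [∀ a, CompleteSpace (H a)]
    {𝓗 : BorelHilbertBundle H} {μ : Measure X} {S T : 𝓗.L2 μ →L[ℂ] 𝓗.L2 μ}
    (h : ∀ ξ η : 𝓗.PreL2 μ, inner ℂ (SeparationQuotient.mk η) (S (SeparationQuotient.mk ξ)) =
      inner ℂ (SeparationQuotient.mk η) (T (SeparationQuotient.mk ξ))) : S = T := by
  refine ContinuousLinearMap.ext fun x => ext_inner_left ℂ fun y => ?_
  obtain ⟨ξ, rfl⟩ := SeparationQuotient.surjective_mk x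
  obtain ⟨η, rfl⟩ := SeparationQuotient.surjective_mk y
  exact h ξ η

open TopologicalGroupoid in
theorem mainTheorem5 {G₀ : Type u₀} {G : Type u} [TopologicalSpace G₀] [TopologicalSpace G]
    [TopologicalGroupoid G₀ G] [T2Space G] [LocallyCompactSpace G] [SecondCountableTopology G]
    [MeasurableSpace G₀] [BorelSpace G₀] [MeasurableSpace G] [BorelSpace G]
    (lam : HaarSystem G₀ G)
    (E : G → Type v) [∀ x, NormedAddCommGroup (E x)] [∀ x, NormedSpace ℂ (E x)]
    [∀ x, CompleteSpace (E x)] [TopologicalSpace (Tot E)] [FellBundle E]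
    (μ : Measure G₀) [IsLocallyFiniteMeasure μ] (hμ : lam.QuasiInvariant μ)
    (H : G₀ → Type w) [∀ a, NormedAddCommGroup (H a)] [∀ a, InnerProductSpace ℂ (H a)]
    [∀ a, CompleteSpace (H a)] (𝓗 : BorelHilbertBundle H)
    (F : StarFunctor E H) (hF : F.IsBorel 𝓗) :
    ∃! L : GammaC E →ₗ[ℂ] (𝓗.L2 μ →L[ℂ] 𝓗.L2 μ),
      (∀ (f : GammaC E) (ξ η : 𝓗.PreL2 μ),
        Integrable (fun x : G => inner ℂ (η.sec (r x)) (F.π (f.1 x) (ξ.sec (s x))) *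
          ((lam.Delta μ x ^ (-1 / 2 : ℝ) : ℝ) : ℂ)) (lam.nu μ) ∧
        inner ℂ (SeparationQuotient.mk η) (L f (SeparationQuotient.mk ξ)) =
          ∫ x, inner ℂ (η.sec (r x)) (F.π (f.1 x) (ξ.sec (s x))) *
            ((lam.Delta μ x ^ (-1 / 2 : ℝ) : ℝ) : ℂ) ∂(lam.nu μ)) ∧
      (∀ f : GammaC E, ‖L f‖ ≤ normI lam f.1) ∧
      (∀ f g : GammaC E, ∃ h : GammaC E, (∀ x, h.1 x = conv lam f.1 g.1 x) ∧
        L h = (L f).comp (L g)) ∧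
      (∀ f : GammaC E, L (GammaC.star f) = ContinuousLinearMap.adjoint (L f)) := by
  have hi := hF.integrable_integrand hμ
  choose L hL hn using hF.exists_operator hμ
  let Λ : GammaC E →ₗ[ℂ] (𝓗.L2 μ →L[ℂ] 𝓗.L2 μ) :=
    { toFun := L
      map_add' := fun f g => BorelHilbertBundle.L2.clm_ext fun ξ η => by
        rw [_root_.add_apply, inner_add_right, hL, hL, hL,
          ← integral_add (hi f ξ η) (hi g ξ η)]
        refine integral_congr_ae (Eventually.of_forall fun x => ?_)
        simp only [StarFunctor.integrand, StarFunctor.coeff]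
        rw [← add_mul, ← inner_add_right, ← _root_.add_apply, ← map_add]
        rfl
      map_smul' := fun c f => BorelHilbertBundle.L2.clm_ext fun ξ η => by
        rw [_root_.smul_apply, inner_smul_right, hL, hL, ← integral_const_mul]
        refine integral_congr_ae (Eventually.of_forall fun x => ?_)
        simp only [StarFunctor.integrand, StarFunctor.coeff]
        rw [← _root_.mul_assoc, ← inner_smul_right, ← _root_.smul_apply,
          ← map_smul]
        rfl }
  have hstar : ∀ f : GammaC E, L (GammaC.star f) = ContinuousLinearMap.adjoint (L f) := by
    refine fun f => BorelHilbertBundle.L2.clm_ext fun ξ η => ?_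
    rw [ContinuousLinearMap.adjoint_inner_right, ← inner_conj_symm (L f _), hL, hL,
      StarFunctor.integral_integrand_star hμ]
  refine ⟨Λ, ⟨fun f ξ η => ⟨hi f ξ η, hL f η ξ⟩, hn, fun f g => ⟨GammaC.conv lam f g,
    fun x => rfl, ?_⟩, hstar⟩, fun T hT => ?_⟩
  · refine BorelHilbertBundle.L2.clm_ext fun ξ η => ?_
    -- A section `θ` representing `L(f*) η` turns `⟪η, L(f) L(g) ξ⟫` into `⟪θ, L(g) ξ⟫`, to which
    -- the defining integral of `L(g)` applies.
    obtain ⟨θ, hθ⟩ :=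
      SeparationQuotient.surjective_mk (L (GammaC.star f) (SeparationQuotient.mk η))
    change inner ℂ (SeparationQuotient.mk η) (L (GammaC.conv lam f g) (SeparationQuotient.mk ξ)) =
      inner ℂ (SeparationQuotient.mk η) (L f (L g (SeparationQuotient.mk ξ)))
    rw [← ContinuousLinearMap.adjoint_inner_left (L f), ← hstar, ← hθ, hL, hL,
      hF.integral_integrand_conv hμ, hF.integral_pairCoeff hμ (GammaC.star f) g (θ := θ)]
    intro ζ
    rw [← hL, ← hθ]
    rfl
  -- The integral formula alone fixes all matrix coefficients, hence the operator.
  · refine LinearMap.ext fun f => BorelHilbertBundle.L2.clm_ext fun ξ η => ?_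
    exact (hT.1 f ξ η).2.trans (hL f η ξ).symm
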